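/- **Model.** Let $G=(V,W,E)$ be a finite bipartite graph with server set $V$, $N=|V|\ge 1$, task-type set $W$, $M=|W|\ge 1$, and $E\subseteq V\times W$. Write $\mathcal N_v=\{w:(v,w)\in E\}$, $\mathcal N_w=\{v:(v,w)\in E\}$, $d_w=|\mathcal N_w|$, and assume $d_w\ge 1$ for every $w\in W$. Let $0<\lambda<1$ and let $d\ge 2$ be an integer. Tasks of each type arrive as independent Poisson processes of rate $\lambda N/M$. A task of type $w$ samples $d$ servers uniformly at random with replacement from $\mathcal N_w$ and joins a shortest queue among the sampled servers, ties being broken at random; service times are independent and exponential with mean one, and each server handles its queue one task at a time. Let $X(t)=(X_v(t))_{v\in V}$ be the resulting queue length process (a càdlàg Markov jump process on $\mathbb Z_{\ge 0}^V$), with arbitrary, possibly random, initial state, and put, for $i\ge 0$ and $w\in W$, $$q_i^N(t)=\frac1N\,\big|\{v\in V:X_v(t)\ge i\}\big|,\qquad q_i^{N,w}(t)=\frac1{d_w}\,\big|\{v\in\mathcal N_w:X_v(t)\ge i\}\big|.$$ Define $$\rho(G)=\max_{v\in V}\frac{\lambda N}{M}\sum_{w\in\mathcal N_v}\frac1{d_w},\qquad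 \phi(G)=\max_{v\in V}\Big|\frac NM\sum_{w\in\mathcal N_v}\frac1{d_w}-1\Big|,\qquad \gamma(G)=\frac1M\sum_{w\in W}\frac1{d_w}.$$ **Mean-field system.** Let $\mathcal S$ be the set of sequences $(q_i)_{i\ge 0}$ with $1=q_0\ge q_1\ge q_2\ge\dots\ge 0$. An $\mathcal S$-valued function $\bar{\boldsymbol q}$ on $[0,\infty)$ is a solution of the mean-field system if $$\frac{d\bar q_i(t)}{dt}=\lambda\big(\bar q_{i-1}(t)^d-\bar q_i(t)^d\big)-\big(\bar q_i(t)-\bar q_{i+1}(t)\big),\qquad i\ge 1,\ t\ge 0,$$ with a one-sided derivative at $t=0$. **Theorem.** Let $d\ge 2$ be an integer and $\rho_0<1$. (a) For every $0<\lambda<1$ and every $p\in\mathcal S$ the mean-field system has a unique $\mathcal S$-valued solution on $[0,\infty)$ with initial value $p$. (b) There exists a constant $c\ge 1$, depending only on $\rho_0$ and $d$, such that for every $\lambda\in(0,1)$ and every graph $G$ as above with $\rho(G)\le\rho_0$, every solution $\bar{\boldsymbol q}$ of the mean-field system in $\mathcal S$, every queue length process $X$ as above and all $t\ge 0$, $$\begin{aligned}\mathbb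 E\Big[\sup_{s\in[0,t]}\sum_{i=1}^\infty\big(q_i^N(s)-\bar q_i(s)\big)^2\Big]\le{}& 2\phi(G)^2\Big(\lambda t+\mathbb E\Big[\sum_{i=1}^\infty q_i^N(0)^2\Big]\Big)\\&+12e^{ct^2}\Big(t^2d^2\phi(G)^2+\mathbb E\Big[\sum_{i=1}^\infty\Big(\frac1M\sum_{w\in W}\big|q_i^{N,w}(0)-\bar q_i(0)\big|\Big)^2\Big]+4t(\rho_0d+1)\gamma(G)\Big).\end{aligned}$$ Both sides take values in $[0,\infty]$, with the convention $0\cdot\infty=0$. -/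

import Mathlib

open scoped NNReal ENNReal

noncomputable section

namespace SpatialLoadBalancing

open MeasureTheory ProbabilityTheory Filter Topology
open scoped Classical

variable {V W : Type*} [Fintype V] [Fintype W]

/-- For a bipartite compatibility graph with server set `V`, set of task types `W` and edge set
`E ⊆ V × W`: the task types compatible with the server `v`. -/
def typesOf (E : Finset (V × W)) (v : V) : Finset W :=
  Finset.univ.filter fun w => (v, w) ∈ E

/-- The servers compatible with the task type `w`. -/
def serversOf (E : Finset (V × W)) (w : W) : Finset V :=
  Finset.univ.filter fun v => (v, w) ∈ E

/-- The degree `d_w` of the task type `w`. -/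
def typeDeg (E : Finset (V × W)) (w : W) : ℕ := (serversOf E w).card

/-- `(N / M) * ∑_{w ∈ 𝒩_v} 1 / d_w`, where `N = |V|` and `M = |W|`. -/
def serverWeight (E : Finset (V × W)) (v : V) : ℝ :=
  (Fintype.card V : ℝ) / Fintype.card W * ∑ w ∈ typesOf E v, 1 / (typeDeg E w : ℝ)

/-- The load `ρ(G) = max_v (lam N / M) ∑_{w ∈ 𝒩_v} 1 / d_w`; the supremum is over the finite set
of servers. -/
def graphLoad (lam : ℝ) (E : Finset (V × W)) : ℝ :=
  ⨆ v : V, lam * serverWeight E v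

/-- `φ(G) = max_v |(N / M) ∑_{w ∈ 𝒩_v} 1 / d_w - 1|`. -/
def graphPhi (E : Finset (V × W)) : ℝ :=
  ⨆ v : V, |serverWeight E v - 1|

/-- `γ(G) = (1 / M) ∑_w 1 / d_w`. -/
def graphGamma (E : Finset (V × W)) : ℝ :=
  1 / (Fintype.card W : ℝ) * ∑ w : W, 1 / (typeDeg E w : ℝ)

/-- The fraction of all servers with queue length at least `i`, in the queue length state `x`. -/
def globalFrac (x : V → ℕ) (i : ℕ) : ℝ :=
  ((Finset.univ.filter fun v => i ≤ x v).card : ℝ) / Fintype.card V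

/-- The fraction of the servers compatible with `w` that have queue length at least `i`. -/
def localFrac (E : Finset (V × W)) (x : V → ℕ) (w : W) (i : ℕ) : ℝ :=
  (((serversOf E w).filter fun v => i ≤ x v).card : ℝ) / typeDeg E w

/-- The positions `k` of a sample `s` of `d` servers at which the queue length is minimal among
the sampled servers. -/
def shortestPositions {d : ℕ} (x : V → ℕ) (s : Fin d → V) : Finset (Fin d) :=
  Finset.univ.filter fun k => ∀ j, x (s k) ≤ x (s j)

/-- The probability that, given the sample `s`, the task goes to `v`: a position is drawn uniformly
among those of minimal queue length. -/
def tieBreakProb {d : ℕ} (x : V → ℕ) (s : Fin d → V) (v : V) : ℝ :=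
  (((shortestPositions x s).filter fun k => s k = v).card : ℝ) / (shortestPositions x s).card

/-- The probability that a task of type `w`, arriving in state `x`, is assigned to `v`: the `d`
servers are sampled uniformly with replacement from the `d_w` servers compatible with `w`, and the
task joins a shortest of the sampled queues, ties broken at random. -/
def routeProb (d : ℕ) (E : Finset (V × W)) (x : V → ℕ) (w : W) (v : V) : ℝ :=
  (∑ s ∈ Fintype.piFinset (fun _ : Fin d => serversOf E w), tieBreakProb x s v) /
    (typeDeg E w : ℝ) ^ d

/-- The rate at which tasks join the queue of `v` in state `x`: each type arrives at rate
`lam N / M`. -/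
def joinRate (lam : ℝ) (d : ℕ) (E : Finset (V × W)) (x : V → ℕ) (v : V) : ℝ :=
  ∑ w : W, lam * Fintype.card V / Fintype.card W * routeProb d E x w v

/-- The generator of the queue length Markov process: tasks join the queue of `v` at rate
`joinRate`, and every nonempty queue loses a task at rate one. -/
def queueGenerator (lam : ℝ) (d : ℕ) (E : Finset (V × W)) (f : (V → ℕ) → ℝ) (x : V → ℕ) : ℝ :=
  ∑ v : V, (joinRate lam d E x v * (f (Function.update x v (x v + 1)) - f x) +
    if 0 < x v then f (Function.update x v (x v - 1)) - f x else 0)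

/-- `X` is a queue length process of the system (a Markov jump process with generator
`queueGenerator` and arbitrary, possibly random, initial state): it is adapted to `𝓕`, has
right-continuous paths with left limits in the discrete space `V → ℕ`, and solves the martingale
problem for `queueGenerator`. As all jump rates are bounded, this determines the law of `X` from
the law of `X 0`. -/
structure IsQueueProcess (lam : ℝ) (d : ℕ) (E : Finset (V × W)) {Ω : Type*}
    {mΩ : MeasurableSpace Ω} (P : Measure Ω) (𝓕 : Filtration ℝ≥0 mΩ)
    (X : ℝ≥0 → Ω → V → ℕ) : Prop where
  adapted : ∀ t, Measurable[𝓕 t] (X t)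
  rightCont : ∀ ω t, ContinuousWithinAt (fun s => X s ω) (Set.Ici t) t
  leftLim : ∀ ω t, ∃ l : V → ℕ, Tendsto (fun s => X s ω) (𝓝[<] t) (𝓝 l)
  martingale : ∀ f : (V → ℕ) → ℝ, (∃ C, ∀ x, |f x| ≤ C) →
    Martingale (fun (t : ℝ≥0) ω => f (X t ω) - f (X 0 ω) -
      ∫ s in (0 : ℝ)..(t : ℝ), queueGenerator lam d E f (X s.toNNReal ω)) 𝓕 P

/-- The space of occupancy sequences `1 = q 0 ≥ q 1 ≥ q 2 ≥ ⋯ ≥ 0`. -/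
def occupancySpace : Set (ℕ → ℝ) :=
  {q | q 0 = 1 ∧ Antitone q ∧ ∀ i, 0 ≤ q i}

/-- `qbar` is a solution on `[0, ∞)`, in the space of occupancy sequences, of the mean-field system
`d/dt q_i = lam (q_{i-1}^d - q_i^d) - (q_i - q_{i+1})`, `i ≥ 1`, with `q_0 = 1`. The derivative
at time `0` is one-sided. -/
structure IsMeanFieldSolution (lam : ℝ) (d : ℕ) (qbar : ℝ → ℕ → ℝ) : Prop where
  mem : ∀ t, 0 ≤ t → qbar t ∈ occupancySpace
  ode : ∀ i, 1 ≤ i → ∀ t, 0 ≤ t → HasDerivWithinAt (fun s => qbar s i)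
    (lam * (qbar t (i - 1) ^ d - qbar t i ^ d) - (qbar t i - qbar t (i + 1))) (Set.Ici 0) t

/-- `∑_{i ≥ 1} a_i ^ 2` as an extended nonnegative number. -/
def sqSum (a : ℕ → ℝ) : ℝ≥0∞ := ∑' i : ℕ, ENNReal.ofReal (a (i + 1) ^ 2)

/-- `(1 / M) ∑_w |q_i^w - p_i|`, the average over the task types of the discrepancy between the
local occupancy fractions in the state `x` and the sequence `p`. -/
def localDiscrepancy (E : Finset (V × W)) (x : V → ℕ) (p : ℕ → ℝ) (i : ℕ) : ℝ :=
  1 / (Fintype.card W : ℝ) * ∑ w : W, |localFrac E x w i - p i|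

end SpatialLoadBalancing

end

open MeasureTheory ProbabilityTheory SpatialLoadBalancing

namespace SpatialLoadBalancing

/-! ### Existence and uniqueness for the mean-field system. -/

section MeanField

open Filter Topology

/-! Mean-field system. Since `x ↦ d * x - x ^ d` is nondecreasing on `[0, 1]`, adding `(lam * d + 1)
* q` to the drift makes it monotone in `q` and nonincreasing in the level. Variation of constants
then yields an order-preserving map on occupancy-valued curves. Iterating it downwards from the
constant `1` converges, and dominated convergence makes the limit a fixed point. Uniqueness comes
from the sup-norm Lipschitz constant `2 * lam * d + 2`, iterated to a bound `(C t) ^ n / n!`.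

Process bound. Compatible servers of equal queue length are exchangeable, so a task of type `w`
joins a given compatible server of length `j` with probability `powQuot d q_j q_{j+1} / d_w`, where
`q_j` denotes `localFrac E x w j` (`routeProb_eq`). This makes the drift of each local fraction
explicit. Averaged over types, its distance to the mean-field drift is at most a Lipschitz term in
the averaged discrepancies `D_j, D_{j+1}, D_{j+2}` plus a bias `d * φ` times the mass at level `j`
(`average_drift_sub_le`). The averaging matters: a server sees the errors of all its types, but
double counting and `ρ ≤ 1` return at most the mean error over types.

The martingale parts are controlled by Doob's inequality and the carré du champ. A jump changes only
one level of `localFrac`, by `1 / d_w`, so the sum over all levels is of order `1 / d_w` and its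
average over types is of order `γ` (`IsQueueProcess.lintegral_martEnergy_le`). A pathwise Grönwall
argument then bounds `∑ D_j ^ 2`; since this sum may be infinite, it is run with weights `θ ^ j`,
uniformly in `θ < 1` (`IsQueueProcess.weighted_discrepancy_le`).

Finally `globalFrac` differs from the type average of the local fractions by at most `φ * min q (1 /
2)`, as the server weights average to one. The energy `∑ min q_i (1 / 2) ^ 2` is monotone in the
state and grows by at most `1 / N` per arrival. Arrivals have total rate `lam * N`, so the expected
running supremum grows by at most `lam * t` (`IsQueueProcess.lintegral_iSup_energy_le`), which
explains the first term of the bound. -/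

theorem abs_pow_sub_pow_le_of_mem_Icc {a b : ℝ} (n : ℕ) (ha : 0 ≤ a) (ha' : a ≤ 1) (hb : 0 ≤ b)
    (hb' : b ≤ 1) : |a ^ n - b ^ n| ≤ n * |a - b| := by
  refine (abs_pow_sub_pow_le a b n).trans ?_
  have : max |a| |b| ^ (n - 1) ≤ 1 := by
    apply pow_le_one₀ (by positivity)
    rw [abs_of_nonneg ha, abs_of_nonneg hb]; exact max_le ha' hb'
  calc |a - b| * n * max |a| |b| ^ (n - 1) ≤ |a - b| * n * 1 := by gcongr
    _ = _ := by ring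

/-- The slope of `x ^ n` on `[0, 1]` never exceeds `n`. This absorbs the only decreasing dependence
in the arrival part of the drift. -/
theorem mul_sub_pow_mono {a b : ℝ} (n : ℕ) (ha : 0 ≤ a) (hab : a ≤ b) (hb : b ≤ 1) :
    n * a - a ^ n ≤ n * b - b ^ n := by
  have := abs_pow_sub_pow_le_of_mem_Icc n (ha.trans hab) hb ha (hab.trans hb)
  rw [abs_of_nonneg (sub_nonneg.2 hab)] at this
  have := (le_abs_self _).trans this
  linarith

theorem occupancy_nonneg {q : ℕ → ℝ} (hq : q ∈ occupancySpace) (i : ℕ) : 0 ≤ q i := hq.2.2 i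

theorem occupancy_le_one {q : ℕ → ℝ} (hq : q ∈ occupancySpace) (i : ℕ) : q i ≤ 1 :=
  hq.1 ▸ hq.2.1 (Nat.zero_le i)

theorem occupancy_succ_le {q : ℕ → ℝ} (hq : q ∈ occupancySpace) (i : ℕ) : q (i + 1) ≤ q i :=
  hq.2.1 (Nat.le_succ i)

/-- The mean-field drift plus `lam * d + 1` times the state; it is monotone on occupancy
sequences. -/
noncomputable def shiftedDrift (lam : ℝ) (d : ℕ) (q : ℕ → ℝ) : ℕ → ℝ
  | 0 => lam * d + 1
  | i + 1 => lam * (q i ^ d + (d * q (i + 1) - q (i + 1) ^ d)) + q (i + 2)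

variable {lam : ℝ} {d : ℕ}

theorem shiftedDrift_mono (hlam : 0 ≤ lam) {q q' : ℕ → ℝ} (hq : q ∈ occupancySpace)
    (hq' : q' ∈ occupancySpace) (h : q ≤ q') (i : ℕ) :
    shiftedDrift lam d q i ≤ shiftedDrift lam d q' i := by
  cases i with
  | zero => exact le_rfl
  | succ i =>
    simp only [shiftedDrift]
    have h1 := mul_sub_pow_mono d (occupancy_nonneg hq (i + 1)) (h (i + 1))
      (occupancy_le_one hq' (i + 1))
    have h2 := pow_le_pow_left₀ (occupancy_nonneg hq i) (h i) d
    have h3 := h (i + 2)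
    gcongr

theorem shiftedDrift_nonneg (hlam : 0 ≤ lam) (hd : 1 ≤ d) {q : ℕ → ℝ} (hq : q ∈ occupancySpace)
    (i : ℕ) : 0 ≤ shiftedDrift lam d q i := by
  cases i with
  | zero => simp only [shiftedDrift]; positivity
  | succ i =>
    simp only [shiftedDrift]
    have h1 := mul_sub_pow_mono d le_rfl (occupancy_nonneg hq (i + 1))
      (occupancy_le_one hq (i + 1))
    rw [zero_pow (by lia)] at h1
    have h2 := pow_nonneg (occupancy_nonneg hq i) d
    have h3 := occupancy_nonneg hq (i + 2)
    have : 0 ≤ q i ^ d + (d * q (i + 1) - q (i + 1) ^ d) := by linarith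
    positivity

/-- Monotonicity in the level is what keeps the iterates occupancy sequences. Component `0` is set
to `lam * d + 1`, the shift times `q 0 = 1`; it dominates component `1` because `d * q 1 - q 1 ^ d ≤
d - 1`. -/
theorem shiftedDrift_antitone (hlam : 0 ≤ lam) {q : ℕ → ℝ}
    (hq : q ∈ occupancySpace) : Antitone (shiftedDrift lam d q) := by
  refine antitone_nat_of_succ_le fun i => ?_
  have hm (j : ℕ) := mul_sub_pow_mono d (occupancy_nonneg hq (j + 1)) (occupancy_succ_le hq j)
      (occupancy_le_one hq j)
  cases i with
  | zero =>
    simp only [shiftedDrift, Nat.zero_add]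
    have h1 := hm 0
    rw [hq.1] at h1 ⊢
    simp only [one_pow, mul_one, zero_add] at h1 ⊢
    have h3 := occupancy_le_one hq 2
    have : lam * (1 + (d * q 1 - q 1 ^ d)) ≤ lam * d := by gcongr; linarith
    linarith
  | succ i =>
    simp only [shiftedDrift]
    have h1 := hm (i + 1)
    have h2 := pow_le_pow_left₀ (occupancy_nonneg hq (i + 1)) (occupancy_succ_le hq i) d
    have h3 := occupancy_succ_le hq (i + 2)
    gcongr

theorem shiftedDrift_le (hlam : 0 ≤ lam) {q : ℕ → ℝ}
    (hq : q ∈ occupancySpace) (i : ℕ) : shiftedDrift lam d q i ≤ lam * d + 1 :=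
  shiftedDrift_antitone hlam hq (Nat.zero_le i)

theorem measurable_shiftedDrift {α : Type*} [MeasurableSpace α] {q : α → ℕ → ℝ}
    (hq : ∀ i, Measurable fun s => q s i) (i : ℕ) :
    Measurable fun s => shiftedDrift lam d (q s) i := by
  cases i with
  | zero => exact measurable_const
  | succ i =>
    simp only [shiftedDrift]
    have h0 := hq i
    have h1 := hq (i + 1)
    have h2 := hq (i + 2)
    fun_prop

theorem continuous_shiftedDrift {q : ℝ → ℕ → ℝ}
    (hq : ∀ i, Continuous fun s => q s i) (i : ℕ) :
    Continuous fun s => shiftedDrift lam d (q s) i := by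
  cases i with
  | zero => exact continuous_const
  | succ i =>
    simp only [shiftedDrift]
    have h0 := hq i
    have h1 := hq (i + 1)
    have h2 := hq (i + 2)
    fun_prop

/-- The integral operator (variation of constants) whose fixed points solve the mean-field
system; the curve is extended by its initial value to negative times. -/
noncomputable def picardMap (lam : ℝ) (d : ℕ) (p : ℕ → ℝ) (q : ℝ → ℕ → ℝ) (t : ℝ) (i : ℕ) : ℝ :=
  Real.exp (-((lam * d + 1) * max t 0)) *
    (p i + ∫ s in (0 : ℝ)..(max t 0),
      Real.exp ((lam * d + 1) * s) * shiftedDrift lam d (q s) i)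

theorem intervalIntegrable_shiftedDrift (hlam : 0 ≤ lam) (hd : 1 ≤ d) {q : ℝ → ℕ → ℝ}
    (hq : ∀ i, Measurable fun s => q s i) (hS : ∀ t, q t ∈ occupancySpace) (i : ℕ) (a b : ℝ) :
    IntervalIntegrable
      (fun s => Real.exp ((lam * d + 1) * s) * shiftedDrift lam d (q s) i) volume a b := by
  have hm := measurable_shiftedDrift (lam := lam) (d := d) hq i
  have h1 : IntervalIntegrable (fun s => Real.exp ((lam * d + 1) * s) * (lam * d + 1))
      volume a b := Continuous.intervalIntegrable (by fun_prop) _ _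
  refine h1.mono_fun (by fun_prop) (ae_of_all _ fun s => ?_)
  have h2 := shiftedDrift_nonneg hlam hd (hS s) i
  have h3 := shiftedDrift_le (d := d) hlam (hS s) i
  simp only [norm_mul, Real.norm_eq_abs, Real.abs_exp]
  rw [abs_of_nonneg h2, abs_of_nonneg (h2.trans h3)]
  gcongr

theorem continuous_picardMap (hlam : 0 ≤ lam) (hd : 1 ≤ d) {p : ℕ → ℝ} {q : ℝ → ℕ → ℝ}
    (hq : ∀ i, Measurable fun s => q s i) (hS : ∀ t, q t ∈ occupancySpace) (i : ℕ) :
    Continuous fun t => picardMap lam d p q t i := by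
  have h := intervalIntegral.continuous_primitive
    (fun a b => intervalIntegrable_shiftedDrift hlam hd hq hS i a b) 0
  unfold picardMap
  have hm : Continuous fun t : ℝ => max t 0 := by fun_prop
  have := h.comp hm
  simp only [Function.comp_def] at this
  fun_prop

theorem integral_exp_mul_shift (κ T : ℝ) :
    ∫ s in (0 : ℝ)..T, Real.exp (κ * s) * κ = Real.exp (κ * T) - 1 := by
  have := intervalIntegral.integral_eq_sub_of_hasDerivAt (a := 0) (b := T)
    (f := fun s => Real.exp (κ * s)) (f' := fun s => Real.exp (κ * s) * κ)
    (fun x _ => by simpa using ((hasDerivAt_id x).const_mul κ).exp)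
    (Continuous.intervalIntegrable (by fun_prop) _ _)
  simpa using this

theorem picardMap_mem (hlam : 0 ≤ lam) (hd : 1 ≤ d) {p : ℕ → ℝ} {q : ℝ → ℕ → ℝ}
    (hp : p ∈ occupancySpace)
    (hq : ∀ i, Measurable fun s => q s i) (hS : ∀ t, q t ∈ occupancySpace) (t : ℝ) :
    picardMap lam d p q t ∈ occupancySpace := by
  have hT : 0 ≤ max t 0 := le_max_right _ _
  refine ⟨?_, fun i j hij => ?_, fun i => ?_⟩
  -- With `κ = lam * d + 1`, component `0` is `exp (-κ t) * (1 + ∫ κ exp (κ s))`, which is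
  -- identically one.
  · simp only [picardMap, shiftedDrift]
    rw [integral_exp_mul_shift, hp.1, add_sub_cancel, ← Real.exp_add]
    simp
  · simp only [picardMap]
    gcongr
    · exact hp.2.1 hij
    · refine intervalIntegral.integral_mono_on hT
        (intervalIntegrable_shiftedDrift hlam hd hq hS j _ _)
        (intervalIntegrable_shiftedDrift hlam hd hq hS i _ _) fun s _ => ?_
      gcongr
      exact shiftedDrift_antitone hlam (hS s) hij
  · simp only [picardMap]
    refine mul_nonneg (Real.exp_nonneg _) (add_nonneg (hp.2.2 i) ?_)
    refine intervalIntegral.integral_nonneg hT fun s _ => ?_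
    exact mul_nonneg (Real.exp_nonneg _) (shiftedDrift_nonneg hlam hd (hS s) i)

theorem picardMap_mono (hlam : 0 ≤ lam) (hd : 1 ≤ d) {p : ℕ → ℝ} {q q' : ℝ → ℕ → ℝ}
    (hq : ∀ i, Measurable fun s => q s i) (hS : ∀ t, q t ∈ occupancySpace)
    (hq' : ∀ i, Measurable fun s => q' s i) (hS' : ∀ t, q' t ∈ occupancySpace)
    (h : ∀ t, q t ≤ q' t) (t : ℝ) : picardMap lam d p q t ≤ picardMap lam d p q' t := by
  intro i
  have hT : 0 ≤ max t 0 := le_max_right _ _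
  simp only [picardMap]
  gcongr
  refine intervalIntegral.integral_mono_on hT
    (intervalIntegrable_shiftedDrift hlam hd hq hS i _ _)
    (intervalIntegrable_shiftedDrift hlam hd hq' hS' i _ _) fun s _ => ?_
  gcongr
  exact shiftedDrift_mono hlam (hS s) (hS' s) (h s) i

/-- The monotone iteration started from the constant sequence one. -/
noncomputable def picardIter (lam : ℝ) (d : ℕ) (p : ℕ → ℝ) : ℕ → ℝ → ℕ → ℝ
  | 0 => fun _ _ => 1
  | n + 1 => picardMap lam d p (picardIter lam d p n)

/-- The three properties are proved together since the integral operator is monotone only on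
measurable occupancy-valued curves. The base of the descent is that every occupancy sequence lies
below the constant `1`. -/
theorem picardIter_spec (hlam : 0 ≤ lam) (hd : 1 ≤ d) {p : ℕ → ℝ}
    (hp : p ∈ occupancySpace) (n : ℕ) :
    (∀ i, Measurable fun s => picardIter lam d p n s i) ∧
      (∀ t, picardIter lam d p n t ∈ occupancySpace) ∧
      ∀ t, picardIter lam d p (n + 1) t ≤ picardIter lam d p n t := by
  induction n with
  | zero =>
    have h1 : ∀ i, Measurable fun s => picardIter lam d p 0 s i := fun i => measurable_const
    have h2 : ∀ t, picardIter lam d p 0 t ∈ occupancySpace :=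
      fun t => ⟨rfl, antitone_const, fun i => zero_le_one⟩
    exact ⟨h1, h2, fun t i => occupancy_le_one (picardMap_mem hlam hd hp h1 h2 t) i⟩
  | succ n ih =>
    obtain ⟨h1, h2, h3⟩ := ih
    have h1' : ∀ i, Measurable fun s => picardIter lam d p (n + 1) s i := fun i =>
      (continuous_picardMap hlam hd h1 h2 i).measurable
    have h2' : ∀ t, picardIter lam d p (n + 1) t ∈ occupancySpace :=
      picardMap_mem hlam hd hp h1 h2
    exact ⟨h1', h2', picardMap_mono hlam hd h1' h2' h1 h2 h3⟩

/-- The limit of the monotone iteration. -/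
noncomputable def picardLimit (lam : ℝ) (d : ℕ) (p : ℕ → ℝ) (t : ℝ) (i : ℕ) : ℝ :=
  ⨅ n, picardIter lam d p n t i

theorem tendsto_picardIter (hlam : 0 ≤ lam) (hd : 1 ≤ d) {p : ℕ → ℝ}
    (hp : p ∈ occupancySpace) (t : ℝ) (i : ℕ) :
    Tendsto (fun n => picardIter lam d p n t i) atTop (𝓝 (picardLimit lam d p t i)) := by
  refine tendsto_atTop_ciInf (antitone_nat_of_succ_le fun n =>
    (picardIter_spec hlam hd hp n).2.2 t i) ⟨0, ?_⟩
  rintro _ ⟨n, rfl⟩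
  exact ((picardIter_spec hlam hd hp n).2.1 t).2.2 i

theorem measurable_picardLimit (hlam : 0 ≤ lam) (hd : 1 ≤ d) {p : ℕ → ℝ}
    (hp : p ∈ occupancySpace) (i : ℕ) : Measurable fun t => picardLimit lam d p t i :=
  measurable_of_tendsto_metrizable (fun n => (picardIter_spec hlam hd hp n).1 i)
    (tendsto_pi_nhds.2 fun t => tendsto_picardIter hlam hd hp t i)

theorem picardLimit_mem (hlam : 0 ≤ lam) (hd : 1 ≤ d) {p : ℕ → ℝ}
    (hp : p ∈ occupancySpace) (t : ℝ) : picardLimit lam d p t ∈ occupancySpace := by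
  have h := tendsto_picardIter hlam hd hp t
  have hS := fun n => (picardIter_spec hlam hd hp n).2.1 t
  refine ⟨?_, fun i j hij => ?_, fun i => ?_⟩
  · refine tendsto_nhds_unique (h 0) ?_
    simp_rw [fun n => (hS n).1]
    exact tendsto_const_nhds
  · exact le_of_tendsto_of_tendsto' (h j) (h i) fun n => (hS n).2.1 hij
  · exact ge_of_tendsto' (h i) fun n => (hS n).2.2 i

theorem tendsto_shiftedDrift {q : ℕ → ℕ → ℝ} {q' : ℕ → ℝ}
    (h : ∀ i, Tendsto (fun n => q n i) atTop (𝓝 (q' i))) (i : ℕ) :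
    Tendsto (fun n => shiftedDrift lam d (q n) i) atTop (𝓝 (shiftedDrift lam d q' i)) := by
  cases i with
  | zero => exact tendsto_const_nhds
  | succ i =>
    exact ((((h i).pow d).add (((h (i + 1)).const_mul _).sub ((h (i + 1)).pow d))).const_mul
      lam).add (h (i + 2))

theorem picardMap_picardLimit (hlam : 0 ≤ lam) (hd : 1 ≤ d) {p : ℕ → ℝ}
    (hp : p ∈ occupancySpace) (t : ℝ) (i : ℕ) :
    picardMap lam d p (picardLimit lam d p) t i = picardLimit lam d p t i := by
  have hspec := picardIter_spec (lam := lam) hlam hd hp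
  refine tendsto_nhds_unique ?_ ((tendsto_add_atTop_iff_nat 1).2
    (tendsto_picardIter hlam hd hp t i))
  simp only [picardIter, picardMap]
  refine Tendsto.const_mul _ (Tendsto.const_add _ ?_)
  -- The uniform bound `shiftedDrift ≤ lam * d + 1` gives the dominating function.
  refine intervalIntegral.tendsto_integral_filter_of_dominated_convergence
    (fun s => Real.exp ((lam * d + 1) * s) * (lam * d + 1)) ?_ ?_ ?_ ?_
  · exact Eventually.of_forall fun n =>
      (intervalIntegrable_shiftedDrift hlam hd (hspec n).1 (hspec n).2.1 i _ _).def'.aestronglyMeasurable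
  · refine Eventually.of_forall fun n => ae_of_all _ fun s _ => ?_
    have h2 := shiftedDrift_nonneg hlam hd ((hspec n).2.1 s) i
    have h3 := shiftedDrift_le (d := d) hlam ((hspec n).2.1 s) i
    simp only [norm_mul, Real.norm_eq_abs, Real.abs_exp]
    rw [abs_of_nonneg h2]
    gcongr
  · exact Continuous.intervalIntegrable (by fun_prop) _ _
  · exact ae_of_all _ fun s _ => Tendsto.const_mul _
      (tendsto_shiftedDrift (fun j => tendsto_picardIter hlam hd hp s j) i)

theorem isMeanFieldSolution_picardLimit (hlam : 0 ≤ lam) (hd : 1 ≤ d) {p : ℕ → ℝ}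
    (hp : p ∈ occupancySpace) : IsMeanFieldSolution lam d (picardLimit lam d p) := by
  have hmeas := measurable_picardLimit (lam := lam) hlam hd hp
  have hmem := picardLimit_mem (lam := lam) hlam hd hp
  refine ⟨fun t _ => hmem t, fun i hi t ht => ?_⟩
  obtain ⟨i, rfl⟩ : ∃ j, i = j + 1 := ⟨i - 1, by lia⟩
  -- The limit is a priori only measurable. Being a fixed point of an integral operator it is
  -- continuous, and only then does the integrand have a derivative formula at every time.
  have hcont : ∀ j, Continuous fun s => picardLimit lam d p s j := fun j => by
    simpa only [picardMap_picardLimit hlam hd hp] using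
      continuous_picardMap (p := p) hlam hd hmeas hmem j
  have hΛ : Continuous fun s : ℝ =>
      Real.exp ((lam * d + 1) * s) * shiftedDrift lam d (picardLimit lam d p s) (i + 1) :=
    (by fun_prop : Continuous fun s : ℝ => Real.exp ((lam * d + 1) * s)).mul
      (continuous_shiftedDrift hcont (i + 1))
  have hI := intervalIntegral.integral_hasDerivAt_right (hΛ.intervalIntegrable 0 t)
    (hΛ.stronglyMeasurableAtFilter _ _) hΛ.continuousAt
  have hE : HasDerivAt (fun s : ℝ => Real.exp (-((lam * d + 1) * s)))
      (Real.exp (-((lam * d + 1) * t)) * (-(lam * d + 1))) t := by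
    simpa using (((hasDerivAt_id t).const_mul (lam * d + 1)).neg).exp
  have hder := (hE.mul (hI.const_add (p (i + 1)))).hasDerivWithinAt (s := Set.Ici 0)
  have hfix : ∀ s ∈ Set.Ici (0 : ℝ), picardLimit lam d p s (i + 1) =
      Real.exp (-((lam * d + 1) * s)) * (p (i + 1) + ∫ u in (0 : ℝ)..s,
        Real.exp ((lam * d + 1) * u) *
          shiftedDrift lam d (picardLimit lam d p u) (i + 1)) := fun s hs => by
    conv_lhs => rw [← picardMap_picardLimit hlam hd hp]
    simp only [picardMap, max_eq_left (Set.mem_Ici.1 hs)]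
  refine (hder.congr hfix (hfix t ht)).congr_deriv ?_
  have h1 := hfix t ht
  have h2 : Real.exp (-((lam * d + 1) * t)) * (Real.exp ((lam * d + 1) * t) *
      shiftedDrift lam d (picardLimit lam d p t) (i + 1)) =
      shiftedDrift lam d (picardLimit lam d p t) (i + 1) := by
    rw [← mul_assoc, ← Real.exp_add]; simp
  rw [h2, mul_right_comm, ← h1]
  simp only [shiftedDrift, Nat.add_sub_cancel]
  ring

theorem picardLimit_zero (hlam : 0 ≤ lam) (hd : 1 ≤ d) {p : ℕ → ℝ}
    (hp : p ∈ occupancySpace) : picardLimit lam d p 0 = p := by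
  ext i
  rw [← picardMap_picardLimit hlam hd hp]
  simp [picardMap]

theorem abs_drift_sub_le (hlam : 0 ≤ lam) {q q' : ℕ → ℝ} {B : ℝ} (hq : q ∈ occupancySpace)
    (hq' : q' ∈ occupancySpace) (hB : ∀ i, |q i - q' i| ≤ B) (i : ℕ) :
    |(lam * (q (i - 1) ^ d - q i ^ d) - (q i - q (i + 1))) -
      (lam * (q' (i - 1) ^ d - q' i ^ d) - (q' i - q' (i + 1)))| ≤ (2 * lam * d + 2) * B := by
  have h (j : ℕ) : |q j ^ d - q' j ^ d| ≤ d * B :=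
    (abs_pow_sub_pow_le_of_mem_Icc d (occupancy_nonneg hq j) (occupancy_le_one hq j)
      (occupancy_nonneg hq' j) (occupancy_le_one hq' j)).trans (by gcongr; exact hB j)
  have e : (lam * (q (i - 1) ^ d - q i ^ d) - (q i - q (i + 1))) -
      (lam * (q' (i - 1) ^ d - q' i ^ d) - (q' i - q' (i + 1))) =
      lam * ((q (i - 1) ^ d - q' (i - 1) ^ d) - (q i ^ d - q' i ^ d)) -
        ((q i - q' i) - (q (i + 1) - q' (i + 1))) := by ring
  rw [e]
  calc _ ≤ lam * (d * B + d * B) + (B + B) := by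
        refine (abs_sub _ _).trans (add_le_add ?_ ((abs_sub _ _).trans
          (add_le_add (hB _) (hB _))))
        rw [abs_mul, abs_of_nonneg hlam]
        gcongr
        exact (abs_sub _ _).trans (add_le_add (h _) (h _))
    _ = _ := by ring

/-- Induction on `n`: the derivative of the difference is at most `C` times the previous bound,
uniformly in the level, and this is the derivative of the next bound. The start `n = 0` uses only
that both values lie in `[0, 1]`. -/
theorem IsMeanFieldSolution.abs_sub_le (hlam : 0 ≤ lam) {q q' : ℝ → ℕ → ℝ}
    (hq : IsMeanFieldSolution lam d q) (hq' : IsMeanFieldSolution lam d q') (h0 : q 0 = q' 0)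
    (n : ℕ) : ∀ t, 0 ≤ t → ∀ i, |q t i - q' t i| ≤ ((2 * lam * d + 2) * t) ^ n / n.factorial := by
  induction n with
  | zero =>
    intro t ht i
    have h1 := occupancy_nonneg (hq.mem t ht) i
    have h2 := occupancy_le_one (hq.mem t ht) i
    have h3 := occupancy_nonneg (hq'.mem t ht) i
    have h4 := occupancy_le_one (hq'.mem t ht) i
    simp only [pow_zero, Nat.factorial_zero, Nat.cast_one, div_one]
    rw [abs_le]; constructor <;> linarith
  | succ n ih =>
    intro t ht i
    rcases Nat.eq_zero_or_pos i with rfl | hi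
    · rw [(hq.mem t ht).1, (hq'.mem t ht).1, sub_self, abs_zero]
      positivity
    set C := 2 * lam * d + 2 with hC
    have hf (s : ℝ) (hs : 0 ≤ s) := (hq.ode i hi s hs).sub (hq'.ode i hi s hs)
    have key := image_norm_le_of_norm_deriv_right_le_deriv_boundary (a := 0) (b := t)
      (f := fun s => q s i - q' s i)
      (f' := fun s => (lam * (q s (i - 1) ^ d - q s i ^ d) - (q s i - q s (i + 1))) -
      (lam * (q' s (i - 1) ^ d - q' s i ^ d) - (q' s i - q' s (i + 1))))
      (B := fun s => (C * s) ^ (n + 1) / (n + 1).factorial)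
      (B' := fun s => C * ((C * s) ^ n / n.factorial))
      (fun s hs => ((hf s hs.1).continuousWithinAt).mono Set.Icc_subset_Ici_self)
      (fun s hs => (hf s hs.1).mono (Set.Ici_subset_Ici.2 hs.1))
      (by simp [h0])
      (fun s => by
        have h1 : HasDerivAt (fun s : ℝ => (C * s) ^ (n + 1) / (n + 1).factorial)
          (((n + 1 : ℕ) * (C * s) ^ n * (C * 1)) / (n + 1).factorial) s :=
          (((hasDerivAt_id s).const_mul C).pow (n + 1)).div_const _
        refine h1.congr_deriv ?_
        rw [Nat.factorial_succ]
        push_cast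
        field_simp)
      (fun s hs => by
        rw [Real.norm_eq_abs]
        exact abs_drift_sub_le hlam (hq.mem s hs.1) (hq'.mem s hs.1) (fun j => ih s hs.1 j) i)
    simpa only [Real.norm_eq_abs] using key ⟨ht, le_rfl⟩

theorem IsMeanFieldSolution.unique (hlam : 0 ≤ lam) {q q' : ℝ → ℕ → ℝ}
    (hq : IsMeanFieldSolution lam d q) (hq' : IsMeanFieldSolution lam d q') (h0 : q 0 = q' 0)
    (t : ℝ) (ht : 0 ≤ t) : q t = q' t := by
  ext i
  have h := le_of_tendsto_of_tendsto' tendsto_const_nhds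
    (FloorSemiring.tendsto_pow_div_factorial_atTop ((2 * lam * d + 2) * t))
    fun n => hq.abs_sub_le hlam hq' h0 n t ht i
  exact sub_eq_zero.1 (abs_nonpos_iff.1 h)

end MeanField

end SpatialLoadBalancing

namespace SpatialLoadBalancing

/-! ### Routing probabilities and join rates. -/

section Routing

set_option linter.unusedSectionVars false

open scoped Classical

/-- The divided difference `(a ^ d - b ^ d) / (a - b)` as a polynomial. -/
noncomputable def powQuot (d : ℕ) (a b : ℝ) : ℝ := ∑ k ∈ Finset.range d, a ^ k * b ^ (d - 1 - k)

theorem powQuot_mul_sub (d : ℕ) (a b : ℝ) : powQuot d a b * (a - b) = a ^ d - b ^ d := by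
  rw [powQuot, geom_sum₂_mul]

theorem powQuot_nonneg (d : ℕ) {a b : ℝ} (ha : 0 ≤ a) (hb : 0 ≤ b) : 0 ≤ powQuot d a b :=
  Finset.sum_nonneg fun _ _ => by positivity

theorem powQuot_le (d : ℕ) {a b : ℝ} (ha : 0 ≤ a) (hb : 0 ≤ b) (ha' : a ≤ 1) (hb' : b ≤ 1) :
    powQuot d a b ≤ d := by
  calc powQuot d a b ≤ ∑ k ∈ Finset.range d, (1 : ℝ) := Finset.sum_le_sum fun k _ => by
        exact mul_le_one₀ (pow_le_one₀ ha ha') (by positivity) (pow_le_one₀ hb hb')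
    _ = d := by simp

theorem abs_powQuot_sub_le (d : ℕ) {a b a' b' : ℝ} (ha : 0 ≤ a) (hb : 0 ≤ b) (ha1 : a ≤ 1)
    (hb1 : b ≤ 1) (ha' : 0 ≤ a') (hb' : 0 ≤ b') (ha1' : a' ≤ 1) (hb1' : b' ≤ 1) :
    |powQuot d a b - powQuot d a' b'| ≤ d ^ 2 * (|a - a'| + |b - b'|) := by
  rw [powQuot, powQuot, ← Finset.sum_sub_distrib]
  refine (Finset.abs_sum_le_sum_abs _ _).trans ?_
  calc _ ≤ ∑ k ∈ Finset.range d, (d : ℝ) * (|a - a'| + |b - b'|) := Finset.sum_le_sum fun k hk => ?_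
    _ = _ := by simp; ring
  have hk' : (k : ℝ) ≤ d := by exact_mod_cast (Finset.mem_range.1 hk).le
  have hl' : ((d - 1 - k : ℕ) : ℝ) ≤ d := by exact_mod_cast (by omega)
  have h1 := abs_pow_sub_pow_le_of_mem_Icc k ha ha1 ha' ha1'
  have h2 := abs_pow_sub_pow_le_of_mem_Icc (d - 1 - k) hb hb1 hb' hb1'
  have e : a ^ k * b ^ (d - 1 - k) - a' ^ k * b' ^ (d - 1 - k) =
      (a ^ k - a' ^ k) * b ^ (d - 1 - k) + a' ^ k * (b ^ (d - 1 - k) - b' ^ (d - 1 - k)) := by ring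
  rw [e]
  calc _ ≤ |a ^ k - a' ^ k| * 1 + 1 * |b ^ (d - 1 - k) - b' ^ (d - 1 - k)| := by
        refine (abs_add_le _ _).trans (add_le_add ?_ ?_)
        · rw [abs_mul]; gcongr
          rw [abs_of_nonneg (by positivity)]; exact pow_le_one₀ hb hb1
        · rw [abs_mul]; gcongr
          rw [abs_of_nonneg (by positivity)]; exact pow_le_one₀ ha' ha1'
    _ ≤ d * |a - a'| * 1 + 1 * (d * |b - b'|) := by
        gcongr
        · exact h1.trans (by gcongr)
        · exact h2.trans (by gcongr)
    _ = _ := by ring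

variable {V W : Type*} [Fintype V] [Fintype W]

theorem mem_serversOf {E : Finset (V × W)} {w : W} {v : V} : v ∈ serversOf E w ↔ (v, w) ∈ E := by
  simp [serversOf]

theorem typeDeg_pos {E : Finset (V × W)} {w : W} (h : ∃ v, (v, w) ∈ E) :
    (0 : ℝ) < typeDeg E w := by
  obtain ⟨v, hv⟩ := h
  exact_mod_cast Finset.card_pos.2 ⟨v, mem_serversOf.2 hv⟩

theorem localFrac_nonneg (E : Finset (V × W)) (x : V → ℕ) (w : W) (i : ℕ) :
    0 ≤ localFrac E x w i := by unfold localFrac; positivity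

theorem localFrac_le_one (E : Finset (V × W)) (x : V → ℕ) (w : W) (i : ℕ) :
    localFrac E x w i ≤ 1 := by
  refine div_le_one_of_le₀ ?_ (by positivity)
  exact_mod_cast Finset.card_filter_le _ _

theorem localFrac_zero {E : Finset (V × W)} {w : W} (h : ∃ v, (v, w) ∈ E) (x : V → ℕ) :
    localFrac E x w 0 = 1 := by
  have := typeDeg_pos h
  simp only [localFrac, Nat.zero_le, Finset.filter_true]
  exact div_self this.ne'

theorem card_filter_le_sub (A : Finset V) (x : V → ℕ) (j : ℕ) :
    ((A.filter fun v => j ≤ x v).card : ℝ) - (A.filter fun v => j + 1 ≤ x v).card =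
      (A.filter fun v => x v = j).card := by
  have : (A.filter fun v => j ≤ x v).card =
      (A.filter fun v => j + 1 ≤ x v).card + (A.filter fun v => x v = j).card := by
    rw [← Finset.card_union_of_disjoint]
    · congr 1; ext v; simp only [Finset.mem_filter, Finset.mem_union]; grind
    · rw [Finset.disjoint_filter]; intros; omega
  rw [this]; push_cast; ring

theorem localFrac_sub (E : Finset (V × W)) (x : V → ℕ) (w : W) (j : ℕ) :
    localFrac E x w j - localFrac E x w (j + 1) =
      (((serversOf E w).filter fun v => x v = j).card : ℝ) / typeDeg E w := by
  rw [localFrac, localFrac, ← sub_div, card_filter_le_sub]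

theorem localFrac_succ_le (E : Finset (V × W)) (x : V → ℕ) (w : W) (j : ℕ) :
    localFrac E x w (j + 1) ≤ localFrac E x w j := by
  rw [← sub_nonneg, localFrac_sub]; positivity

variable {d : ℕ}

theorem shortestPositions_nonempty (hd : 1 ≤ d) (x : V → ℕ) (s : Fin d → V) :
    (shortestPositions x s).Nonempty := by
  have : Nonempty (Fin d) := ⟨⟨0, hd⟩⟩
  obtain ⟨k, -, hk⟩ := Finset.exists_min_image Finset.univ (fun k => x (s k)) Finset.univ_nonempty
  exact ⟨k, by simpa [shortestPositions] using fun j => hk j (Finset.mem_univ j)⟩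

theorem sum_tieBreakProb (x : V → ℕ) (s : Fin d → V) (A : Finset V) :
    ∑ v ∈ A, tieBreakProb x s v =
      (((shortestPositions x s).filter fun k => s k ∈ A).card : ℝ) /
        (shortestPositions x s).card := by
  simp only [tieBreakProb]
  rw [← Finset.sum_div, Finset.card_eq_sum_card_fiberwise (f := s) (t := A)
    (s := (shortestPositions x s).filter fun k => s k ∈ A)]
  · push_cast
    congr 1
    refine Finset.sum_congr rfl fun v hv => ?_
    congr 2
    ext k; simp only [Finset.mem_filter]; grind
  · intro k hk; simpa using (Finset.mem_filter.1 hk).2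

theorem tieBreakProb_nonneg (x : V → ℕ) (s : Fin d → V) (v : V) : 0 ≤ tieBreakProb x s v := by
  unfold tieBreakProb; positivity

theorem routeProb_nonneg (E : Finset (V × W)) (x : V → ℕ) (w : W) (v : V) :
    0 ≤ routeProb d E x w v :=
  div_nonneg (Finset.sum_nonneg fun _ _ => tieBreakProb_nonneg _ _ _) (by positivity)

theorem sum_tieBreakProb_univ (hd : 1 ≤ d) (x : V → ℕ) (s : Fin d → V) :
    ∑ v, tieBreakProb x s v = 1 := by
  rw [sum_tieBreakProb]
  have := Finset.card_pos.2 (shortestPositions_nonempty hd x s)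
  simp only [Finset.mem_univ, Finset.filter_true]
  exact div_self (by exact_mod_cast this.ne')

theorem sum_routeProb (hd : 1 ≤ d) {E : Finset (V × W)} {w : W} (h : ∃ v, (v, w) ∈ E)
    (x : V → ℕ) : ∑ v, routeProb d E x w v = 1 := by
  have := typeDeg_pos h
  simp only [routeProb]
  rw [← Finset.sum_div, Finset.sum_comm, Finset.sum_congr rfl
    fun s _ => sum_tieBreakProb_univ hd x s]
  rw [Finset.sum_const, Fintype.card_piFinset]
  simp only [Finset.prod_const, Finset.card_univ, Fintype.card_fin, nsmul_eq_mul, mul_one,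
    Nat.cast_pow]
  exact div_self (by unfold typeDeg at *; positivity)

/-- All minimal positions share one queue length, so the total probability is `0` or `1`. It is `1`
exactly when the sampled minimum equals `j`, that is, when all samples are at least `j` but not all
are at least `j + 1`. -/
theorem sum_tieBreakProb_level (hd : 1 ≤ d) (x : V → ℕ) (s : Fin d → V) (j : ℕ) :
    ∑ v ∈ Finset.univ.filter (fun v => x v = j), tieBreakProb x s v =
      (if ∀ k, j ≤ x (s k) then 1 else 0) - if ∀ k, j + 1 ≤ x (s k) then 1 else 0 := by
  rw [sum_tieBreakProb]
  obtain ⟨m, hm⟩ := shortestPositions_nonempty hd x s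
  have hpos := Finset.card_pos.2 ⟨m, hm⟩
  have hm' : ∀ k, x (s m) ≤ x (s k) := by simpa [shortestPositions] using hm
  have hval : ∀ k ∈ shortestPositions x s, x (s k) = x (s m) := fun k hk =>
    le_antisymm ((by simpa [shortestPositions] using hk : ∀ l, x (s k) ≤ x (s l)) m) (hm' k)
  by_cases hj : x (s m) = j
  · rw [if_pos fun k => hj ▸ hm' k, if_neg fun h => by have := h m; omega,
      Finset.filter_true_of_mem fun k hk => by simpa [hval k hk] using hj,
      div_self (by exact_mod_cast hpos.ne'), sub_zero]
  · rw [Finset.filter_false_of_mem fun k hk => by simpa [hval k hk] using hj]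
    have : (∀ k, j ≤ x (s k)) ↔ ∀ k, j + 1 ≤ x (s k) :=
      ⟨fun h k => by have := h m; have := hm' k; omega, fun h k => by have := h k; omega⟩
    simp only [this, sub_self]; simp

theorem card_samples_ge (E : Finset (V × W)) (x : V → ℕ) (w : W) (j : ℕ) :
    (∑ s ∈ Fintype.piFinset (fun _ : Fin d => serversOf E w),
      if ∀ k, j ≤ x (s k) then (1 : ℝ) else 0) =
      (((serversOf E w).filter fun v => j ≤ x v).card : ℝ) ^ d := by
  rw [Finset.sum_boole]
  have : (Fintype.piFinset (fun _ : Fin d => serversOf E w)).filter (fun s => ∀ k, j ≤ x (s k)) =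
      Fintype.piFinset (fun _ : Fin d => (serversOf E w).filter fun v => j ≤ x v) := by
    ext s; simp only [Finset.mem_filter, Fintype.mem_piFinset]; grind
  rw [this, Fintype.card_piFinset]
  simp

theorem sum_routeProb_level (hd : 1 ≤ d) (E : Finset (V × W)) (w : W)
    (x : V → ℕ) (j : ℕ) : ∑ v ∈ Finset.univ.filter (fun v => x v = j), routeProb d E x w v =
      localFrac E x w j ^ d - localFrac E x w (j + 1) ^ d := by
  simp only [routeProb]
  rw [← Finset.sum_div, Finset.sum_comm, Finset.sum_congr rfl
    fun s _ => sum_tieBreakProb_level hd x s j, Finset.sum_sub_distrib, card_samples_ge,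
    card_samples_ge, localFrac, localFrac, div_pow, div_pow, sub_div]

theorem routeProb_eq_zero {E : Finset (V × W)} {w : W} {v : V} (hv : (v, w) ∉ E) (x : V → ℕ) :
    routeProb d E x w v = 0 := by
  rw [routeProb, Finset.sum_eq_zero, zero_div]
  intro s hs
  rw [tieBreakProb, Finset.filter_false_of_mem, Finset.card_empty, Nat.cast_zero, zero_div]
  intro k _ hk
  exact hv (mem_serversOf.1 (hk ▸ (Fintype.mem_piFinset.1 hs k)))

/-- The transposition of `u` and `v` permutes the samples from `serversOf E w` and leaves the queue
lengths unchanged. -/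
theorem routeProb_congr {E : Finset (V × W)} {w : W} {u v : V} (hu : (u, w) ∈ E)
    (hv : (v, w) ∈ E) {x : V → ℕ} (h : x u = x v) :
    routeProb d E x w u = routeProb d E x w v := by
  simp only [routeProb]
  congr 1
  have hx : ∀ a, x (Equiv.swap u v a) = x a := fun a => by
    rw [Equiv.swap_apply_def]; split_ifs <;> simp_all
  have hE : ∀ a, a ∈ serversOf E w → Equiv.swap u v a ∈ serversOf E w := fun a ha => by
    rw [Equiv.swap_apply_def]; split_ifs <;> simp_all [mem_serversOf]
  refine Finset.sum_nbij' (fun s k => Equiv.swap u v (s k)) (fun s k => Equiv.swap u v (s k))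
    ?_ ?_ ?_ ?_ ?_
  · intro s hs
    exact Fintype.mem_piFinset.2 fun k => hE _ (Fintype.mem_piFinset.1 hs k)
  · intro s hs
    exact Fintype.mem_piFinset.2 fun k => hE _ (Fintype.mem_piFinset.1 hs k)
  · intro s _; simp
  · intro s _; simp
  · intro s _
    have h1 : shortestPositions x (fun k => Equiv.swap u v (s k)) = shortestPositions x s := by
      simp only [shortestPositions, hx]
    have h2 : ∀ k, Equiv.swap u v (s k) = v ↔ s k = u := fun k => by
      rw [Equiv.swap_apply_eq_iff, Equiv.swap_apply_right]
    simp only [tieBreakProb, h1, h2]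

/-- The mass `q_j ^ d - q_{j+1} ^ d` sent to level `j = x v` is shared equally by the `d_w * (q_j -
q_{j+1})` compatible servers at that level. This number is positive because `v` is one of them, so
it can be cancelled; the quotient is a polynomial in the two fractions and hence Lipschitz. -/
theorem routeProb_eq (hd : 1 ≤ d) {E : Finset (V × W)} {w : W} {v : V} (hv : (v, w) ∈ E)
    (x : V → ℕ) : routeProb d E x w v =
      powQuot d (localFrac E x w (x v)) (localFrac E x w (x v + 1)) / typeDeg E w := by
  have hdeg := typeDeg_pos ⟨v, hv⟩
  have h1 := sum_routeProb_level hd E w x (x v)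
  rw [← powQuot_mul_sub, localFrac_sub] at h1
  have h2 : ∑ u ∈ Finset.univ.filter (fun u => x u = x v), routeProb d E x w u =
      (((serversOf E w).filter fun u => x u = x v).card : ℝ) * routeProb d E x w v := by
    rw [← nsmul_eq_mul, ← Finset.sum_const]
    symm
    refine Finset.sum_subset_zero_on_sdiff (fun u hu => ?_) (fun u hu => ?_) (fun u hu => ?_)
    · simp_all
    · refine routeProb_eq_zero (fun h => ?_) x
      simp_all [mem_serversOf]
    · obtain ⟨hu1, hu2⟩ := Finset.mem_filter.1 hu
      exact routeProb_congr hv (mem_serversOf.1 hu1) hu2.symm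
  have hpos : (0 : ℝ) < ((serversOf E w).filter fun u => x u = x v).card := by
    exact_mod_cast Finset.card_pos.2 ⟨v, by simp [mem_serversOf, hv]⟩
  rw [h2] at h1
  field_simp at h1 ⊢
  linarith

theorem joinRate_eq (hd : 1 ≤ d) (lam : ℝ) (E : Finset (V × W)) (x : V → ℕ) (v : V) :
    joinRate lam d E x v = lam * Fintype.card V / Fintype.card W * ∑ w ∈ typesOf E v,
      powQuot d (localFrac E x w (x v)) (localFrac E x w (x v + 1)) / typeDeg E w := by
  rw [joinRate, Finset.mul_sum, typesOf, Finset.sum_filter]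
  refine Finset.sum_congr rfl fun w _ => ?_
  split_ifs with h
  · rw [routeProb_eq hd h]
  · rw [routeProb_eq_zero h, mul_zero]

theorem joinRate_nonneg {lam : ℝ} (hlam : 0 ≤ lam) (E : Finset (V × W)) (x : V → ℕ) (v : V) :
    0 ≤ joinRate lam d E x v :=
  Finset.sum_nonneg fun _ _ => mul_nonneg (by positivity) (routeProb_nonneg _ _ _ _)

theorem sum_joinRate [Nonempty W] (hd : 1 ≤ d) (lam : ℝ) {E : Finset (V × W)}
    (hE : ∀ w, ∃ v, (v, w) ∈ E) (x : V → ℕ) :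
    ∑ v, joinRate lam d E x v = lam * Fintype.card V := by
  simp only [joinRate]
  rw [Finset.sum_comm]
  simp only [← Finset.mul_sum, sum_routeProb hd (hE _) x]
  simp only [Finset.sum_const, Finset.card_univ, nsmul_eq_mul, mul_one]
  have : (0 : ℝ) < Fintype.card W := by exact_mod_cast Fintype.card_pos
  field_simp

theorem mul_serverWeight_le_graphLoad (lam : ℝ) (E : Finset (V × W)) (v : V) :
    lam * serverWeight E v ≤ graphLoad lam E :=
  le_ciSup (f := fun v => lam * serverWeight E v) (Set.finite_range _).bddAbove v

theorem abs_serverWeight_sub_one_le (E : Finset (V × W)) (v : V) :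
    |serverWeight E v - 1| ≤ graphPhi E :=
  le_ciSup (f := fun v => |serverWeight E v - 1|) (Set.finite_range _).bddAbove v

theorem graphPhi_nonneg (E : Finset (V × W)) : 0 ≤ graphPhi E :=
  Real.iSup_nonneg fun _ => abs_nonneg _

theorem serverWeight_nonneg (E : Finset (V × W)) (v : V) : 0 ≤ serverWeight E v :=
  mul_nonneg (by positivity) (Finset.sum_nonneg fun _ _ => by positivity)

/-- Each divided difference is at most `d`, and what remains is the load of the server. -/
theorem joinRate_le (hd : 1 ≤ d) {lam rho0 : ℝ} (hlam : 0 ≤ lam) {E : Finset (V × W)}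
    (hρ : graphLoad lam E ≤ rho0) (x : V → ℕ) (v : V) : joinRate lam d E x v ≤ rho0 * d := by
  rw [joinRate_eq hd]
  calc _ ≤ lam * Fintype.card V / Fintype.card W * ∑ w ∈ typesOf E v, d * (1 / (typeDeg E w : ℝ)) := by
        gcongr with w
        rw [mul_one_div]
        gcongr
        exact powQuot_le d (localFrac_nonneg _ _ _ _) (localFrac_nonneg _ _ _ _)
          (localFrac_le_one _ _ _ _) (localFrac_le_one _ _ _ _)
    _ = lam * serverWeight E v * d := by rw [← Finset.mul_sum, serverWeight]; ring
    _ ≤ _ := by gcongr; exact (mul_serverWeight_le_graphLoad lam E v).trans hρ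

/-- Double counting: averaging over types and then over compatible servers weighs the server `v`
by `serverWeight E v / |V|`. -/
theorem average_servers [Nonempty V] (E : Finset (V × W)) (g : V → ℝ) :
    1 / (Fintype.card W : ℝ) * ∑ w, (∑ v ∈ serversOf E w, g v) / typeDeg E w =
      1 / (Fintype.card V : ℝ) * ∑ v, serverWeight E v * g v := by
  have hV : (Fintype.card V : ℝ) ≠ 0 := by exact_mod_cast Fintype.card_ne_zero
  simp only [serverWeight, serversOf, typesOf, Finset.sum_filter, Finset.mul_sum, Finset.sum_mul,
    Finset.sum_div]
  rw [Finset.sum_comm]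
  refine Finset.sum_congr rfl fun v _ => Finset.sum_congr rfl fun w _ => ?_
  split_ifs
  · field_simp
  · simp

end Routing

end SpatialLoadBalancing

namespace SpatialLoadBalancing

/-! ### The generator on local fractions, and the energy controlling the bias. -/

section Generator

set_option linter.unusedSectionVars false

open scoped Classical

variable {V W : Type*} [Fintype V] [Fintype W] {d : ℕ} {lam rho0 : ℝ}

theorem localFrac_eq_sum (E : Finset (V × W)) (x : V → ℕ) (w : W) (i : ℕ) :
    localFrac E x w i = (∑ v ∈ serversOf E w, if i ≤ x v then (1 : ℝ) else 0) / typeDeg E w := by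
  rw [localFrac, Finset.sum_boole]

theorem globalFrac_eq_sum (x : V → ℕ) (i : ℕ) :
    globalFrac x i = (∑ v, if i ≤ x v then (1 : ℝ) else 0) / Fintype.card V := by
  rw [globalFrac, Finset.sum_boole]

theorem sum_update_sub (A : Finset V) (g : ℕ → ℝ) (x : V → ℕ) (v : V) (n : ℕ) :
    ∑ u ∈ A, g (Function.update x v n u) - ∑ u ∈ A, g (x u) =
      if v ∈ A then g n - g (x v) else 0 := by
  rw [← Finset.sum_sub_distrib]
  split_ifs with h
  · rw [Finset.sum_eq_single_of_mem v h]
    · simp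
    · intro u _ hu; simp [Function.update_of_ne hu]
  · refine Finset.sum_eq_zero fun u hu => ?_
    have : u ≠ v := fun e => h (e ▸ hu)
    simp [Function.update_of_ne this]

theorem localFrac_up_sub (E : Finset (V × W)) (x : V → ℕ) (w : W) (j : ℕ) (v : V) :
    localFrac E (Function.update x v (x v + 1)) w (j + 1) - localFrac E x w (j + 1) =
      if v ∈ serversOf E w ∧ x v = j then 1 / (typeDeg E w : ℝ) else 0 := by
  rw [localFrac_eq_sum, localFrac_eq_sum, ← sub_div,
    sum_update_sub _ (fun n => if j + 1 ≤ n then (1 : ℝ) else 0)]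
  by_cases h : v ∈ serversOf E w
  · rcases lt_trichotomy (x v) j with h1 | h1 | h1
    · simp [h, show ¬ j ≤ x v by omega, show ¬ j + 1 ≤ x v by omega, h1.ne]
    · simp [h, h1]
    · simp [h, show j ≤ x v by omega, show j + 1 ≤ x v by omega, h1.ne']
  · simp [h]

theorem localFrac_down_sub (E : Finset (V × W)) (x : V → ℕ) (w : W) (j : ℕ) (v : V) :
    (if 0 < x v then
      localFrac E (Function.update x v (x v - 1)) w (j + 1) - localFrac E x w (j + 1) else 0) =
      if v ∈ serversOf E w ∧ x v = j + 1 then -(1 / (typeDeg E w : ℝ)) else 0 := by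
  rw [localFrac_eq_sum, localFrac_eq_sum, ← sub_div,
    sum_update_sub _ (fun n => if j + 1 ≤ n then (1 : ℝ) else 0)]
  by_cases h : v ∈ serversOf E w
  · rcases lt_trichotomy (x v) (j + 1) with h1 | h1 | h1
    · simp [h, show ¬ j + 1 ≤ x v - 1 by omega, show ¬ j + 1 ≤ x v by omega, h1.ne]
    · simp [h, h1, neg_div]
    · simp [h, show j + 1 ≤ x v - 1 by omega, show j + 1 ≤ x v by omega, h1.ne']
  · simp [h]

theorem queueGenerator_localFrac (E : Finset (V × W)) (x : V → ℕ) (w : W) (j : ℕ) :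
    queueGenerator lam d E (fun y => localFrac E y w (j + 1)) x =
      (∑ v ∈ serversOf E w, if x v = j then joinRate lam d E x v else 0) / typeDeg E w -
        (localFrac E x w (j + 1) - localFrac E x w (j + 2)) := by
  rw [localFrac_sub, queueGenerator, Finset.card_filter]
  simp only [localFrac_up_sub, localFrac_down_sub]
  rw [Finset.sum_add_distrib, sub_eq_add_neg]
  push_cast
  congr 1
  · rw [Finset.sum_div, serversOf, Finset.sum_filter]
    refine Finset.sum_congr rfl fun v _ => ?_
    simp only [Finset.mem_filter, Finset.mem_univ, true_and, mul_ite, mul_zero, mul_one_div]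
    split_ifs <;> simp_all
  · rw [Finset.sum_div, ← Finset.sum_neg_distrib, serversOf, Finset.sum_filter]
    refine Finset.sum_congr rfl fun v _ => ?_
    simp only [Finset.mem_filter, Finset.mem_univ, true_and]
    split_ifs <;> simp_all

/-- The carré du champ of the queue length generator. -/
theorem queueGenerator_sq (E : Finset (V × W)) (f : (V → ℕ) → ℝ) (x : V → ℕ) :
    queueGenerator lam d E (fun y => f y ^ 2) x - 2 * f x * queueGenerator lam d E f x =
      ∑ v, (joinRate lam d E x v * (f (Function.update x v (x v + 1)) - f x) ^ 2 +
        (if 0 < x v then f (Function.update x v (x v - 1)) - f x else 0) ^ 2) := by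
  rw [queueGenerator, queueGenerator, Finset.mul_sum, ← Finset.sum_sub_distrib]
  refine Finset.sum_congr rfl fun v _ => ?_
  split_ifs <;> ring

theorem queueGenerator_sq_nonneg (hlam : 0 ≤ lam) (E : Finset (V × W)) (f : (V → ℕ) → ℝ)
    (x : V → ℕ) :
    0 ≤ queueGenerator lam d E (fun y => f y ^ 2) x - 2 * f x * queueGenerator lam d E f x := by
  rw [queueGenerator_sq]
  exact Finset.sum_nonneg fun v _ => add_nonneg
    (mul_nonneg (joinRate_nonneg hlam _ _ _) (sq_nonneg _)) (sq_nonneg _)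

/-- An arrival at `v` affects only level `x v + 1`, and a departure only level `x v`, each by `1 /
d_w`. Hence the sum over any number of levels costs a compatible server at most `(rho0 * d + 1) /
d_w ^ 2`, and there are `d_w` such servers. -/
theorem sum_queueGenerator_sq_localFrac_le (hd : 1 ≤ d) (hlam : 0 ≤ lam) {E : Finset (V × W)}
    (hρ : graphLoad lam E ≤ rho0) {w : W} (hw : ∃ v, (v, w) ∈ E) (x : V → ℕ) (n : ℕ) :
    ∑ j ∈ Finset.range n, (queueGenerator lam d E (fun y => localFrac E y w (j + 1) ^ 2) x -
      2 * localFrac E x w (j + 1) * queueGenerator lam d E (fun y => localFrac E y w (j + 1)) x) ≤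
      (rho0 * d + 1) * (1 / (typeDeg E w : ℝ)) := by
  have hdeg := typeDeg_pos hw
  simp only [queueGenerator_sq E (fun y => localFrac E y w (_ + 1)), localFrac_up_sub,
    localFrac_down_sub]
  rw [Finset.sum_comm]
  calc _ ≤ ∑ v, if v ∈ serversOf E w then (rho0 * d + 1) * (1 / (typeDeg E w : ℝ)) ^ 2 else 0 := by
        refine Finset.sum_le_sum fun v _ => ?_
        by_cases hv : v ∈ serversOf E w
        · simp only [hv, true_and, if_true, ite_pow, neg_sq, ne_eq, OfNat.ofNat_ne_zero,
            not_false_eq_true, zero_pow, mul_ite, mul_zero]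
          rw [Finset.sum_add_distrib, Finset.sum_ite_eq, add_mul, one_mul]
          have hA : (∑ j ∈ Finset.range n,
              if x v = j + 1 then (1 / (typeDeg E w : ℝ)) ^ 2 else 0) ≤
              (1 / (typeDeg E w : ℝ)) ^ 2 := by
            rw [← Finset.sum_filter, Finset.sum_const, nsmul_eq_mul]
            have : ((Finset.range n).filter fun j => x v = j + 1).card ≤ 1 :=
              Finset.card_le_one.2 fun a ha b hb => by
                have := (Finset.mem_filter.1 ha).2
                have := (Finset.mem_filter.1 hb).2
                omega
            exact mul_le_of_le_one_left (by positivity) (by exact_mod_cast this)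
          refine add_le_add ?_ hA
          have hj := joinRate_le hd hlam hρ x v
          have hj0 := joinRate_nonneg (d := d) hlam E x v
          split_ifs
          · gcongr
          · exact mul_nonneg (hj0.trans hj) (by positivity)
        · simp [hv]
    _ = _ := by
        rw [← Finset.sum_filter, Finset.sum_const, Finset.filter_mem_eq_inter,
          Finset.univ_inter, nsmul_eq_mul]
        rw [typeDeg] at *
        field_simp

theorem abs_queueGenerator_le [Nonempty W] (hd : 1 ≤ d) (hlam : 0 ≤ lam) {E : Finset (V × W)}
    (hE : ∀ w, ∃ v, (v, w) ∈ E) {f : (V → ℕ) → ℝ} {C : ℝ} (hf : ∀ x, |f x| ≤ C) (x : V → ℕ) :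
    |queueGenerator lam d E f x| ≤ (lam * Fintype.card V + Fintype.card V) * (2 * C) := by
  have hC (y z) : |f y - f z| ≤ 2 * C := by
    refine (abs_sub _ _).trans ?_
    linarith [hf y, hf z]
  have hC0 : 0 ≤ C := (abs_nonneg _).trans (hf x)
  calc _ ≤ ∑ v, (joinRate lam d E x v * (2 * C) + 2 * C) := by
        refine (Finset.abs_sum_le_sum_abs _ _).trans (Finset.sum_le_sum fun v _ => ?_)
        refine (abs_add_le _ _).trans (add_le_add ?_ ?_)
        · rw [abs_mul, abs_of_nonneg (joinRate_nonneg hlam _ _ _)]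
          gcongr
          · exact joinRate_nonneg hlam _ _ _
          · exact hC _ _
        · split_ifs
          · exact hC _ _
          · simpa using hC0
    _ = _ := by
        rw [Finset.sum_add_distrib, ← Finset.sum_mul, sum_joinRate hd lam hE]
        simp; ring

theorem localDiscrepancy_nonneg (E : Finset (V × W)) (x : V → ℕ) (p : ℕ → ℝ) (i : ℕ) :
    0 ≤ localDiscrepancy E x p i :=
  mul_nonneg (by positivity) (Finset.sum_nonneg fun _ _ => abs_nonneg _)

/-- The type-averaged fraction of compatible servers with queue length exactly `j`. -/
noncomputable def levelFrac (E : Finset (V × W)) (x : V → ℕ) (j : ℕ) : ℝ :=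
  1 / (Fintype.card W : ℝ) * ∑ w, (localFrac E x w j - localFrac E x w (j + 1))

theorem levelFrac_nonneg (E : Finset (V × W)) (x : V → ℕ) (j : ℕ) : 0 ≤ levelFrac E x j :=
  mul_nonneg (by positivity) (Finset.sum_nonneg fun _ _ => sub_nonneg.2 (localFrac_succ_le _ _ _ _))

theorem sum_levelFrac_le [Nonempty W] (E : Finset (V × W)) (x : V → ℕ) (n : ℕ) :
    ∑ j ∈ Finset.range n, levelFrac E x j ≤ 1 := by
  have hW : (0 : ℝ) < Fintype.card W := by exact_mod_cast Fintype.card_pos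
  simp only [levelFrac]
  rw [← Finset.mul_sum, Finset.sum_comm]
  simp only [Finset.sum_range_sub']
  calc _ ≤ 1 / (Fintype.card W : ℝ) * ∑ w : W, (1 : ℝ) := by
        gcongr with w
        linarith [localFrac_le_one E x w 0, localFrac_nonneg E x w n]
    _ = 1 := by simp [hW.ne']

theorem sum_levelFrac_sq_le [Nonempty W] (E : Finset (V × W)) (x : V → ℕ) (n : ℕ) :
    ∑ j ∈ Finset.range n, levelFrac E x j ^ 2 ≤ 1 := by
  refine le_trans (Finset.sum_le_sum fun j hj => ?_) (sum_levelFrac_le E x n)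
  have h0 := levelFrac_nonneg E x j
  have h1 : levelFrac E x j ≤ 1 :=
    (Finset.single_le_sum (f := levelFrac E x) (fun k _ => levelFrac_nonneg E x k) hj).trans
      (sum_levelFrac_le E x n)
  nlinarith

/-- Two errors separate the join rate from `lam * h`: replacing every divided difference by the
common value `h`, and replacing `serverWeight` by `1`. The second is where `graphPhi` enters the
dynamics. -/
theorem abs_joinRate_sub_le (hd : 1 ≤ d) (hlam : 0 ≤ lam) (hlam1 : lam ≤ 1) (E : Finset (V × W))
    {h : ℝ} (hh : 0 ≤ h) (hh' : h ≤ d) (x : V → ℕ) (v : V) :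
    |joinRate lam d E x v - lam * h| ≤
      lam * Fintype.card V / Fintype.card W * ∑ w ∈ typesOf E v,
        |powQuot d (localFrac E x w (x v)) (localFrac E x w (x v + 1)) - h| / typeDeg E w +
      d * graphPhi E := by
  have e : joinRate lam d E x v - lam * h = lam * Fintype.card V / Fintype.card W *
      ∑ w ∈ typesOf E v,
        (powQuot d (localFrac E x w (x v)) (localFrac E x w (x v + 1)) - h) / typeDeg E w +
      lam * h * (serverWeight E v - 1) := by
    rw [joinRate_eq hd, serverWeight]
    simp only [sub_div, Finset.sum_sub_distrib]
    have : ∑ w ∈ typesOf E v, h / (typeDeg E w : ℝ) =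
        h * ∑ w ∈ typesOf E v, 1 / (typeDeg E w : ℝ) := by
      rw [Finset.mul_sum]; simp only [mul_one_div]
    rw [this]; ring
  rw [e]
  refine (abs_add_le _ _).trans (add_le_add ?_ ?_)
  · rw [abs_mul, abs_of_nonneg (by positivity)]
    gcongr
    refine (Finset.abs_sum_le_sum_abs _ _).trans (Finset.sum_le_sum fun w _ => ?_)
    rw [abs_div, Nat.abs_cast]
  · rw [abs_mul, abs_of_nonneg (by positivity)]
    have := abs_serverWeight_sub_one_le E v
    have h1 : lam * h ≤ d := by nlinarith
    gcongr

theorem average_add (f g : W → ℝ) : 1 / (Fintype.card W : ℝ) * ∑ w, (f w + g w) =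
    1 / (Fintype.card W : ℝ) * ∑ w, f w + 1 / (Fintype.card W : ℝ) * ∑ w, g w := by
  rw [Finset.sum_add_distrib, mul_add]

theorem average_mul (c : ℝ) (f : W → ℝ) : 1 / (Fintype.card W : ℝ) * ∑ w, c * f w =
    c * (1 / (Fintype.card W : ℝ) * ∑ w, f w) := by
  rw [← Finset.mul_sum]; ring

/-- Replacing the routing intensities of the neighbouring types costs at most the average error,
as the load is at most one. -/
theorem average_neighbour_error_le [Nonempty V] [Nonempty W]
    {E : Finset (V × W)} (hE : ∀ w, ∃ v, (v, w) ∈ E) (hρ : graphLoad lam E ≤ 1) (x : V → ℕ)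
    (j : ℕ) {δ : W → ℝ} (hδ : ∀ w, 0 ≤ δ w) :
    1 / (Fintype.card W : ℝ) * ∑ w, (∑ v ∈ serversOf E w, if x v = j then
        lam * Fintype.card V / Fintype.card W * ∑ u ∈ typesOf E v, δ u / typeDeg E u else 0) /
          typeDeg E w ≤
      1 / (Fintype.card W : ℝ) * ∑ w, δ w := by
  have hV : (0 : ℝ) < Fintype.card V := by exact_mod_cast Fintype.card_pos
  rw [average_servers]
  -- The indicator of level `j` is dropped, and `lam * serverWeight E v ≤ 1` absorbs the weight
  -- created by the outer average.
  calc _ ≤ 1 / (Fintype.card V : ℝ) * ∑ v, Fintype.card V / Fintype.card W *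
        ∑ u ∈ typesOf E v, δ u / (typeDeg E u : ℝ) := by
        refine mul_le_mul_of_nonneg_left (Finset.sum_le_sum fun v _ => ?_) (by positivity)
        have hs : 0 ≤ ∑ u ∈ typesOf E v, δ u / (typeDeg E u : ℝ) :=
          Finset.sum_nonneg fun u _ => div_nonneg (hδ u) (by positivity)
        split_ifs
        · have h1 := (mul_serverWeight_le_graphLoad lam E v).trans hρ
          calc _ = lam * serverWeight E v * (Fintype.card V / Fintype.card W *
                ∑ u ∈ typesOf E v, δ u / (typeDeg E u : ℝ)) := by ring
            _ ≤ 1 * _ := by gcongr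
            _ = _ := one_mul _
        · rw [mul_zero]; positivity
    _ = 1 / (Fintype.card W : ℝ) * ∑ v, ∑ u ∈ typesOf E v, δ u / (typeDeg E u : ℝ) := by
        rw [← Finset.mul_sum]; field_simp
    -- After exchanging the sums, type `u` occurs once for each of its `d_u` servers, which cancels
    -- the factor `1 / d_u`.
    _ = _ := by
        congr 1
        simp only [typesOf, Finset.sum_filter]
        rw [Finset.sum_comm]
        refine Finset.sum_congr rfl fun w _ => ?_
        rw [← Finset.sum_filter, Finset.sum_const, nsmul_eq_mul]
        have := typeDeg_pos (hE w)
        rw [show (Finset.univ.filter fun v => (v, w) ∈ E).card = typeDeg E w from rfl]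
        field_simp

/-- Both arrival drifts are written as an intensity times the mass at level `j`, with the mean-field
intensity `lam * h` factored out by `powQuot_mul_sub`. The intensity errors are averaged by
`average_neighbour_error_le`, and the rest is linear in the discrepancies. -/
theorem average_drift_sub_le [Nonempty V] [Nonempty W] (hd : 1 ≤ d) (hlam : 0 ≤ lam)
    (hlam1 : lam ≤ 1) {E : Finset (V × W)} (hE : ∀ w, ∃ v, (v, w) ∈ E)
    (hρ : graphLoad lam E ≤ 1) (x : V → ℕ) {p : ℕ → ℝ} (hp : p ∈ occupancySpace) (j : ℕ) :
    1 / (Fintype.card W : ℝ) * ∑ w,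
      |queueGenerator lam d E (fun y => localFrac E y w (j + 1)) x -
        (lam * (p j ^ d - p (j + 1) ^ d) - (p (j + 1) - p (j + 2)))| ≤
      d * graphPhi E * levelFrac E x j + ((d : ℝ) ^ 2 + d + 1) * (localDiscrepancy E x p j +
        localDiscrepancy E x p (j + 1) + localDiscrepancy E x p (j + 2)) := by
  set h := powQuot d (p j) (p (j + 1)) with hh
  have hp0 := occupancy_nonneg hp
  have hp1 := occupancy_le_one hp
  have hh0 : 0 ≤ h := powQuot_nonneg d (hp0 _) (hp0 _)
  have hhd : h ≤ d := powQuot_le d (hp0 _) (hp0 _) (hp1 _) (hp1 _)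
  set δ : W → ℝ := fun w => |powQuot d (localFrac E x w j) (localFrac E x w (j + 1)) - h| with hδ
  set a : W → ℕ → ℝ := fun w i => |localFrac E x w i - p i| with ha
  have hpoint (w : W) :
      |queueGenerator lam d E (fun y => localFrac E y w (j + 1)) x -
        (lam * (p j ^ d - p (j + 1) ^ d) - (p (j + 1) - p (j + 2)))| ≤
      (∑ v ∈ serversOf E w, if x v = j then
        lam * Fintype.card V / Fintype.card W * ∑ u ∈ typesOf E v, δ u / typeDeg E u else 0) /
          typeDeg E w + (d * graphPhi E * (localFrac E x w j - localFrac E x w (j + 1)) +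
        (d * a w j + (d * a w (j + 1) + (a w (j + 1) + a w (j + 2))))) := by
    rw [queueGenerator_localFrac, ← powQuot_mul_sub, ← hh]
    have hlev : localFrac E x w j - localFrac E x w (j + 1) =
        (∑ v ∈ serversOf E w, if x v = j then (1 : ℝ) else 0) / typeDeg E w := by
      rw [localFrac_sub, Finset.sum_boole]
    have e : (∑ v ∈ serversOf E w, if x v = j then joinRate lam d E x v else 0) / typeDeg E w -
        (localFrac E x w (j + 1) - localFrac E x w (j + 2)) -
        (lam * (h * (p j - p (j + 1))) - (p (j + 1) - p (j + 2))) =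
        (∑ v ∈ serversOf E w, if x v = j then joinRate lam d E x v - lam * h else 0) /
          typeDeg E w + (lam * h * (localFrac E x w j - p j) -
            lam * h * (localFrac E x w (j + 1) - p (j + 1)) -
            ((localFrac E x w (j + 1) - p (j + 1)) - (localFrac E x w (j + 2) - p (j + 2)))) := by
      have h1 : (∑ v ∈ serversOf E w, if x v = j then joinRate lam d E x v - lam * h else 0) /
          typeDeg E w = (∑ v ∈ serversOf E w, if x v = j then joinRate lam d E x v else 0) /
          typeDeg E w - lam * h * (localFrac E x w j - localFrac E x w (j + 1)) := by
        rw [hlev, mul_div_assoc', ← sub_div, Finset.mul_sum, ← Finset.sum_sub_distrib]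
        congr 1
        refine Finset.sum_congr rfl fun v _ => ?_
        split_ifs <;> ring
      rw [h1]; ring
    rw [e]
    have hlh : lam * h ≤ d := by nlinarith
    have hlh0 : 0 ≤ lam * h := by positivity
    refine (abs_add_le _ _).trans ?_
    rw [← add_assoc]
    refine add_le_add ?_ ?_
    · rw [hlev, mul_div_assoc', ← add_div, Finset.mul_sum, ← Finset.sum_add_distrib, abs_div,
        Nat.abs_cast]
      gcongr
      refine (Finset.abs_sum_le_sum_abs _ _).trans (Finset.sum_le_sum fun v _ => ?_)
      split_ifs with hv
      · have := abs_joinRate_sub_le hd hlam hlam1 E hh0 hhd x v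
        rw [hv] at this
        simpa [hδ] using this
      · simp
    · refine (abs_sub _ _).trans ?_
      rw [← add_assoc]
      refine add_le_add ((abs_sub _ _).trans (add_le_add ?_ ?_)) (abs_sub _ _)
      · rw [abs_mul, abs_of_nonneg hlh0]; gcongr
      · rw [abs_mul, abs_of_nonneg hlh0]; gcongr
  have hsum := mul_le_mul_of_nonneg_left (Finset.sum_le_sum fun w (_ : w ∈ Finset.univ) => hpoint w)
    (show 0 ≤ 1 / (Fintype.card W : ℝ) by positivity)
  refine hsum.trans ?_
  simp only [average_add, average_mul]
  have h1 := average_neighbour_error_le hE hρ x j (δ := δ) fun w => abs_nonneg _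
  have h2 : 1 / (Fintype.card W : ℝ) * ∑ w, δ w ≤
      d ^ 2 * (localDiscrepancy E x p j + localDiscrepancy E x p (j + 1)) := by
    simp only [localDiscrepancy]
    rw [← average_add, ← average_mul]
    gcongr with w
    exact abs_powQuot_sub_le d (localFrac_nonneg _ _ _ _) (localFrac_nonneg _ _ _ _)
      (localFrac_le_one _ _ _ _) (localFrac_le_one _ _ _ _) (hp0 _) (hp0 _) (hp1 _) (hp1 _)
  have hD := localDiscrepancy_nonneg E x p
  have e (i : ℕ) : 1 / (Fintype.card W : ℝ) * ∑ w, a w i = localDiscrepancy E x p i := rfl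
  rw [e, e, e]
  have e' : 1 / (Fintype.card W : ℝ) * ∑ w, (localFrac E x w j - localFrac E x w (j + 1)) =
    levelFrac E x j := rfl
  rw [e']
  -- The coefficient of the discrepancy at `j + 2` is really `1`; it is enlarged so that the three
  -- neighbours share one constant.
  have h3 : 0 ≤ ((d : ℝ) ^ 2 + d) * localDiscrepancy E x p (j + 2) :=
    mul_nonneg (by positivity) (hD _)
  nlinarith [hD j, hD (j + 1)]

theorem globalFrac_nonneg (x : V → ℕ) (i : ℕ) : 0 ≤ globalFrac x i := by
  unfold globalFrac; positivity

theorem globalFrac_le_one (x : V → ℕ) (i : ℕ) : globalFrac x i ≤ 1 := by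
  refine div_le_one_of_le₀ ?_ (by positivity)
  exact_mod_cast Finset.card_filter_le _ _

/-- The weights `serverWeight` average to one, so the bias of the type average is controlled by
both `q` and `1 - q`. -/
theorem abs_globalFrac_sub_average_le [Nonempty V] [Nonempty W] {E : Finset (V × W)}
    (hE : ∀ w, ∃ v, (v, w) ∈ E) (x : V → ℕ) (i : ℕ) :
    |globalFrac x i - 1 / (Fintype.card W : ℝ) * ∑ w, localFrac E x w i| ≤
      graphPhi E * min (globalFrac x i) (1 / 2) := by
  have hV : (0 : ℝ) < Fintype.card V := by exact_mod_cast Fintype.card_pos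
  have hW : (0 : ℝ) < Fintype.card W := by exact_mod_cast Fintype.card_pos
  set g : V → ℝ := fun v => if i ≤ x v then 1 else 0 with hg
  have hg0 (v) : 0 ≤ g v := by simp only [hg]; split_ifs <;> norm_num
  have hg1 (v) : g v ≤ 1 := by simp only [hg]; split_ifs <;> norm_num
  have hq : globalFrac x i = 1 / (Fintype.card V : ℝ) * ∑ v, g v := by
    rw [globalFrac_eq_sum]; ring
  have havg : 1 / (Fintype.card W : ℝ) * ∑ w, localFrac E x w i =
      1 / (Fintype.card V : ℝ) * ∑ v, serverWeight E v * g v := by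
    simp only [localFrac_eq_sum]; exact average_servers E g
  have hone : 1 / (Fintype.card V : ℝ) * ∑ v, serverWeight E v = 1 := by
    have := average_servers E (fun _ : V => (1 : ℝ))
    simp only [mul_one] at this
    rw [← this]
    have h1 (w : W) : (∑ v ∈ serversOf E w, (1 : ℝ)) / typeDeg E w = 1 := by
      rw [Finset.sum_const, nsmul_eq_mul, mul_one]; exact div_self (typeDeg_pos (hE w)).ne'
    rw [Finset.sum_congr rfl fun w _ => h1 w]
    simp only [Finset.sum_const, Finset.card_univ, nsmul_eq_mul, mul_one]
    field_simp
  have key (k : V → ℝ) (hk : ∀ v, 0 ≤ k v) :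
      |1 / (Fintype.card V : ℝ) * ∑ v, (serverWeight E v - 1) * k v| ≤
        graphPhi E * (1 / (Fintype.card V : ℝ) * ∑ v, k v) := by
    rw [abs_mul, abs_of_nonneg (by positivity), mul_left_comm]
    gcongr
    rw [Finset.mul_sum]
    refine (Finset.abs_sum_le_sum_abs _ _).trans (Finset.sum_le_sum fun v _ => ?_)
    rw [abs_mul, abs_of_nonneg (hk v)]
    exact mul_le_mul_of_nonneg_right (abs_serverWeight_sub_one_le E v) (hk v)
  have hcard : 1 / (Fintype.card V : ℝ) * ∑ v : V, (1 : ℝ) = 1 := by simp [hV.ne']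
  have e1 : globalFrac x i - 1 / (Fintype.card W : ℝ) * ∑ w, localFrac E x w i =
      -(1 / (Fintype.card V : ℝ) * ∑ v, (serverWeight E v - 1) * g v) := by
    rw [hq, havg]; simp only [sub_mul, Finset.sum_sub_distrib, one_mul]; ring
  -- As `serverWeight - 1` averages to zero, `g` may be replaced by `1 - g` up to sign. This yields
  -- the bound `φ * (1 - q)` next to `φ * q`, and one of `q`, `1 - q` is at most `1 / 2`.
  have e2 : globalFrac x i - 1 / (Fintype.card W : ℝ) * ∑ w, localFrac E x w i =
      1 / (Fintype.card V : ℝ) * ∑ v, (serverWeight E v - 1) * (1 - g v) := by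
    rw [e1]; simp only [mul_sub, sub_mul, Finset.sum_sub_distrib, one_mul, mul_one]
    rw [hone, hcard]; ring
  have b1 := key g hg0
  have b2 := key (fun v => 1 - g v) fun v => sub_nonneg.2 (hg1 v)
  rw [← abs_neg, ← e1, ← hq] at b1
  rw [← e2, Finset.sum_sub_distrib, mul_sub, hcard, ← hq] at b2
  have hφ := graphPhi_nonneg E
  rcases le_total (globalFrac x i) (1 / 2) with h | h
  · rwa [min_eq_left h]
  · rw [min_eq_right h]
    exact b2.trans (by gcongr; linarith)

theorem sq_globalFrac_sub_le [Nonempty V] [Nonempty W] {E : Finset (V × W)}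
    (hE : ∀ w, ∃ v, (v, w) ∈ E) (x : V → ℕ) (p : ℕ → ℝ) (i : ℕ) :
    (globalFrac x i - p i) ^ 2 ≤ 2 * graphPhi E ^ 2 * min (globalFrac x i) (1 / 2) ^ 2 +
      2 * localDiscrepancy E x p i ^ 2 := by
  have hW : (0 : ℝ) < Fintype.card W := by exact_mod_cast Fintype.card_pos
  have h1 := abs_globalFrac_sub_average_le hE x i
  have h2 : |1 / (Fintype.card W : ℝ) * ∑ w, localFrac E x w i - p i| ≤
      localDiscrepancy E x p i := by
    have : 1 / (Fintype.card W : ℝ) * ∑ w, localFrac E x w i - p i =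
        1 / (Fintype.card W : ℝ) * ∑ w, (localFrac E x w i - p i) := by
      rw [Finset.sum_sub_distrib]; simp; field_simp
    rw [this, abs_mul, abs_of_nonneg (by positivity), localDiscrepancy]
    gcongr
    exact Finset.abs_sum_le_sum_abs _ _
  have h3 := (abs_sub_le (globalFrac x i) (1 / (Fintype.card W : ℝ) * ∑ w, localFrac E x w i)
    (p i)).trans (add_le_add h1 h2)
  rw [← sq_abs]
  calc _ ≤ (graphPhi E * min (globalFrac x i) (1 / 2) + localDiscrepancy E x p i) ^ 2 := by gcongr
    _ ≤ _ := by nlinarith [sq_nonneg (graphPhi E * min (globalFrac x i) (1 / 2) -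
        localDiscrepancy E x p i)]

/-- A monotone function of the queue lengths that dominates the bias of the type average and that
an arrival increases by at most `1 / |V|`. -/
noncomputable def cappedEnergy (n : ℕ) (x : V → ℕ) : ℝ :=
  ∑ j ∈ Finset.range n, min (globalFrac x (j + 1)) (1 / 2) ^ 2

theorem cappedEnergy_nonneg (n : ℕ) (x : V → ℕ) : 0 ≤ cappedEnergy n x :=
  Finset.sum_nonneg fun _ _ => sq_nonneg _

theorem cappedEnergy_le (n : ℕ) (x : V → ℕ) : cappedEnergy n x ≤ n := by
  calc _ ≤ ∑ j ∈ Finset.range n, (1 : ℝ) := Finset.sum_le_sum fun j _ => by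
        refine pow_le_one₀ (le_min (globalFrac_nonneg _ _) (by norm_num)) ?_
        exact (min_le_left _ _).trans (globalFrac_le_one _ _)
    _ = n := by simp

theorem globalFrac_mono {x y : V → ℕ} (h : x ≤ y) (i : ℕ) : globalFrac x i ≤ globalFrac y i := by
  unfold globalFrac
  gcongr with v
  exact h v

theorem cappedEnergy_mono (n : ℕ) {x y : V → ℕ} (h : x ≤ y) :
    cappedEnergy n x ≤ cappedEnergy n y := by
  refine Finset.sum_le_sum fun j _ => ?_
  have := globalFrac_nonneg x (j + 1)
  have := globalFrac_mono h (j + 1)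
  gcongr

/-- The slope of `q ^ 2` is at most one up to `q = 1 / 2`, and the capped function is constant
afterwards. Without the cap the Lipschitz constant would be `2`. -/
theorem sq_min_half_sub_le {a b : ℝ} (ha : 0 ≤ a) (hab : a ≤ b) :
    min b (1 / 2) ^ 2 - min a (1 / 2) ^ 2 ≤ b - a := by
  rcases le_total a (1 / 2) with h1 | h1 <;> rcases le_total b (1 / 2) with h2 | h2 <;>
    simp only [h1, h2, min_eq_left, min_eq_right] <;> nlinarith

theorem cappedEnergy_up_sub_le (n : ℕ) (x : V → ℕ) (v : V) :
    cappedEnergy n (Function.update x v (x v + 1)) - cappedEnergy n x ≤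
      1 / (Fintype.card V : ℝ) := by
  have hle : x ≤ Function.update x v (x v + 1) := by
    intro u
    by_cases h : u = v
    · subst h; simp
    · simp [Function.update_of_ne h]
  rw [cappedEnergy, cappedEnergy, ← Finset.sum_sub_distrib]
  have hj (j : ℕ) : globalFrac (Function.update x v (x v + 1)) (j + 1) - globalFrac x (j + 1) =
      if x v = j then 1 / (Fintype.card V : ℝ) else 0 := by
    rw [globalFrac_eq_sum, globalFrac_eq_sum, ← sub_div,
      sum_update_sub _ (fun n => if j + 1 ≤ n then (1 : ℝ) else 0)]
    rcases lt_trichotomy (x v) j with h1 | h1 | h1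
    · simp [show ¬ j ≤ x v by omega, show ¬ j + 1 ≤ x v by omega, h1.ne]
    · simp [h1]
    · simp [show j ≤ x v by omega, show j + 1 ≤ x v by omega, h1.ne']
  calc _ ≤ ∑ j ∈ Finset.range n, if x v = j then 1 / (Fintype.card V : ℝ) else 0 := by
        refine Finset.sum_le_sum fun j _ => ?_
        rw [← hj]
        exact sq_min_half_sub_le (globalFrac_nonneg _ _) (globalFrac_mono hle _)
    _ ≤ _ := by
        rw [Finset.sum_ite_eq]
        split_ifs
        · exact le_rfl
        · positivity

/-- Departures cannot increase a monotone function. Arrivals have total rate `lam * |V|` and each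
adds at most `1 / |V|`; the positive part `(· - c)⁺` preserves both properties. -/
theorem queueGenerator_cappedEnergy_le [Nonempty V] [Nonempty W] (hd : 1 ≤ d) (hlam : 0 ≤ lam)
    {E : Finset (V × W)} (hE : ∀ w, ∃ v, (v, w) ∈ E) (n : ℕ) (c : ℝ) (x : V → ℕ) :
    queueGenerator lam d E (fun y => max (cappedEnergy n y - c) 0) x ≤ lam := by
  have hV : (0 : ℝ) < Fintype.card V := by exact_mod_cast Fintype.card_pos
  calc _ ≤ ∑ v, joinRate lam d E x v * (1 / (Fintype.card V : ℝ)) := by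
        refine Finset.sum_le_sum fun v _ => ?_
        rw [← add_zero (joinRate lam d E x v * (1 / (Fintype.card V : ℝ)))]
        refine add_le_add ?_ ?_
        · refine mul_le_mul_of_nonneg_left ?_ (joinRate_nonneg hlam _ _ _)
          have h1 := cappedEnergy_up_sub_le n x v
          have h2 : (0 : ℝ) ≤ 1 / (Fintype.card V : ℝ) := by positivity
          rw [sub_le_iff_le_add]
          refine max_le ?_ ?_
          · have := le_max_left (cappedEnergy n x - c) 0
            linarith
          · have := le_max_right (cappedEnergy n x - c) 0
            linarith
        · split_ifs with hv
          · rw [sub_nonpos]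
            refine max_le_max (sub_le_sub_right (cappedEnergy_mono n ?_) _) le_rfl
            intro u
            by_cases h : u = v
            · subst h; simp
            · simp [Function.update_of_ne h]
          · exact le_rfl
    _ = lam := by
        rw [← Finset.sum_mul, sum_joinRate hd lam hE]; field_simp

end Generator

end SpatialLoadBalancing

namespace SpatialLoadBalancing

/-! ### Suprema over time intervals through dyadic grids. -/

section DyadicGrid

open Filter Topology

/-- The `k`-th point of the `n`-th dyadic grid on `[0, t]`. -/
noncomputable def dyadicPoint (t : ℝ≥0) (n k : ℕ) : ℝ≥0 := t * (k / 2 ^ n)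

theorem tendsto_dyadicPoint_ceil {t : ℝ≥0} (ht : t ≠ 0) (s : ℝ≥0) :
    Tendsto (fun n => dyadicPoint t n ⌈(s / t : ℝ≥0) * (2 : ℝ≥0) ^ n⌉₊) atTop (𝓝[≥] s) := by
  rw [tendsto_nhdsWithin_iff]
  constructor
  · have h2 : Tendsto (fun n : ℕ => (2 : ℝ) ^ n) atTop atTop :=
      tendsto_pow_atTop_atTop_of_one_lt (by norm_num)
    have h1 := ((tendsto_nat_ceil_mul_div_atTop (R := ℝ) (a := ((s / t : ℝ≥0) : ℝ))
      (by positivity)).comp h2).const_mul (t : ℝ)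
    rw [← NNReal.tendsto_coe]
    have e : (t : ℝ) * ((s / t : ℝ≥0) : ℝ) = s := by
      rw [← NNReal.coe_mul, mul_div_cancel₀ _ ht]
    rw [e] at h1
    refine h1.congr fun n => ?_
    simp only [Function.comp_def, dyadicPoint]
    have e : ⌈((s / t : ℝ≥0) : ℝ) * 2 ^ n⌉₊ = ⌈(s / t : ℝ≥0) * (2 : ℝ≥0) ^ n⌉₊ := by
      refine eq_of_forall_ge_iff fun m => ?_
      rw [Nat.ceil_le, Nat.ceil_le, ← NNReal.coe_le_coe]; push_cast; rfl
    rw [e]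
    push_cast
    ring
  · refine Eventually.of_forall fun n => ?_
    have h := Nat.le_ceil ((s / t : ℝ≥0) * (2 : ℝ≥0) ^ n)
    calc s = t * ((s / t * 2 ^ n) / 2 ^ n) := by field_simp
      _ ≤ _ := by unfold dyadicPoint; gcongr

theorem dyadicPoint_mono (t : ℝ≥0) (n : ℕ) : Monotone (dyadicPoint t n) := by
  intro k l h
  unfold dyadicPoint
  gcongr

theorem dyadicPoint_zero (t : ℝ≥0) (n : ℕ) : dyadicPoint t n 0 = 0 := by simp [dyadicPoint]

theorem dyadicPoint_last (t : ℝ≥0) (n : ℕ) : dyadicPoint t n (2 ^ n) = t := by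
  simp [dyadicPoint]

theorem dyadicPoint_two_mul (t : ℝ≥0) (n k : ℕ) :
    dyadicPoint t (n + 1) (2 * k) = dyadicPoint t n k := by
  simp only [dyadicPoint]; push_cast; rw [pow_succ]; field_simp

/-- The maximum of a function over the `n`-th dyadic grid on `[0, t]`. -/
noncomputable def dyadicSup (t : ℝ≥0) (g : ℝ≥0 → ℝ≥0∞) (n : ℕ) : ℝ≥0∞ :=
  (Finset.range (2 ^ n + 1)).sup fun k => g (dyadicPoint t n k)

theorem dyadicSup_mono (t : ℝ≥0) (g : ℝ≥0 → ℝ≥0∞) : Monotone (dyadicSup t g) := by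
  refine monotone_nat_of_le_succ fun n => Finset.sup_le fun k hk => ?_
  rw [← dyadicPoint_two_mul]
  refine Finset.le_sup (f := fun k => g (dyadicPoint t (n + 1) k)) ?_
  rw [Finset.mem_range] at hk ⊢
  rw [pow_succ]; omega

/-- Every `s` is a limit from the right of grid points obtained by rounding up. Rounding does not
leave the interval, since `s / t ≤ 1` and the right endpoint `t` belongs to each grid. -/
theorem iSup_Icc_eq_iSup_dyadicSup (t : ℝ≥0) {g : ℝ≥0 → ℝ≥0∞}
    (hg : ∀ s, ContinuousWithinAt g (Set.Ici s) s) :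
    ⨆ s ∈ Set.Icc (0 : ℝ≥0) t, g s = ⨆ n, dyadicSup t g n := by
  refine le_antisymm (iSup₂_le fun s hs => ?_) (iSup_le fun n => Finset.sup_le fun k hk => ?_)
  · rcases eq_or_ne t 0 with rfl | ht
    · have : s = dyadicPoint 0 0 0 := by
        rw [dyadicPoint_zero]; exact le_antisymm hs.2 hs.1
      rw [this]
      exact (Finset.le_sup (f := fun k => g (dyadicPoint 0 0 k)) (by simp)).trans
        (le_iSup (dyadicSup 0 g) 0)
    · refine le_of_tendsto ((hg s).tendsto.comp (tendsto_dyadicPoint_ceil ht s))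
        (Eventually.of_forall fun n => ?_)
      refine (Finset.le_sup (f := fun k => g (dyadicPoint t n k)) ?_).trans
        (le_iSup (dyadicSup t g) n)
      rw [Finset.mem_range, Nat.lt_succ_iff, Nat.ceil_le]
      have : s / t ≤ 1 := div_le_one_of_le₀ hs.2 (zero_le)
      calc (s / t) * (2 : ℝ≥0) ^ n ≤ 1 * 2 ^ n := by gcongr
        _ = _ := by push_cast; rw [one_mul]
  · refine le_iSup₂ (f := fun s (_ : s ∈ Set.Icc (0 : ℝ≥0) t) => g s) (dyadicPoint t n k)
      ⟨zero_le, ?_⟩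
    conv_rhs => rw [← dyadicPoint_last t n]
    exact dyadicPoint_mono t n (Nat.lt_succ_iff.1 (Finset.mem_range.1 hk))

variable {Ω : Type*} {mΩ : MeasurableSpace Ω} {P : Measure Ω}

theorem measurable_dyadicSup (t : ℝ≥0) {g : ℝ≥0 → Ω → ℝ≥0∞} (hm : ∀ s, Measurable (g s)) (n : ℕ) :
    Measurable fun ω => dyadicSup t (fun s => g s ω) n := by
  simp only [dyadicSup, Finset.sup_eq_iSup]
  exact Measurable.biSup _ (Finset.countable_toSet _) fun k _ => hm _

theorem measurable_iSup_Icc (t : ℝ≥0) {g : ℝ≥0 → Ω → ℝ≥0∞} (hm : ∀ s, Measurable (g s))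
    (hg : ∀ ω s, ContinuousWithinAt (fun s => g s ω) (Set.Ici s) s) :
    Measurable fun ω => ⨆ s ∈ Set.Icc (0 : ℝ≥0) t, g s ω := by
  simp_rw [fun ω => iSup_Icc_eq_iSup_dyadicSup t (hg ω)]
  exact Measurable.iSup fun n => measurable_dyadicSup t hm n

theorem lintegral_iSup_Icc_le (t : ℝ≥0) {g : ℝ≥0 → Ω → ℝ≥0∞} (hm : ∀ s, Measurable (g s))
    (hg : ∀ ω s, ContinuousWithinAt (fun s => g s ω) (Set.Ici s) s) {B : ℝ≥0∞}
    (hB : ∀ n, ∫⁻ ω, dyadicSup t (fun s => g s ω) n ∂P ≤ B) :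
    ∫⁻ ω, ⨆ s ∈ Set.Icc (0 : ℝ≥0) t, g s ω ∂P ≤ B := by
  simp_rw [fun ω => iSup_Icc_eq_iSup_dyadicSup t (hg ω)]
  rw [lintegral_iSup (fun n => measurable_dyadicSup t hm n)
    fun m n h ω => dyadicSup_mono t _ h]
  exact iSup_le hB

/-- A right-continuous measurable process is jointly measurable. -/
theorem measurable_uncurry_of_rightContinuous {g : ℝ≥0 → Ω → ℝ} (hm : ∀ s, Measurable (g s))
    (hg : ∀ ω s, ContinuousWithinAt (fun s => g s ω) (Set.Ici s) s) :
    Measurable (Function.uncurry g) := by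
  -- Time is rounded up to the next multiple of `2 ^ (-n)`; the index is unbounded here, so all of
  -- `ℝ≥0` is covered.
  obtain ⟨c, hc, hlim⟩ : ∃ c : ℕ → ℝ≥0 → ℕ, (∀ n, Measurable (c n)) ∧
      ∀ s, Tendsto (fun n => dyadicPoint 1 n (c n s)) atTop (𝓝[≥] s) :=
    ⟨fun n s => ⌈(s / 1 : ℝ≥0) * (2 : ℝ≥0) ^ n⌉₊, fun n => Nat.measurable_ceil.comp (by fun_prop),
      fun s => tendsto_dyadicPoint_ceil one_ne_zero s⟩
  have h1 (n : ℕ) : Measurable fun p : ℝ≥0 × Ω => g (dyadicPoint 1 n (c n p.1)) p.2 := by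
    have h2 : Measurable fun p : ℕ × Ω => g (dyadicPoint 1 n p.1) p.2 :=
      measurable_from_prod_countable_right fun k => hm (dyadicPoint 1 n k)
    have h3 : Measurable fun p : ℝ≥0 × Ω => (c n p.1, p.2) :=
      ((hc n).comp measurable_fst).prodMk measurable_snd
    have h4 := h2.comp h3
    exact h4
  refine measurable_of_tendsto_metrizable h1 (tendsto_pi_nhds.2 fun p => ?_)
  exact (hg p.2 p.1).tendsto.comp (hlim p.1)

end DyadicGrid

/-! ### Doob's maximal inequality in mean square. -/

section Doob

/-- The running maximum of the absolute values of a sequence. -/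
noncomputable def runningMax (x : ℕ → ℝ) : ℕ → ℝ
  | 0 => |x 0|
  | n + 1 => max (runningMax x n) |x (n + 1)|

theorem abs_le_runningMax (x : ℕ → ℝ) {k n : ℕ} (h : k ≤ n) : |x k| ≤ runningMax x n := by
  induction n with
  | zero => rw [Nat.le_zero.1 h]; exact le_rfl
  | succ n ih =>
    rcases Nat.le_succ_iff.1 h with h | rfl
    · exact (ih h).trans (le_max_left _ _)
    · exact le_max_right _ _

theorem runningMax_nonneg (x : ℕ → ℝ) (n : ℕ) : 0 ≤ runningMax x n :=
  (abs_nonneg _).trans (abs_le_runningMax x le_rfl)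

theorem runningMax_le {x : ℕ → ℝ} {C : ℝ} {n : ℕ} (h : ∀ k ≤ n, |x k| ≤ C) :
    runningMax x n ≤ C := by
  induction n with
  | zero => exact h 0 le_rfl
  | succ n ih => exact max_le (ih fun k hk => h k (hk.trans n.le_succ)) (h _ le_rfl)

/-- The sign is a subgradient of the absolute value. -/
theorem sign_mul_sub_le (a b : ℝ) : SignType.sign a * (b - a) ≤ |b| - |a| := by
  rcases lt_trichotomy a 0 with h | rfl | h
  · simp [sign_neg h, abs_of_neg h]; linarith [neg_abs_le b]
  · simp
  · simp [sign_pos h, abs_of_pos h]; linarith [le_abs_self b]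

/-- The pathwise form of Doob's maximal inequality. -/
theorem runningMax_sq_le (x : ℕ → ℝ) (n : ℕ) :
    runningMax x n ^ 2 + 4 * ∑ k ∈ Finset.range n,
      runningMax x k * SignType.sign (x k) * (x (k + 1) - x k) ≤ 4 * x n ^ 2 := by
  -- Discrete integration by parts: when the maximum increases, `|x (n + 1)|` is the new maximum and
  -- half a square of the jump is left over. The final estimate completes the square in `2 * |x n| -
  -- R`, where `R` is the running maximum.
  have key : ∑ k ∈ Finset.range n, runningMax x k * SignType.sign (x k) * (x (k + 1) - x k) ≤
      runningMax x n * |x n| - runningMax x n ^ 2 / 2 := by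
    induction n with
    | zero => simp [runningMax]; nlinarith [sq_nonneg (x 0)]
    | succ n ih =>
      rw [Finset.sum_range_succ]
      have h0 := runningMax_nonneg x n
      have h1 : runningMax x n * SignType.sign (x n) * (x (n + 1) - x n) ≤
          runningMax x n * (|x (n + 1)| - |x n|) := by
        rw [mul_assoc]
        exact mul_le_mul_of_nonneg_left (sign_mul_sub_le _ _) h0
      simp only [runningMax]
      rcases le_total (runningMax x n) |x (n + 1)| with h | h
      · rw [max_eq_right h]; nlinarith [sq_nonneg (|x (n + 1)| - runningMax x n)]
      · rw [max_eq_left h]; nlinarith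
  rw [← sq_abs (x n)]
  nlinarith [sq_nonneg (2 * |x n| - runningMax x n)]

variable {Ω : Type*} {mΩ : MeasurableSpace Ω} {P : Measure Ω} [IsProbabilityMeasure P]
  {𝓕 : Filtration ℝ≥0 mΩ} {M : ℝ≥0 → Ω → ℝ}

/-- Conditioning on the earlier time allows the bounded factor to be pulled out. -/
theorem integral_mul_martingale_sub (hM : Martingale M 𝓕 P) {s u : ℝ≥0} (hsu : s ≤ u)
    {H : Ω → ℝ} (hH : Measurable[𝓕 s] H) {C : ℝ} (hC : ∀ ω, |H ω| ≤ C) :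
    ∫ ω, H ω * (M u ω - M s ω) ∂P = 0 := by
  have hint : Integrable (M u - M s) P := (hM.integrable u).sub (hM.integrable s)
  have h1 : P[H * (M u - M s) | 𝓕 s] =ᵐ[P] H * P[M u - M s | 𝓕 s] :=
    condExp_stronglyMeasurable_mul_of_bound (𝓕.le s) hH.stronglyMeasurable hint C
      (ae_of_all _ hC)
  have h2 : P[M u - M s | 𝓕 s] =ᵐ[P] 0 := by
    filter_upwards [condExp_sub (hM.integrable u) (hM.integrable s) (𝓕 s), hM.condExp_ae_eq hsu,
      hM.condExp_ae_eq (le_refl s)] with ω a b c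
    rw [a, Pi.sub_apply, b, c]; simp
  calc _ = ∫ ω, (P[H * (M u - M s) | 𝓕 s]) ω ∂P := (integral_condExp (𝓕.le s)).symm
    _ = ∫ ω, (0 : ℝ) ∂P := integral_congr_ae (by
        filter_upwards [h1, h2] with ω a b
        rw [a, Pi.mul_apply, b]; simp)
    _ = 0 := by simp

theorem measurable_runningMax {mΩ' : MeasurableSpace Ω} {x : ℕ → Ω → ℝ} {n : ℕ}
    (h : ∀ k ≤ n, Measurable (x k)) : Measurable fun ω => runningMax (fun k => x k ω) n := by
  induction n with
  | zero => exact (h 0 le_rfl).norm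
  | succ n ih => exact (ih fun k hk => h k (hk.trans n.le_succ)).max (h _ le_rfl).norm

theorem integral_runningMax_sq_le (hM : Martingale M 𝓕 P) {τ : ℕ → ℝ≥0} (hτ : Monotone τ)
    {C : ℝ} (n : ℕ) (hC : ∀ k ≤ n, ∀ ω, |M (τ k) ω| ≤ C) :
    ∫ ω, runningMax (fun k => M (τ k) ω) n ^ 2 ∂P ≤ 4 * ∫ ω, M (τ n) ω ^ 2 ∂P := by
  have hMm (k l : ℕ) (h : k ≤ l) : Measurable[𝓕 (τ l)] (M (τ k)) :=
    ((hM.stronglyAdapted (τ k)).measurable).mono (𝓕.mono (hτ h)) le_rfl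
  have hMm' (k : ℕ) : Measurable (M (τ k)) := (hMm k k le_rfl).mono (𝓕.le _) le_rfl
  set R : ℕ → Ω → ℝ := fun k ω => runningMax (fun k => M (τ k) ω) k with hR
  have hRm (k : ℕ) : Measurable[𝓕 (τ k)] (R k) := measurable_runningMax fun l hl => hMm l k hl
  have hRm' (k : ℕ) : Measurable (R k) := (hRm k).mono (𝓕.le _) le_rfl
  have hR0 (k : ℕ) (ω) : 0 ≤ R k ω := runningMax_nonneg _ _
  have hRC (k : ℕ) (hk : k ≤ n) (ω) : R k ω ≤ C := runningMax_le fun l hl => hC l (hl.trans hk) ω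
  have hsm : Measurable (fun a : ℝ => ((SignType.sign a : SignType) : ℝ)) := by
    have : (fun a : ℝ => ((SignType.sign a : SignType) : ℝ)) =
        fun a => if 0 < a then 1 else if a < 0 then -1 else 0 := by
      ext a
      rw [sign_apply]
      split_ifs <;> simp
    rw [this]
    exact Measurable.ite measurableSet_Ioi measurable_const
      (Measurable.ite measurableSet_Iio measurable_const measurable_const)
  have hs1 (a : ℝ) : |((SignType.sign a : SignType) : ℝ)| ≤ 1 := by
    rcases lt_trichotomy a 0 with h | rfl | h
    · simp [sign_neg h]
    · simp
    · simp [sign_pos h]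
  have hHC (k : ℕ) (hk : k ≤ n) (ω) : |R k ω * SignType.sign (M (τ k) ω)| ≤ C := by
    rw [abs_mul, abs_of_nonneg (hR0 k ω)]
    calc _ ≤ R k ω * 1 := by gcongr; exacts [hR0 k ω, hs1 _]
      _ ≤ C := by rw [mul_one]; exact hRC k hk ω
  have hHm (k : ℕ) : Measurable[𝓕 (τ k)] fun ω => R k ω * SignType.sign (M (τ k) ω) :=
    (hRm k).mul (hsm.comp (hMm k k le_rfl))
  -- The integrand at step `k` is bounded and known at time `τ k`, so the sum in the pathwise
  -- inequality has mean zero.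
  have hz (k : ℕ) (hk : k ∈ Finset.range n) :
      ∫ ω, R k ω * SignType.sign (M (τ k) ω) * (M (τ (k + 1)) ω - M (τ k) ω) ∂P = 0 :=
    integral_mul_martingale_sub hM (hτ k.le_succ) (hHm k) (hHC k (Finset.mem_range.1 hk).le)
  have hint (k : ℕ) (hk : k ∈ Finset.range n) : Integrable
      (fun ω => R k ω * SignType.sign (M (τ k) ω) * (M (τ (k + 1)) ω - M (τ k) ω)) P :=
    ((hM.integrable _).sub (hM.integrable _)).bdd_mul (c := C)
      ((hHm k).mono (𝓕.le _) le_rfl).aestronglyMeasurable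
      (ae_of_all _ (hHC k (Finset.mem_range.1 hk).le))
  have hsq : Integrable (fun ω => R n ω ^ 2) P := by
    refine Integrable.of_bound ((hRm' n).pow_const 2).aestronglyMeasurable (C ^ 2)
      (ae_of_all _ fun ω => ?_)
    rw [Real.norm_eq_abs, abs_of_nonneg (sq_nonneg _)]
    have := hR0 n ω
    gcongr
    exact hRC n le_rfl ω
  have hMsq : Integrable (fun ω => M (τ n) ω ^ 2) P := by
    refine Integrable.of_bound ((hMm' n).pow_const 2).aestronglyMeasurable (C ^ 2)
      (ae_of_all _ fun ω => ?_)
    rw [Real.norm_eq_abs, abs_of_nonneg (sq_nonneg _), ← sq_abs]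
    gcongr
    exact hC n le_rfl ω
  have hmono := integral_mono (hsq.add ((integrable_finsetSum _ hint).const_mul 4))
    (hMsq.const_mul 4) fun ω => runningMax_sq_le (fun k => M (τ k) ω) n
  simp only [Pi.add_apply] at hmono
  rw [integral_add hsq ((integrable_finsetSum _ hint).const_mul 4), integral_const_mul,
    integral_const_mul, integral_finsetSum _ hint, Finset.sum_eq_zero hz, mul_zero,
    add_zero] at hmono
  exact hmono

/-- Doob's `L²` maximal inequality for a bounded right-continuous martingale. -/
theorem lintegral_iSup_martingale_sq_le (hM : Martingale M 𝓕 P)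
    (hrc : ∀ ω s, ContinuousWithinAt (fun s => M s ω) (Set.Ici s) s) (t : ℝ≥0) {C : ℝ}
    (hC : ∀ s ≤ t, ∀ ω, |M s ω| ≤ C) :
    ∫⁻ ω, ⨆ s ∈ Set.Icc (0 : ℝ≥0) t, ENNReal.ofReal (M s ω ^ 2) ∂P ≤
      ENNReal.ofReal (4 * ∫ ω, M t ω ^ 2 ∂P) := by
  have hMm (s : ℝ≥0) : Measurable (M s) :=
    (hM.stronglyAdapted s).measurable.mono (𝓕.le s) le_rfl
  refine lintegral_iSup_Icc_le t (fun s => ((hMm s).pow_const 2).ennreal_ofReal) (fun ω s => ?_)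
    fun n => ?_
  · exact ENNReal.continuous_ofReal.continuousAt.comp_continuousWithinAt ((hrc ω s).pow 2)
  · have hle (k : ℕ) (hk : k ≤ 2 ^ n) : dyadicPoint t n k ≤ t := by
      conv_rhs => rw [← dyadicPoint_last t n]
      exact dyadicPoint_mono t n hk
    have h1 := integral_runningMax_sq_le hM (dyadicPoint_mono t n) (2 ^ n)
      (fun k hk ω => hC _ (hle k hk) ω)
    rw [dyadicPoint_last] at h1
    refine le_trans ?_ (ENNReal.ofReal_le_ofReal h1)
    rw [ofReal_integral_eq_lintegral_ofReal ?_ (ae_of_all _ fun ω => sq_nonneg _)]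
    · refine lintegral_mono fun ω => Finset.sup_le fun k hk => ENNReal.ofReal_le_ofReal ?_
      rw [← sq_abs]
      gcongr
      exact abs_le_runningMax (fun k => M (dyadicPoint t n k) ω)
        (Nat.lt_succ_iff.1 (Finset.mem_range.1 hk))
    · refine Integrable.of_bound ((measurable_runningMax fun k _ =>
        hMm (dyadicPoint t n k)).pow_const 2).aestronglyMeasurable (C ^ 2) (ae_of_all _ fun ω => ?_)
      rw [Real.norm_eq_abs, abs_of_nonneg (sq_nonneg _)]
      have := runningMax_nonneg (fun k => M (dyadicPoint t n k) ω) (2 ^ n)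
      gcongr
      exact runningMax_le fun k hk => hC _ (hle k hk) ω

end Doob

end SpatialLoadBalancing

namespace SpatialLoadBalancing

/-! ### Second moments of compensated processes. -/

section Compensator

set_option linter.unusedSectionVars false

open Filter Topology

variable {Ω : Type*} {mΩ : MeasurableSpace Ω} {P : Measure Ω} [IsProbabilityMeasure P]

theorem integral_intervalIntegral_swap {g : ℝ≥0 → Ω → ℝ} (hg : Measurable (Function.uncurry g))
    (t : ℝ≥0) {C : ℝ} (hC : ∀ s ≤ t, ∀ ω, |g s ω| ≤ C) :
    ∫ ω, (∫ s in (0 : ℝ)..t, g s.toNNReal ω) ∂P =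
      ∫ s in (0 : ℝ)..t, (∫ ω, g s.toNNReal ω ∂P) := by
  refine (intervalIntegral_integral_swap (f := fun s ω => g (Real.toNNReal s) ω) ?_).symm
  have hm : Measurable (Function.uncurry fun (s : ℝ) ω => g s.toNNReal ω) :=
    hg.comp ((measurable_real_toNNReal.comp measurable_fst).prodMk measurable_snd)
  have hfin : IsFiniteMeasure (volume.restrict (Set.uIoc (0 : ℝ) t)) := by
    constructor; simp
  refine Integrable.of_bound hm.aestronglyMeasurable C ?_
  have h1 : ∀ᵐ s ∂(volume.restrict (Set.uIoc (0 : ℝ) t)), s ∈ Set.uIoc (0 : ℝ) t :=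
    ae_restrict_mem measurableSet_uIoc
  filter_upwards [Measure.quasiMeasurePreserving_fst.ae h1] with p hp
  refine hC _ ?_ _
  rw [Set.uIoc_of_le t.coe_nonneg] at hp
  exact Real.toNNReal_le_iff_le_coe.2 hp.2

variable {S : Type*} [TopologicalSpace S] [DiscreteTopology S]
  {X : ℝ≥0 → Ω → S}

theorem rightContinuous_comp (hrc : ∀ ω t, ContinuousWithinAt (fun s => X s ω) (Set.Ici t) t)
    (f : S → ℝ) (ω : Ω) (t : ℝ≥0) :
    ContinuousWithinAt (fun s => f (X s ω)) (Set.Ici t) t :=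
  (continuous_of_discreteTopology (f := f)).continuousAt.comp_continuousWithinAt (hrc ω t)

/-- The time integral of a function along a path. -/
noncomputable def pathIntegral (X : ℝ≥0 → Ω → S) (b : S → ℝ) (ω : Ω) (t : ℝ) : ℝ :=
  ∫ s in (0 : ℝ)..t, b (X s.toNNReal ω)

variable [MeasurableSpace S] [Countable S] [MeasurableSingletonClass S]

theorem measurable_uncurry_comp (hX : ∀ t, Measurable (X t))
    (hrc : ∀ ω t, ContinuousWithinAt (fun s => X s ω) (Set.Ici t) t) (f : S → ℝ) :
    Measurable (Function.uncurry fun s ω => f (X s ω)) :=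
  measurable_uncurry_of_rightContinuous (fun s => (measurable_of_countable f).comp (hX s))
    (rightContinuous_comp hrc f)

theorem measurable_path (hX : ∀ t, Measurable (X t))
    (hrc : ∀ ω t, ContinuousWithinAt (fun s => X s ω) (Set.Ici t) t) (f : S → ℝ) (ω : Ω) :
    Measurable fun s : ℝ => f (X s.toNNReal ω) :=
  (measurable_uncurry_comp hX hrc f).comp
    (measurable_real_toNNReal.prodMk (measurable_const (a := ω)))

theorem intervalIntegrable_path (hX : ∀ t, Measurable (X t))
    (hrc : ∀ ω t, ContinuousWithinAt (fun s => X s ω) (Set.Ici t) t) {f : S → ℝ} {C : ℝ}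
    (hC : ∀ x, |f x| ≤ C) (ω : Ω) (a c : ℝ) :
    IntervalIntegrable (fun s : ℝ => f (X s.toNNReal ω)) volume a c := by
  refine (intervalIntegrable_const (c := C)).mono_fun
    (measurable_path hX hrc f ω).aestronglyMeasurable (ae_of_all _ fun s => ?_)
  exact (hC _).trans (le_abs_self C)

theorem abs_pathIntegral_le {b : S → ℝ} {C : ℝ} (hC : ∀ x, |b x| ≤ C) (ω : Ω) (t : ℝ≥0) :
    |pathIntegral X b ω t| ≤ C * t := by
  have := intervalIntegral.norm_integral_le_of_norm_le_const (a := (0 : ℝ)) (b := t) (C := C)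
    (f := fun s => b (X s.toNNReal ω)) fun s _ => hC _
  simpa [pathIntegral] using this

theorem continuous_pathIntegral (hX : ∀ t, Measurable (X t))
    (hrc : ∀ ω t, ContinuousWithinAt (fun s => X s ω) (Set.Ici t) t) {b : S → ℝ} {C : ℝ}
    (hC : ∀ x, |b x| ≤ C) (ω : Ω) : Continuous (pathIntegral X b ω) :=
  intervalIntegral.continuous_primitive (fun a c => intervalIntegrable_path hX hrc hC ω a c) 0

theorem measurable_pathIntegral (hX : ∀ t, Measurable (X t))
    (hrc : ∀ ω t, ContinuousWithinAt (fun s => X s ω) (Set.Ici t) t) (b : S → ℝ) (t : ℝ≥0) :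
    Measurable fun ω => pathIntegral X b ω t := by
  have hm : StronglyMeasurable (Function.uncurry fun ω (s : ℝ) => b (X s.toNNReal ω)) :=
    ((measurable_uncurry_comp hX hrc b).comp
      ((measurable_real_toNNReal.comp measurable_snd).prodMk measurable_fst)).stronglyMeasurable
  simp only [pathIntegral, intervalIntegral.integral_of_le t.coe_nonneg]
  exact hm.integral_prod_right.measurable

theorem rightContinuous_pathIntegral (hX : ∀ t, Measurable (X t))
    (hrc : ∀ ω t, ContinuousWithinAt (fun s => X s ω) (Set.Ici t) t) {b : S → ℝ} {C : ℝ}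
    (hC : ∀ x, |b x| ≤ C) (ω : Ω) (t : ℝ≥0) :
    ContinuousWithinAt (fun s : ℝ≥0 => pathIntegral X b ω s) (Set.Ici t) t :=
  ((continuous_pathIntegral hX hrc hC ω).comp NNReal.continuous_coe).continuousWithinAt

/-- The integrand is only right-continuous along the path, so only a right derivative is available;
this is enough for the fundamental theorem in `pathIntegral_sq`. -/
theorem hasDerivWithinAt_pathIntegral (hX : ∀ t, Measurable (X t))
    (hrc : ∀ ω t, ContinuousWithinAt (fun s => X s ω) (Set.Ici t) t) {b : S → ℝ} {C : ℝ}
    (hC : ∀ x, |b x| ≤ C) (ω : Ω) (t : ℝ) :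
    HasDerivWithinAt (pathIntegral X b ω) (b (X t.toNNReal ω)) (Set.Ioi t) t := by
  refine HasDerivWithinAt.mono (intervalIntegral.integral_hasDerivWithinAt_right (s := Set.Ici t)
    (t := Set.Ioi t) (intervalIntegrable_path hX hrc hC ω 0 t)
    ⟨Set.univ, univ_mem, (measurable_path hX hrc b ω).aestronglyMeasurable⟩ ?_)
    Set.Ioi_subset_Ici_self
  have h := (rightContinuous_comp hrc b ω t.toNNReal).tendsto
  refine h.comp (tendsto_nhdsWithin_iff.2 ⟨?_, ?_⟩)
  · exact (continuous_real_toNNReal.tendsto t).mono_left nhdsWithin_le_nhds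
  · filter_upwards [self_mem_nhdsWithin] with s hs
    exact Real.toNNReal_le_toNNReal (le_of_lt hs)

theorem pathIntegral_sq (hX : ∀ t, Measurable (X t))
    (hrc : ∀ ω t, ContinuousWithinAt (fun s => X s ω) (Set.Ici t) t) {b : S → ℝ} {C : ℝ}
    (hC : ∀ x, |b x| ≤ C) (ω : Ω) (t : ℝ≥0) :
    ∫ s in (0 : ℝ)..t, pathIntegral X b ω s * b (X s.toNNReal ω) =
      pathIntegral X b ω t ^ 2 / 2 := by
  have hc := continuous_pathIntegral hX hrc hC ω
  have h := intervalIntegral.integral_eq_sub_of_hasDeriv_right (a := 0) (b := (t : ℝ))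
    (f := fun s => pathIntegral X b ω s ^ 2 / 2)
    (f' := fun s => pathIntegral X b ω s * b (X s.toNNReal ω)) ((hc.pow 2).div_const 2).continuousOn
    (fun s _ => by
      have := ((hasDerivWithinAt_pathIntegral hX hrc hC ω s).pow 2).div_const 2
      refine this.congr_deriv ?_
      push_cast; ring)
    ((intervalIntegrable_path hX hrc hC ω 0 t).continuousOn_mul hc.continuousOn)
  rw [h]
  simp [pathIntegral]

/-- The candidate martingale `f (X t) - f (X 0) - ∫ b (X s) ds`. -/
noncomputable def compensated (X : ℝ≥0 → Ω → S) (f b : S → ℝ) (t : ℝ≥0) (ω : Ω) : ℝ :=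
  f (X t ω) - f (X 0 ω) - pathIntegral X b ω t

theorem rightContinuous_compensated (hX : ∀ t, Measurable (X t))
    (hrc : ∀ ω t, ContinuousWithinAt (fun s => X s ω) (Set.Ici t) t) (f : S → ℝ) {b : S → ℝ}
    {C : ℝ} (hC : ∀ x, |b x| ≤ C) (ω : Ω) (t : ℝ≥0) :
    ContinuousWithinAt (fun s => compensated X f b s ω) (Set.Ici t) t :=
  ((rightContinuous_comp hrc f ω t).sub continuousWithinAt_const).sub
    (rightContinuous_pathIntegral hX hrc hC ω t)

theorem abs_compensated_le {f b : S → ℝ} {C : ℝ} (hf : ∀ x, |f x| ≤ C) (hb : ∀ x, |b x| ≤ C)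
    (ω : Ω) {s t : ℝ≥0} (hst : s ≤ t) : |compensated X f b s ω| ≤ 2 * C + C * t := by
  have h1 := abs_pathIntegral_le (X := X) hb ω s
  have hC : 0 ≤ C := (abs_nonneg _).trans (hf (X 0 ω))
  have h2 : C * s ≤ C * t := by gcongr
  refine (abs_sub _ _).trans ?_
  have h3 := abs_sub (f (X s ω)) (f (X 0 ω))
  linarith [hf (X s ω), hf (X 0 ω)]

variable {𝓕 : Filtration ℝ≥0 mΩ}

/-- The second moment of the compensated process is the mean time integral of the carré du
champ. -/
theorem integral_compensated_sq (hX : ∀ t, Measurable[𝓕 t] (X t))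
    (hrc : ∀ ω t, ContinuousWithinAt (fun s => X s ω) (Set.Ici t) t) {f a b : S → ℝ} {C : ℝ}
    (hf : ∀ x, |f x| ≤ C) (ha : ∀ x, |a x| ≤ C) (hb : ∀ x, |b x| ≤ C)
    (hM : Martingale (compensated X f b) 𝓕 P)
    (hM2 : Martingale (compensated X (fun x => f x ^ 2) a) 𝓕 P) (t : ℝ≥0) :
    ∫ ω, compensated X f b t ω ^ 2 ∂P =
      ∫ ω, pathIntegral X (fun x => a x - 2 * f x * b x) ω t ∂P := by
  have hX' : ∀ t, Measurable (X t) := fun t => (hX t).mono (𝓕.le t) le_rfl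
  have hC0 (ω : Ω) : 0 ≤ C := (abs_nonneg _).trans (hf (X 0 ω))
  have hfm := measurable_of_countable f
  have hfX (s : ℝ≥0) : Measurable fun ω => f (X s ω) := hfm.comp (hX' s)
  have hbX (s : ℝ≥0) : Measurable fun ω => b (X s ω) := (measurable_of_countable b).comp (hX' s)
  have hIm := measurable_pathIntegral hX' hrc b t
  have hMm (s : ℝ≥0) : Measurable (compensated X f b s) :=
    (hM.stronglyAdapted s).measurable.mono (𝓕.le s) le_rfl
  have hprod {u v : Ω → ℝ} (hu : Measurable u) (hv : Measurable v) {A B : ℝ}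
      (hA : ∀ ω, |u ω| ≤ A) (hB : ∀ ω, |v ω| ≤ B) : Integrable (fun ω => u ω * v ω) P := by
    refine Integrable.of_bound (hu.mul hv).aestronglyMeasurable (A * B) (ae_of_all _ fun ω => ?_)
    rw [norm_mul]
    exact mul_le_mul (hA ω) (hB ω) (norm_nonneg _) ((abs_nonneg _).trans (hA ω))
  have hs {u v : Ω → ℝ} (hu : Integrable u P) (hv : Integrable v P) :
      Integrable (fun ω => u ω - v ω) P := hu.sub hv
  have hIb := abs_pathIntegral_le (X := X) hb (t := t)
  have hMb := fun ω => abs_compensated_le (X := X) hf hb ω (le_refl t)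
  have iMI := hprod (hMm t) hIm hMb hIb
  have iII := hprod hIm hIm hIb hIb
  have ifI := hprod (hfX 0) hIm (fun ω => hf _) hIb
  have ifM := hprod (hfX 0) (hMm t) (fun ω => hf _) hMb
  -- orthogonality of the increments to the initial value
  have e1 : ∫ ω, f (X 0 ω) * compensated X f b t ω ∂P = 0 := by
    have := integral_mul_martingale_sub hM (zero_le : (0 : ℝ≥0) ≤ t) (hfm.comp (hX 0))
      (fun ω => hf _)
    simpa [compensated, pathIntegral] using this
  have e2 : ∫ ω, compensated X (fun x => f x ^ 2) a t ω ∂P = 0 := by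
    have := integral_mul_martingale_sub hM2 (zero_le : (0 : ℝ≥0) ≤ t) (H := fun _ => 1)
      measurable_const (C := 1) (fun ω => by simp)
    simpa [compensated, pathIntegral] using this
  -- the mixed term
  have hMjoint : Measurable (Function.uncurry (compensated X f b)) :=
    measurable_uncurry_of_rightContinuous hMm (rightContinuous_compensated hX' hrc f hb)
  have hbjoint := measurable_uncurry_comp hX' hrc b
  have hCt : ∀ ω : Ω, 0 ≤ 2 * C + C * t := fun ω => by have := hC0 ω; positivity
  -- After Fubini, `M t` may be replaced by `M s` inside the time integral, because the increment `M
  -- t - M s` is orthogonal to `b (X s)`.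
  have e3 : ∫ ω, compensated X f b t ω * pathIntegral X b ω t ∂P =
      ∫ ω, (∫ s in (0 : ℝ)..t, compensated X f b s.toNNReal ω * b (X s.toNNReal ω)) ∂P := by
    have s1 := integral_intervalIntegral_swap (P := P)
      (g := fun s ω => compensated X f b t ω * b (X s ω))
      (((hMm t).comp measurable_snd).mul hbjoint) t (C := (2 * C + C * t) * C) (fun s _ ω => by
        rw [abs_mul]; exact mul_le_mul (hMb ω) (hb _) (abs_nonneg _) (hCt ω))
    have s2 := integral_intervalIntegral_swap (P := P)
      (g := fun s ω => compensated X f b s ω * b (X s ω))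
      (hMjoint.mul hbjoint) t (C := (2 * C + C * t) * C) (fun s hs ω => by
        rw [abs_mul]
        exact mul_le_mul (abs_compensated_le hf hb ω hs) (hb _) (abs_nonneg _) (hCt ω))
    simp only [intervalIntegral.integral_const_mul] at s1
    rw [s2]
    refine s1.trans (intervalIntegral.integral_congr fun s hs => ?_)
    rw [Set.uIcc_of_le t.coe_nonneg] at hs
    have hst : s.toNNReal ≤ t := Real.toNNReal_le_iff_le_coe.2 hs.2
    have h0 := integral_mul_martingale_sub hM hst
      ((measurable_of_countable b).comp (hX s.toNNReal)) (fun ω => hb _)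
    have i1 := hprod (hMm t) (hbX s.toNNReal) hMb (fun ω => hb _)
    have i2 := hprod (hMm s.toNNReal) (hbX s.toNNReal)
      (fun ω => abs_compensated_le hf hb ω hst) (fun ω => hb _)
    have h1 : ∫ ω, (compensated X f b t ω * b (X s.toNNReal ω) -
        compensated X f b s.toNNReal ω * b (X s.toNNReal ω)) ∂P = 0 := by
      rw [← h0]; congr 1; ext ω; simp only [Function.comp_apply]; ring
    rw [integral_sub i1 i2] at h1
    exact sub_eq_zero.1 h1
  have hfb (x : S) : |f x * b x| ≤ C * C := by
    rw [abs_mul]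
    exact mul_le_mul (hf x) (hb x) (abs_nonneg _) ((abs_nonneg _).trans (hf x))
  -- Substituting the definition of `M s` leaves the integral of `I s * I' s`, with `I` the path
  -- integral of `b`; this is `I t ^ 2 / 2`.
  have e4 (ω : Ω) : ∫ s in (0 : ℝ)..t, compensated X f b s.toNNReal ω * b (X s.toNNReal ω) =
      pathIntegral X (fun x => f x * b x) ω t - f (X 0 ω) * pathIntegral X b ω t -
        pathIntegral X b ω t ^ 2 / 2 := by
    rw [← pathIntegral_sq hX' hrc hb]
    rw [show pathIntegral X (fun x => f x * b x) ω t =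
        ∫ s in (0 : ℝ)..t, f (X s.toNNReal ω) * b (X s.toNNReal ω) from rfl,
      show f (X 0 ω) * pathIntegral X b ω t =
        f (X 0 ω) * ∫ s in (0 : ℝ)..t, b (X s.toNNReal ω) from rfl,
      ← intervalIntegral.integral_const_mul, ← intervalIntegral.integral_sub
      (intervalIntegrable_path hX' hrc hfb ω 0 t)
      ((intervalIntegrable_path hX' hrc hb ω 0 t).const_mul _), ← intervalIntegral.integral_sub
      ((intervalIntegrable_path hX' hrc hfb ω 0 t).sub
        ((intervalIntegrable_path hX' hrc hb ω 0 t).const_mul _))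
      ((intervalIntegrable_path hX' hrc hb ω 0 t).continuousOn_mul
        (continuous_pathIntegral hX' hrc hb ω).continuousOn)]
    refine intervalIntegral.integral_congr fun s hs => ?_
    rw [Set.uIcc_of_le t.coe_nonneg] at hs
    simp only [compensated, pathIntegral, Real.coe_toNNReal s hs.1]
    ring
  have ifb : Integrable (fun ω => pathIntegral X (fun x => f x * b x) ω t) P :=
    Integrable.of_bound (measurable_pathIntegral hX' hrc _ t).aestronglyMeasurable (C * C * t)
      (ae_of_all _ fun ω => abs_pathIntegral_le hfb ω t)
  have ia : Integrable (fun ω => pathIntegral X a ω t) P :=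
    Integrable.of_bound (measurable_pathIntegral hX' hrc _ t).aestronglyMeasurable (C * t)
      (ae_of_all _ fun ω => abs_pathIntegral_le ha ω t)
  have e5 : ∫ ω, compensated X f b t ω * pathIntegral X b ω t ∂P =
      ∫ ω, pathIntegral X (fun x => f x * b x) ω t ∂P -
        ∫ ω, f (X 0 ω) * pathIntegral X b ω t ∂P -
        (∫ ω, pathIntegral X b ω t * pathIntegral X b ω t ∂P) / 2 := by
    rw [e3]
    simp only [e4, pow_two]
    rw [integral_sub (hs ifb ifI) (iII.div_const 2), integral_sub ifb ifI, integral_div]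
  -- The square of `f (X t) = M t + f (X 0) + I t` is compared with the decomposition of `f ^ 2`. In
  -- the mean, the terms in `f (X 0) * I t` and `I t ^ 2` cancel against those produced by the mixed
  -- term `e5`.
  have e6 (ω : Ω) : compensated X f b t ω ^ 2 = compensated X (fun x => f x ^ 2) a t ω +
      (pathIntegral X a ω t - 2 * (f (X 0 ω) * compensated X f b t ω) -
      2 * (f (X 0 ω) * pathIntegral X b ω t) -
      2 * (compensated X f b t ω * pathIntegral X b ω t) -
      pathIntegral X b ω t * pathIntegral X b ω t) := by
    simp only [compensated]; ring
  have e7 (ω : Ω) : pathIntegral X (fun x => a x - 2 * f x * b x) ω t =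
      pathIntegral X a ω t - 2 * pathIntegral X (fun x => f x * b x) ω t := by
    simp only [pathIntegral]
    rw [← intervalIntegral.integral_const_mul, ← intervalIntegral.integral_sub
      (intervalIntegrable_path hX' hrc ha ω 0 t)
      ((intervalIntegrable_path hX' hrc hfb ω 0 t).const_mul _)]
    simp only [mul_assoc]
  simp only [e6, e7]
  have j1 := hs ia (ifM.const_mul 2)
  have j2 := hs j1 (ifI.const_mul 2)
  have j3 := hs j2 (iMI.const_mul 2)
  rw [integral_add (hM2.integrable t) (hs j3 iII), integral_sub j3 iII,
    integral_sub j2 (iMI.const_mul 2), integral_sub j1 (ifI.const_mul 2),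
    integral_sub ia (ifM.const_mul 2), integral_sub ia (ifb.const_mul 2),
    integral_const_mul, integral_const_mul, integral_const_mul, integral_const_mul, e1, e2, e5]
  ring

end Compensator

end SpatialLoadBalancing

namespace SpatialLoadBalancing

/-! ### Running suprema of functionals with bounded upward drift. -/

section UpwardVariation

open Filter Topology

variable {Ω : Type*} {mΩ : MeasurableSpace Ω} {P : Measure Ω} [IsProbabilityMeasure P]
  {S : Type*} [TopologicalSpace S] [DiscreteTopology S] [MeasurableSpace S] [Countable S]
  [MeasurableSingletonClass S] {X : ℝ≥0 → Ω → S} {𝓕 : Filtration ℝ≥0 mΩ}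

/-- The state space is countable, so the event `X s = x` can be fixed and the martingale used with
`c = F x`. The test function then vanishes at time `s` and equals the positive part of the increment
at time `u`. -/
theorem lintegral_increment_le (hX : ∀ t, Measurable[𝓕 t] (X t))
    (hrc : ∀ ω t, ContinuousWithinAt (fun s => X s ω) (Set.Ici t) t) {F : S → ℝ} {C : ℝ}
    (hF : ∀ x, |F x| ≤ C) {b : ℝ → S → ℝ} (hb : ∀ c, ∃ B, ∀ x, |b c x| ≤ B) {lam : ℝ}
    (hle : ∀ c x, b c x ≤ lam)
    (hM : ∀ c, Martingale (compensated X (fun y => max (F y - c) 0) (b c)) 𝓕 P)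
    {s u : ℝ≥0} (hsu : s ≤ u) :
    ∫⁻ ω, ENNReal.ofReal (F (X u ω) - F (X s ω)) ∂P ≤ ENNReal.ofReal (lam * (u - s)) := by
  have hX' : ∀ t, Measurable (X t) := fun t => (hX t).mono (𝓕.le t) le_rfl
  have hsu' : (s : ℝ) ≤ u := by exact_mod_cast hsu
  have hmeas (x : S) : MeasurableSet (X s ⁻¹' {x}) := hX' s (measurableSet_singleton x)
  have hcover : (⋃ x, X s ⁻¹' {x}) = Set.univ := by
    rw [← Set.preimage_iUnion, Set.iUnion_singleton_eq_range]; simp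
  have hdisj : Pairwise (Function.onFun Disjoint fun x => X s ⁻¹' {x}) := fun x y hxy =>
    Disjoint.preimage _ (Set.disjoint_singleton.2 hxy)
  have key (x : S) : ∫⁻ ω in X s ⁻¹' {x}, ENNReal.ofReal (F (X u ω) - F (X s ω)) ∂P ≤
      ENNReal.ofReal (lam * (u - s)) * P (X s ⁻¹' {x}) := by
    set A := X s ⁻¹' {x} with hA
    obtain ⟨B, hB⟩ := hb (F x)
    set M := compensated X (fun y => max (F y - F x) 0) (b (F x)) with hMdef
    have hfint : Integrable (fun ω => max (F (X u ω) - F x) 0) P := by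
      refine Integrable.of_bound ((measurable_of_countable fun y => max (F y - F x) 0).comp
        (hX' u)).aestronglyMeasurable (C + C) (ae_of_all _ fun ω => ?_)
      rw [Real.norm_eq_abs, abs_of_nonneg (le_max_right _ _)]
      have h1 := abs_le.1 (hF x)
      have h2 := abs_le.1 (hF (X u ω))
      exact max_le (by linarith) (by linarith)
    have hzero : ∫ ω in A, (M u ω - M s ω) ∂P = 0 := by
      rw [integral_sub (((hM _).integrable u).integrableOn) (((hM _).integrable s).integrableOn),
        (hM _).setIntegral_eq hsu (hX s (measurableSet_singleton x)), sub_self]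
    calc ∫⁻ ω in A, ENNReal.ofReal (F (X u ω) - F (X s ω)) ∂P
        = ∫⁻ ω in A, ENNReal.ofReal (max (F (X u ω) - F x) 0) ∂P := by
          refine setLIntegral_congr_fun (hmeas x) fun ω hω => ?_
          have : X s ω = x := hω
          simp only [this, ENNReal.ofReal_max, ENNReal.ofReal_zero]
          exact (max_eq_left (zero_le)).symm
      _ = ENNReal.ofReal (∫ ω in A, max (F (X u ω) - F x) 0 ∂P) :=
          (ofReal_integral_eq_lintegral_ofReal hfint.integrableOn
            (ae_of_all _ fun ω => le_max_right _ _)).symm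
      _ ≤ ENNReal.ofReal (∫ ω in A, ((M u ω - M s ω) + lam * (u - s)) ∂P) := by
          refine ENNReal.ofReal_le_ofReal (setIntegral_mono_on hfint.integrableOn
            (((((hM _).integrable u).sub ((hM _).integrable s)).add
              (integrable_const _)).integrableOn) (hmeas x) fun ω hω => ?_)
          have hx : X s ω = x := hω
          have hI : pathIntegral X (b (F x)) ω u - pathIntegral X (b (F x)) ω s ≤
              lam * (u - s) := by
            have hii (a c : ℝ) := intervalIntegrable_path hX' hrc hB ω a c
            rw [pathIntegral, pathIntegral,
              intervalIntegral.integral_interval_sub_left (hii _ _) (hii _ _)]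
            calc _ ≤ ∫ r in (s : ℝ)..u, lam :=
                  intervalIntegral.integral_mono_on hsu' (hii _ _) intervalIntegrable_const
                    fun r _ => hle _ _
              _ = _ := by simp; ring
          simp only [hMdef, compensated, hx, sub_self, max_self]
          linarith
      _ = ENNReal.ofReal (lam * (u - s)) * P A := by
          have hMi : Integrable (fun ω => M u ω - M s ω) (P.restrict A) :=
            (((hM _).integrable u).sub ((hM _).integrable s)).integrableOn
          rw [integral_add hMi (integrable_const _), hzero, setIntegral_const, zero_add, smul_eq_mul,
            ENNReal.ofReal_mul measureReal_nonneg, mul_comm, ofReal_measureReal]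
  calc _ = ∫⁻ ω in ⋃ x, X s ⁻¹' {x}, ENNReal.ofReal (F (X u ω) - F (X s ω)) ∂P := by
        rw [hcover, setLIntegral_univ]
    _ = ∑' x, ∫⁻ ω in X s ⁻¹' {x}, ENNReal.ofReal (F (X u ω) - F (X s ω)) ∂P :=
        lintegral_iUnion hmeas hdisj _
    _ ≤ ∑' x, ENNReal.ofReal (lam * (u - s)) * P (X s ⁻¹' {x}) := ENNReal.tsum_le_tsum key
    _ = ENNReal.ofReal (lam * (u - s)) := by
        rw [ENNReal.tsum_mul_left, ← measure_iUnion hdisj hmeas, hcover, measure_univ, mul_one]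

/-- A telescoping sum with the downward increments discarded. The right side does not depend on `k`,
so it bounds the maximum over the whole grid. -/
theorem ofReal_le_add_sum_increments (z : ℕ → ℝ) {k n : ℕ} (h : k ≤ n) :
    ENNReal.ofReal (z k) ≤ ENNReal.ofReal (z 0) +
      ∑ l ∈ Finset.range n, ENNReal.ofReal (z (l + 1) - z l) := by
  refine le_trans ?_ (add_le_add_right (Finset.sum_le_sum_of_subset (Finset.range_mono h)) _)
  clear h
  induction k with
  | zero => simp
  | succ k ih =>
    rw [Finset.sum_range_succ, ← add_assoc]
    calc ENNReal.ofReal (z (k + 1)) = ENNReal.ofReal (z k + (z (k + 1) - z k)) := by ring_nf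
      _ ≤ ENNReal.ofReal (z k) + ENNReal.ofReal (z (k + 1) - z k) := ENNReal.ofReal_add_le
      _ ≤ _ := by gcongr

/-- If all positive parts `(F - c)⁺` have generator at most `lam`, then the running supremum of
`F` along the path grows in mean at rate at most `lam`. -/
theorem lintegral_iSup_le_add_of_upward_drift (hX : ∀ t, Measurable[𝓕 t] (X t))
    (hrc : ∀ ω t, ContinuousWithinAt (fun s => X s ω) (Set.Ici t) t) {F : S → ℝ} {C : ℝ}
    (hF : ∀ x, |F x| ≤ C) {b : ℝ → S → ℝ} (hb : ∀ c, ∃ B, ∀ x, |b c x| ≤ B) {lam : ℝ}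
    (hle : ∀ c x, b c x ≤ lam)
    (hM : ∀ c, Martingale (compensated X (fun y => max (F y - c) 0) (b c)) 𝓕 P) (t : ℝ≥0) :
    ∫⁻ ω, ⨆ s ∈ Set.Icc (0 : ℝ≥0) t, ENNReal.ofReal (F (X s ω)) ∂P ≤
      ENNReal.ofReal (lam * t) + ∫⁻ ω, ENNReal.ofReal (F (X 0 ω)) ∂P := by
  have hX' : ∀ t, Measurable (X t) := fun t => (hX t).mono (𝓕.le t) le_rfl
  have hFm (s : ℝ≥0) : Measurable fun ω => F (X s ω) := (measurable_of_countable F).comp (hX' s)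
  refine lintegral_iSup_Icc_le t (fun s => (hFm s).ennreal_ofReal) (fun ω s =>
    ENNReal.continuous_ofReal.continuousAt.comp_continuousWithinAt
      (rightContinuous_comp hrc F ω s)) fun n => ?_
  calc _ ≤ ∫⁻ ω, (ENNReal.ofReal (F (X 0 ω)) + ∑ l ∈ Finset.range (2 ^ n), ENNReal.ofReal
        (F (X (dyadicPoint t n (l + 1)) ω) - F (X (dyadicPoint t n l) ω))) ∂P := by
        refine lintegral_mono fun ω => Finset.sup_le fun k hk => ?_
        have := ofReal_le_add_sum_increments (fun k => F (X (dyadicPoint t n k) ω))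
          (Nat.lt_succ_iff.1 (Finset.mem_range.1 hk))
        simpa only [dyadicPoint_zero] using this
    _ = ∫⁻ ω, ENNReal.ofReal (F (X 0 ω)) ∂P + ∑ l ∈ Finset.range (2 ^ n), ∫⁻ ω, ENNReal.ofReal
        (F (X (dyadicPoint t n (l + 1)) ω) - F (X (dyadicPoint t n l) ω)) ∂P := by
        rw [lintegral_add_left (hFm 0).ennreal_ofReal, lintegral_finsetSum]
        exact fun l _ => ((hFm _).sub (hFm _)).ennreal_ofReal
    _ ≤ ∫⁻ ω, ENNReal.ofReal (F (X 0 ω)) ∂P + ∑ l ∈ Finset.range (2 ^ n),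
        ENNReal.ofReal (lam * (t / 2 ^ n)) := by
        gcongr with l
        refine (lintegral_increment_le hX hrc hF hb hle hM
          (dyadicPoint_mono t n l.le_succ)).trans (le_of_eq ?_)
        congr 2
        simp only [dyadicPoint]
        push_cast
        ring
    _ = _ := by
        rw [add_comm]
        congr 1
        rw [Finset.sum_const, Finset.card_range, nsmul_eq_mul,
          ← ENNReal.ofReal_natCast, ← ENNReal.ofReal_mul (by positivity)]
        congr 1
        push_cast
        field_simp

end UpwardVariation

/-! ### Grönwall and Cauchy–Schwarz inequalities for time integrals. -/

section Gronwall

open Filter Topology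

/-- Integral Grönwall inequality for bounded measurable functions. -/
theorem le_mul_exp_of_le_add_lintegral {y : ℝ → ℝ≥0∞} (hy : Measurable y) {B A : ℝ≥0∞}
    (hB : B ≠ ∞) (hyB : ∀ s, y s ≤ B) (C : ℝ≥0) {t : ℝ} (ht : 0 ≤ t)
    (h : ∀ s ∈ Set.Icc 0 t, y s ≤ A + C * ∫⁻ r in Set.Ioc 0 s, y r) :
    y t ≤ A * ENNReal.ofReal (Real.exp (C * t)) := by
  rcases eq_or_ne A ∞ with rfl | hA
  · rw [ENNReal.top_mul]
    · exact le_top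
    · simpa using Real.exp_pos _
  set v : ℝ → ℝ := fun s => (y s).toReal with hv
  have hyt (s : ℝ) : y s ≠ ∞ := ne_top_of_le_ne_top hB (hyB s)
  have hvm : Measurable v := hy.ennreal_toReal
  have hvB (s : ℝ) : ‖v s‖ ≤ B.toReal := by
    rw [Real.norm_eq_abs, abs_of_nonneg ENNReal.toReal_nonneg]
    exact ENNReal.toReal_mono hB (hyB s)
  have hvi (a b : ℝ) : IntervalIntegrable v volume a b :=
    (intervalIntegrable_const (c := B.toReal)).mono_fun hvm.aestronglyMeasurable
      (ae_of_all _ fun s => (hvB s).trans (le_abs_self _))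
  have hVc : Continuous fun s => ∫ r in (0 : ℝ)..s, v r :=
    intervalIntegral.continuous_primitive hvi 0
  have hv_le (s : ℝ) (hs : s ∈ Set.Icc 0 t) :
      v s ≤ A.toReal + C * ∫ r in (0 : ℝ)..s, v r := by
    have e : ∫⁻ r in Set.Ioc 0 s, y r = ENNReal.ofReal (∫ r in (0 : ℝ)..s, v r) := by
      rw [intervalIntegral.integral_of_le hs.1, ofReal_integral_eq_lintegral_ofReal (hvi 0 s).1
        (ae_of_all _ fun r => ENNReal.toReal_nonneg)]
      simp only [hv, ENNReal.ofReal_toReal (hyt _)]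
    have hV0 : 0 ≤ ∫ r in (0 : ℝ)..s, v r :=
      intervalIntegral.integral_nonneg hs.1 fun r _ => ENNReal.toReal_nonneg
    have := h s hs
    rw [e, ← ENNReal.ofReal_coe_nnreal, ← ENNReal.ofReal_mul C.coe_nonneg] at this
    have h2 := ENNReal.toReal_mono (ENNReal.add_ne_top.2 ⟨hA, ENNReal.ofReal_ne_top⟩) this
    rwa [ENNReal.toReal_add hA ENNReal.ofReal_ne_top,
      ENNReal.toReal_ofReal (mul_nonneg C.coe_nonneg hV0)] at h2
  set Y : ℝ → ℝ := fun s => A.toReal + C * ∫ r in (0 : ℝ)..s, v r with hY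
  have hYc : Continuous Y := continuous_const.add (continuous_const.mul hVc)
  -- `y` is only measurable, so `Y` need not be differentiable. Integrating once more gives a
  -- differentiable `Z` with `Z' = C * Y ≤ C * Z`, to which the differential Grönwall inequality
  -- applies.
  set Z : ℝ → ℝ := fun s => A.toReal + C * ∫ r in (0 : ℝ)..s, Y r with hZ
  have hYZ (s : ℝ) (hs : s ∈ Set.Icc 0 t) : Y s ≤ Z s := by
    simp only [hY, hZ]
    gcongr
    exact intervalIntegral.integral_mono_on hs.1 (hvi _ _) (hYc.intervalIntegrable _ _)
      fun r hr => hv_le r ⟨hr.1, hr.2.trans hs.2⟩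
  have hZd (s : ℝ) : HasDerivAt Z (C * Y s) s :=
    ((hYc.integral_hasStrictDerivAt 0 s).hasDerivAt.const_mul _).const_add _
  have hg := le_gronwallBound_of_liminf_deriv_right_le (f := Z) (f' := fun s => C * Y s)
    (δ := A.toReal) (K := C) (ε := 0) (a := 0) (b := t)
    (fun s _ => (hZd s).continuousAt.continuousWithinAt)
    (fun s _ r hr => (hZd s).hasDerivWithinAt.liminf_right_slope_le hr)
    (by simp [hZ]) (fun s hs => by
      have := hYZ s ⟨hs.1, hs.2.le⟩
      rw [add_zero]
      gcongr) t ⟨ht, le_rfl⟩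
  rw [gronwallBound_ε0, sub_zero] at hg
  have hfin : v t ≤ A.toReal * Real.exp (C * t) :=
    (hv_le t ⟨ht, le_rfl⟩).trans ((hYZ t ⟨ht, le_rfl⟩).trans hg)
  rw [← ENNReal.ofReal_toReal (hyt t), ← ENNReal.ofReal_toReal hA,
    ← ENNReal.ofReal_mul ENNReal.toReal_nonneg]
  exact ENNReal.ofReal_le_ofReal hfin

/-- Cauchy–Schwarz for interval integrals. -/
theorem sq_integral_le {g : ℝ → ℝ} {s : ℝ} (hs : 0 ≤ s) (hg : IntervalIntegrable g volume 0 s)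
    (hg2 : IntervalIntegrable (fun r => g r ^ 2) volume 0 s) :
    (∫ r in (0 : ℝ)..s, g r) ^ 2 ≤ s * ∫ r in (0 : ℝ)..s, g r ^ 2 := by
  set I := ∫ r in (0 : ℝ)..s, g r with hI
  -- The variance of `g` over `[0, s]`, multiplied by a power of `s` to avoid division; the case `s
  -- = 0` is separated below.
  have h0 : 0 ≤ ∫ r in (0 : ℝ)..s, (s * g r - I) ^ 2 :=
    intervalIntegral.integral_nonneg hs fun r _ => sq_nonneg _
  have e : ∫ r in (0 : ℝ)..s, (s * g r - I) ^ 2 =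
      s ^ 2 * (∫ r in (0 : ℝ)..s, g r ^ 2) - 2 * s * I * I + s * I ^ 2 := by
    have : ∀ r, (s * g r - I) ^ 2 = s ^ 2 * g r ^ 2 - 2 * s * I * g r + I ^ 2 := fun r => by ring
    simp only [this]
    rw [intervalIntegral.integral_add ((hg2.const_mul _).sub (hg.const_mul _))
      intervalIntegrable_const, intervalIntegral.integral_sub (hg2.const_mul _) (hg.const_mul _),
      intervalIntegral.integral_const_mul, intervalIntegral.integral_const_mul,
      intervalIntegral.integral_const]
    simp [hI]
  rw [e] at h0
  rcases hs.eq_or_lt with rfl | hs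
  · simp [hI]
  · have : 0 ≤ s * (s * (∫ r in (0 : ℝ)..s, g r ^ 2) - I ^ 2) := by linarith
    linarith [nonneg_of_mul_nonneg_right this hs]

theorem ofReal_sq_integral_le {g : ℝ → ℝ} (hg : Measurable g) {B : ℝ} (hB : ∀ r, |g r| ≤ B)
    {s : ℝ} (hs : 0 ≤ s) : ENNReal.ofReal ((∫ r in (0 : ℝ)..s, g r) ^ 2) ≤
      ENNReal.ofReal s * ∫⁻ r in Set.Ioc 0 s, ENNReal.ofReal (g r ^ 2) := by
  have h1 : IntervalIntegrable g volume 0 s :=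
    (intervalIntegrable_const (c := B)).mono_fun hg.aestronglyMeasurable
      (ae_of_all _ fun r => (hB r).trans (le_abs_self _))
  have h2 : IntervalIntegrable (fun r => g r ^ 2) volume 0 s :=
    (intervalIntegrable_const (c := B ^ 2)).mono_fun (hg.pow_const 2).aestronglyMeasurable
      (ae_of_all _ fun r => by
        simp only [norm_pow]
        gcongr
        exact (hB r).trans (le_abs_self _))
  rw [← ofReal_integral_eq_lintegral_ofReal h2.1 (ae_of_all _ fun r => sq_nonneg _),
    ← intervalIntegral.integral_of_le hs, ← ENNReal.ofReal_mul hs]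
  exact ENNReal.ofReal_le_ofReal (sq_integral_le hs h1 h2)

end Gronwall

end SpatialLoadBalancing

namespace SpatialLoadBalancing

/-! ### Square sums with geometric weights. -/

section WeightedSums

theorem sqSum_le_iff {a : ℕ → ℝ} {B : ℝ≥0∞} :
    sqSum a ≤ B ↔ ∀ n, ∑ j ∈ Finset.range n, ENNReal.ofReal (a (j + 1) ^ 2) ≤ B :=
  ⟨fun h _ => (ENNReal.sum_le_tsum _).trans h, fun h => ENNReal.tsum_le_of_sum_range_le h⟩

/-- Looking one level down costs nothing, as `θ ≤ 1` and `D 0 = 0`. Looking one level up costs `1 /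
θ ≤ 2`. With the factor `3` from squaring three terms, the constant is `3 * (1 + 1 + 2) = 12`. -/
theorem tsum_weighted_neighbours_le {θ : ℝ} (h0 : 1 / 2 ≤ θ) (h1 : θ ≤ 1) {D : ℕ → ℝ}
    (hD : D 0 = 0) :
    ∑' j, ENNReal.ofReal (θ ^ (j + 1) * (D j + D (j + 1) + D (j + 2)) ^ 2) ≤
      12 * ∑' j, ENNReal.ofReal (θ ^ (j + 1) * D (j + 1) ^ 2) := by
  have hθ : 0 < θ := by linarith
  set y := ∑' j, ENNReal.ofReal (θ ^ (j + 1) * D (j + 1) ^ 2) with hy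
  have e1 : ∑' j, ENNReal.ofReal (θ ^ (j + 1) * D j ^ 2) ≤ y := by
    rw [tsum_eq_zero_add' ENNReal.summable]
    simp only [hD, ne_eq, OfNat.ofNat_ne_zero, not_false_eq_true, zero_pow, mul_zero,
      ENNReal.ofReal_zero, zero_add]
    refine ENNReal.tsum_le_tsum fun j => ENNReal.ofReal_le_ofReal ?_
    exact mul_le_mul_of_nonneg_right (pow_le_pow_of_le_one hθ.le h1 (by omega)) (sq_nonneg _)
  have e2 : ∑' j, ENNReal.ofReal (θ ^ (j + 1) * D (j + 2) ^ 2) ≤ 2 * y := by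
    have : ∑' j, ENNReal.ofReal (θ ^ (j + 2) * D (j + 2) ^ 2) ≤ y := by
      rw [hy, tsum_eq_zero_add' (f := fun j => ENNReal.ofReal (θ ^ (j + 1) * D (j + 1) ^ 2))
        ENNReal.summable]
      exact le_add_self
    refine le_trans ?_ (mul_le_mul_right this 2)
    rw [← ENNReal.tsum_mul_left]
    refine ENNReal.tsum_le_tsum fun j => ?_
    rw [← ENNReal.ofReal_ofNat 2, ← ENNReal.ofReal_mul (by norm_num)]
    refine ENNReal.ofReal_le_ofReal ?_
    have : 0 ≤ θ ^ (j + 1) * D (j + 2) ^ 2 := by positivity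
    calc _ = 1 * (θ ^ (j + 1) * D (j + 2) ^ 2) := (one_mul _).symm
      _ ≤ (2 * θ) * (θ ^ (j + 1) * D (j + 2) ^ 2) := by gcongr; linarith
      _ = _ := by ring
  calc _ ≤ ∑' j, 3 * (ENNReal.ofReal (θ ^ (j + 1) * D j ^ 2) +
        (ENNReal.ofReal (θ ^ (j + 1) * D (j + 1) ^ 2) +
          ENNReal.ofReal (θ ^ (j + 1) * D (j + 2) ^ 2))) := by
        refine ENNReal.tsum_le_tsum fun j => ?_
        rw [← ENNReal.ofReal_add (by positivity) (by positivity),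
          ← ENNReal.ofReal_add (by positivity) (by positivity),
          ← ENNReal.ofReal_ofNat 3, ← ENNReal.ofReal_mul (by norm_num)]
        refine ENNReal.ofReal_le_ofReal ?_
        have : (D j + D (j + 1) + D (j + 2)) ^ 2 ≤
            3 * (D j ^ 2 + (D (j + 1) ^ 2 + D (j + 2) ^ 2)) := by
          nlinarith [sq_nonneg (D j - D (j + 1)), sq_nonneg (D j - D (j + 2)),
            sq_nonneg (D (j + 1) - D (j + 2))]
        calc _ ≤ θ ^ (j + 1) * (3 * (D j ^ 2 + (D (j + 1) ^ 2 + D (j + 2) ^ 2))) := by gcongr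
          _ = _ := by ring
    _ = 3 * (∑' j, ENNReal.ofReal (θ ^ (j + 1) * D j ^ 2) +
        (y + ∑' j, ENNReal.ofReal (θ ^ (j + 1) * D (j + 2) ^ 2))) := by
        rw [ENNReal.tsum_mul_left, ENNReal.tsum_add, ENNReal.tsum_add]
    _ ≤ 3 * (y + (y + 2 * y)) := by gcongr
    _ = 12 * y := by ring

end WeightedSums

/-! ### Fluctuations of local fractions and growth of the capped energy. -/

section Fluctuations

open scoped Classical

set_option linter.unusedSectionVars false

variable {V W : Type*} [Fintype V] [Fintype W] {d : ℕ} {lam rho0 : ℝ} {E : Finset (V × W)}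
  {Ω : Type*} {mΩ : MeasurableSpace Ω} {P : Measure Ω} {𝓕 : Filtration ℝ≥0 mΩ}
  {X : ℝ≥0 → Ω → V → ℕ}

theorem IsQueueProcess.martingale_compensated (hX : IsQueueProcess lam d E P 𝓕 X)
    {f : (V → ℕ) → ℝ} {C : ℝ} (hf : ∀ x, |f x| ≤ C) :
    Martingale (compensated X f (queueGenerator lam d E f)) 𝓕 P :=
  hX.martingale f ⟨C, hf⟩

theorem IsQueueProcess.measurable (hX : IsQueueProcess lam d E P 𝓕 X) (t : ℝ≥0) :
    Measurable (X t) := (hX.adapted t).mono (𝓕.le t) le_rfl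

theorem abs_localFrac_le_one (w : W) (i : ℕ) (x : V → ℕ) : |localFrac E x w i| ≤ 1 := by
  rw [abs_of_nonneg (localFrac_nonneg _ _ _ _)]
  exact localFrac_le_one _ _ _ _

/-- The martingale part of the fraction of servers compatible with `w` with queue length at least
`j + 1`. -/
noncomputable def localMart (lam : ℝ) (d : ℕ) (E : Finset (V × W)) (X : ℝ≥0 → Ω → V → ℕ) (w : W)
    (j : ℕ) : ℝ≥0 → Ω → ℝ :=
  compensated X (fun y => localFrac E y w (j + 1))
    (queueGenerator lam d E fun y => localFrac E y w (j + 1))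

theorem IsQueueProcess.measurable_localMart (hX : IsQueueProcess lam d E P 𝓕 X) (w : W) (j : ℕ)
    (s : ℝ≥0) : Measurable (localMart lam d E X w j s) :=
  ((hX.martingale_compensated
    (abs_localFrac_le_one w (j + 1))).stronglyAdapted s).measurable.mono (𝓕.le s) le_rfl

variable [Nonempty W]

theorem IsQueueProcess.rightContinuous_localMart (hX : IsQueueProcess lam d E P 𝓕 X)
    (hd : 1 ≤ d) (hlam : 0 ≤ lam) (hE : ∀ w, ∃ v, (v, w) ∈ E) (w : W) (j : ℕ) (ω : Ω) (s : ℝ≥0) :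
    ContinuousWithinAt (fun s => localMart lam d E X w j s ω) (Set.Ici s) s :=
  rightContinuous_compensated hX.measurable hX.rightCont _
    (abs_queueGenerator_le hd hlam hE (abs_localFrac_le_one w (j + 1))) ω s

variable [IsProbabilityMeasure P]

theorem IsQueueProcess.lintegral_iSup_localMart_le (hX : IsQueueProcess lam d E P 𝓕 X)
    (hd : 1 ≤ d) (hlam : 0 ≤ lam) (hE : ∀ w, ∃ v, (v, w) ∈ E) (w : W) (j : ℕ) (t : ℝ≥0) :
    ∫⁻ ω, ⨆ s ∈ Set.Icc (0 : ℝ≥0) t, ENNReal.ofReal (localMart lam d E X w j s ω ^ 2) ∂P ≤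
      ENNReal.ofReal (4 * ∫ ω, pathIntegral X (fun x =>
        queueGenerator lam d E (fun y => localFrac E y w (j + 1) ^ 2) x -
          2 * localFrac E x w (j + 1) *
            queueGenerator lam d E (fun y => localFrac E y w (j + 1)) x) ω t ∂P) := by
  have hf := abs_localFrac_le_one (E := E) w (j + 1)
  have hf2 (x : V → ℕ) : |localFrac E x w (j + 1) ^ 2| ≤ 1 := by
    rw [abs_pow]; exact pow_le_one₀ (abs_nonneg _) (hf x)
  have hb := abs_queueGenerator_le hd hlam hE hf
  have ha := abs_queueGenerator_le hd hlam hE hf2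
  set B := (lam * Fintype.card V + Fintype.card V) * (2 * 1)
  rw [← integral_compensated_sq (C := max 1 B) hX.adapted hX.rightCont
    (fun x => (hf x).trans (le_max_left _ _)) (fun x => (ha x).trans (le_max_right _ _))
    (fun x => (hb x).trans (le_max_right _ _)) (hX.martingale_compensated hf)
    (hX.martingale_compensated hf2) t]
  exact lintegral_iSup_martingale_sq_le (hX.martingale_compensated hf)
    (hX.rightContinuous_localMart hd hlam hE w j) t
    (fun s hs ω => abs_compensated_le (C := max 1 B)
      (fun x => (hf x).trans (le_max_left _ _)) (fun x => (hb x).trans (le_max_right _ _)) ω hs)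

/-- The levels are summed inside the time integral before anything is estimated, so that the bound
on the total carré du champ applies without loss in the number of levels. The factor `4` is Doob's.
-/
theorem IsQueueProcess.tsum_lintegral_localMart_le (hX : IsQueueProcess lam d E P 𝓕 X)
    (hd : 1 ≤ d) (hlam : 0 ≤ lam) (hE : ∀ w, ∃ v, (v, w) ∈ E) (hρ : graphLoad lam E ≤ rho0)
    (w : W) (t : ℝ≥0) :
    ∑' j, ∫⁻ ω, ⨆ s ∈ Set.Icc (0 : ℝ≥0) t,
      ENNReal.ofReal (localMart lam d E X w j s ω ^ 2) ∂P ≤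
      ENNReal.ofReal (4 * (t * ((rho0 * d + 1) * (1 / typeDeg E w)))) := by
  set Γ : ℕ → (V → ℕ) → ℝ := fun j x =>
    queueGenerator lam d E (fun y => localFrac E y w (j + 1) ^ 2) x -
      2 * localFrac E x w (j + 1) *
        queueGenerator lam d E (fun y => localFrac E y w (j + 1)) x with hΓ
  have hΓ0 (j x) : 0 ≤ Γ j x := queueGenerator_sq_nonneg hlam E _ x
  have hΓle (n x) := sum_queueGenerator_sq_localFrac_le hd hlam hρ (hE w) x n
  have hΓb (j x) : |Γ j x| ≤ (rho0 * d + 1) * (1 / typeDeg E w) := by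
    rw [abs_of_nonneg (hΓ0 j x)]
    exact (Finset.single_le_sum (f := fun j => Γ j x) (fun k _ => hΓ0 k x)
      (Finset.self_mem_range_succ j)).trans (hΓle (j + 1) x)
  have hint (j : ℕ) : Integrable (fun ω => pathIntegral X (Γ j) ω t) P :=
    Integrable.of_bound (measurable_pathIntegral hX.measurable hX.rightCont _ t).aestronglyMeasurable
      _ (ae_of_all _ fun ω => abs_pathIntegral_le (hΓb j) ω t)
  have hnn (j : ℕ) (ω : Ω) : 0 ≤ pathIntegral X (Γ j) ω t :=
    intervalIntegral.integral_nonneg t.coe_nonneg fun s _ => hΓ0 j _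
  refine ENNReal.tsum_le_of_sum_range_le fun n => ?_
  calc _ ≤ ∑ j ∈ Finset.range n, ENNReal.ofReal (4 * ∫ ω, pathIntegral X (Γ j) ω t ∂P) :=
        Finset.sum_le_sum fun j _ => hX.lintegral_iSup_localMart_le hd hlam hE w j t
    _ = ENNReal.ofReal (4 * ∫ ω, ∑ j ∈ Finset.range n, pathIntegral X (Γ j) ω t ∂P) := by
        rw [integral_finsetSum _ fun j _ => hint j, Finset.mul_sum, ENNReal.ofReal_sum_of_nonneg]
        exact fun j _ => mul_nonneg (by norm_num) (integral_nonneg (hnn j))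
    _ ≤ _ := by
        refine ENNReal.ofReal_le_ofReal (mul_le_mul_of_nonneg_left ?_ (by norm_num))
        calc _ ≤ ∫ ω, (t * ((rho0 * d + 1) * (1 / typeDeg E w)) : ℝ) ∂P := by
              refine integral_mono (integrable_finsetSum _ fun j _ => hint j)
                (integrable_const _) fun ω => ?_
              have hii (j : ℕ) := intervalIntegrable_path hX.measurable hX.rightCont (hΓb j) ω 0 t
              simp only [pathIntegral]
              rw [← intervalIntegral.integral_finsetSum fun j _ => hii j]
              calc _ ≤ ∫ r in (0 : ℝ)..t, (rho0 * d + 1) * (1 / (typeDeg E w : ℝ)) := by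
                    refine intervalIntegral.integral_mono_on t.coe_nonneg
                      ?_ intervalIntegrable_const fun r _ => hΓle n _
                    have := IntervalIntegrable.sum (Finset.range n) fun j _ => hii j
                    refine this.congr fun r _ => ?_
                    simp
                _ = _ := by simp; ring
          _ = _ := by simp

theorem IsQueueProcess.lintegral_iSup_energy_le [Nonempty V] (hX : IsQueueProcess lam d E P 𝓕 X)
    (hd : 1 ≤ d) (hlam : 0 ≤ lam) (hE : ∀ w, ∃ v, (v, w) ∈ E) (t : ℝ≥0) :
    ∫⁻ ω, ⨆ s ∈ Set.Icc (0 : ℝ≥0) t, sqSum (fun i => min (globalFrac (X s ω) i) (1 / 2)) ∂P ≤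
      ENNReal.ofReal (lam * t) + ∫⁻ ω, sqSum (globalFrac (X 0 ω)) ∂P := by
  have hpart (n : ℕ) (x : V → ℕ) : ENNReal.ofReal (cappedEnergy n x) =
      ∑ j ∈ Finset.range n, ENNReal.ofReal (min (globalFrac x (j + 1)) (1 / 2) ^ 2) :=
    ENNReal.ofReal_sum_of_nonneg fun j _ => sq_nonneg _
  have hb (n : ℕ) (x : V → ℕ) : |cappedEnergy n x| ≤ n := by
    rw [abs_of_nonneg (cappedEnergy_nonneg _ _)]; exact cappedEnergy_le n x
  have hb' (n : ℕ) (c : ℝ) (x : V → ℕ) : |max (cappedEnergy n x - c) 0| ≤ n + |c| := by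
    rw [abs_of_nonneg (le_max_right _ _)]
    refine max_le ?_ (by positivity)
    linarith [cappedEnergy_le n x, neg_abs_le c]
  have hn (n : ℕ) := lintegral_iSup_le_add_of_upward_drift (P := P) hX.adapted hX.rightCont (hb n)
    (b := fun c => queueGenerator lam d E fun y => max (cappedEnergy n y - c) 0)
    (fun c => ⟨_, abs_queueGenerator_le hd hlam hE (hb' n c)⟩)
    (fun c x => queueGenerator_cappedEnergy_le hd hlam hE n c x)
    (fun c => hX.martingale_compensated (hb' n c)) t
  have hmeas (n : ℕ) (s : ℝ≥0) : Measurable fun ω => ENNReal.ofReal (cappedEnergy n (X s ω)) :=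
    ((measurable_of_countable (cappedEnergy n)).comp (hX.measurable s)).ennreal_ofReal
  -- The infinite energy is the increasing limit of the finite ones. The suprema over `n` and over
  -- time commute, and monotone convergence reduces the claim to the bounded functionals
  -- `cappedEnergy n`.
  have hrw (ω : Ω) : (⨆ s ∈ Set.Icc (0 : ℝ≥0) t,
      sqSum (fun i => min (globalFrac (X s ω) i) (1 / 2))) =
      ⨆ n, ⨆ s ∈ Set.Icc (0 : ℝ≥0) t, ENNReal.ofReal (cappedEnergy n (X s ω)) := by
    simp only [sqSum, ENNReal.tsum_eq_iSup_nat, hpart]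
    rw [iSup_comm]
    refine iSup_congr fun s => ?_
    rw [iSup_comm]
  simp only [hrw]
  rw [lintegral_iSup]
  · refine iSup_le fun n => (hn n).trans ?_
    gcongr with ω
    rw [hpart]
    refine le_trans (Finset.sum_le_sum fun j _ => ?_) (sqSum_le_iff.1 le_rfl n)
    refine ENNReal.ofReal_le_ofReal ?_
    have := globalFrac_nonneg (X 0 ω) (j + 1)
    gcongr
    exact min_le_left _ _
  · exact fun n => measurable_iSup_Icc t (hmeas n) fun ω s =>
      ENNReal.continuous_ofReal.continuousAt.comp_continuousWithinAt
        (rightContinuous_comp hX.rightCont _ ω s)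
  · intro m n hmn ω
    refine iSup₂_mono fun s _ => ?_
    rw [hpart, hpart]
    exact Finset.sum_le_sum_of_subset (Finset.range_mono hmn)

end Fluctuations

end SpatialLoadBalancing

namespace SpatialLoadBalancing

/-! ### Pathwise comparison with the mean-field solution. -/

section Comparison

open scoped Classical

set_option linter.unusedSectionVars false

variable {V W : Type*} [Fintype V] [Fintype W] {d : ℕ} {lam rho0 : ℝ} {E : Finset (V × W)}
  {Ω : Type*} {mΩ : MeasurableSpace Ω} {P : Measure Ω} {𝓕 : Filtration ℝ≥0 mΩ}
  {X : ℝ≥0 → Ω → V → ℕ} {qbar : ℝ → ℕ → ℝ}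

theorem IsMeanFieldSolution.continuous_toNNReal (hq : IsMeanFieldSolution lam d qbar) (i : ℕ) :
    Continuous fun r : ℝ => qbar r.toNNReal i := by
  have hc : ContinuousOn (fun s => qbar s i) (Set.Ici 0) := by
    rcases Nat.eq_zero_or_pos i with rfl | hi
    · exact continuousOn_const.congr fun s hs => (hq.mem s hs).1
    · exact fun s hs => (hq.ode i hi s hs).continuousWithinAt
  exact hc.comp_continuous (NNReal.continuous_coe.comp continuous_real_toNNReal)
    fun r => NNReal.coe_nonneg _

/-- The velocity of the component `j + 1` in the mean-field system. -/
noncomputable def meanFieldRate (lam : ℝ) (d : ℕ) (p : ℕ → ℝ) (j : ℕ) : ℝ :=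
  lam * (p j ^ d - p (j + 1) ^ d) - (p (j + 1) - p (j + 2))

theorem IsMeanFieldSolution.continuous_meanFieldRate (hq : IsMeanFieldSolution lam d qbar) (j : ℕ) :
    Continuous fun r : ℝ => meanFieldRate lam d (qbar r.toNNReal) j := by
  have h0 := hq.continuous_toNNReal j
  have h1 := hq.continuous_toNNReal (j + 1)
  have h2 := hq.continuous_toNNReal (j + 2)
  exact (continuous_const.mul ((h0.pow d).sub (h1.pow d))).sub (h1.sub h2)

theorem IsMeanFieldSolution.sub_eq_integral (hq : IsMeanFieldSolution lam d qbar) (j : ℕ)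
    (s : ℝ≥0) : qbar s (j + 1) - qbar 0 (j + 1) =
      ∫ r in (0 : ℝ)..s, meanFieldRate lam d (qbar r.toNNReal) j := by
  refine (intervalIntegral.integral_eq_sub_of_hasDeriv_right (f := fun r => qbar r (j + 1))
    ?_ ?_ ((hq.continuous_meanFieldRate j).intervalIntegrable _ _)).symm
  · intro r hr
    rw [Set.uIcc_of_le s.coe_nonneg] at hr
    refine ((hq.ode (j + 1) (by omega) r hr.1).continuousWithinAt).mono ?_
    rw [Set.uIcc_of_le s.coe_nonneg]
    exact Set.Icc_subset_Ici_self
  · intro r hr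
    rw [min_eq_left s.coe_nonneg] at hr
    have := (hq.ode (j + 1) (by omega) r hr.1.le).mono
      (Set.Ioi_subset_Ici_self.trans (Set.Ici_subset_Ici.2 hr.1.le))
    refine this.congr_deriv ?_
    rw [meanFieldRate, Real.coe_toNNReal r hr.1.le]
    rfl

theorem localDiscrepancy_le_one [Nonempty W] (x : V → ℕ) {p : ℕ → ℝ} (hp : p ∈ occupancySpace)
    (i : ℕ) : localDiscrepancy E x p i ≤ 1 := by
  have hW : (0 : ℝ) < Fintype.card W := by exact_mod_cast Fintype.card_pos
  calc _ ≤ 1 / (Fintype.card W : ℝ) * ∑ w : W, (1 : ℝ) := by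
        unfold localDiscrepancy
        gcongr with w
        have h1 := localFrac_nonneg E x w i
        have h2 := localFrac_le_one E x w i
        have h3 := occupancy_nonneg hp i
        have h4 := occupancy_le_one hp i
        rw [abs_le]
        constructor <;> linarith
    _ = 1 := by simp [hW.ne']

theorem localDiscrepancy_zero (hE : ∀ w, ∃ v, (v, w) ∈ E) (x : V → ℕ) {p : ℕ → ℝ}
    (hp : p ∈ occupancySpace) : localDiscrepancy E x p 0 = 0 := by
  simp [localDiscrepancy, localFrac_zero (hE _), hp.1]

theorem IsQueueProcess.measurable_localDiscrepancy (hX : IsQueueProcess lam d E P 𝓕 X)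
    (hq : IsMeanFieldSolution lam d qbar) (ω : Ω) (i : ℕ) :
    Measurable fun r : ℝ => localDiscrepancy E (X r.toNNReal ω) (qbar r.toNNReal) i := by
  unfold localDiscrepancy
  refine (Finset.measurable_fun_sum _ fun w _ => ?_).const_mul _
  exact ((measurable_path hX.measurable hX.rightCont (fun x => localFrac E x w i) ω).sub
    (hq.continuous_toNNReal i).measurable).norm

variable [Nonempty W]

/-- For each type the difference is its initial value, a martingale term and the time integral of
the drift difference. Absolute values are averaged over types before applying
`average_drift_sub_le`, which holds only for averages. -/
theorem IsQueueProcess.localDiscrepancy_le [Nonempty V] (hX : IsQueueProcess lam d E P 𝓕 X)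
    (hq : IsMeanFieldSolution lam d qbar) (hd : 1 ≤ d) (hlam : 0 ≤ lam) (hlam1 : lam ≤ 1)
    (hE : ∀ w, ∃ v, (v, w) ∈ E) (hρ : graphLoad lam E ≤ 1) (ω : Ω) (j : ℕ) (s : ℝ≥0) :
    localDiscrepancy E (X s ω) (qbar s) (j + 1) ≤
      localDiscrepancy E (X 0 ω) (qbar 0) (j + 1) +
      1 / (Fintype.card W : ℝ) * ∑ w, |localMart lam d E X w j s ω| +
      d * graphPhi E * (∫ r in (0 : ℝ)..s, levelFrac E (X r.toNNReal ω) j) +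
      ((d : ℝ) ^ 2 + d + 1) * ∫ r in (0 : ℝ)..s,
        (localDiscrepancy E (X r.toNNReal ω) (qbar r.toNNReal) j +
          localDiscrepancy E (X r.toNNReal ω) (qbar r.toNNReal) (j + 1) +
          localDiscrepancy E (X r.toNNReal ω) (qbar r.toNNReal) (j + 2)) := by
  set b : W → (V → ℕ) → ℝ := fun w =>
    queueGenerator lam d E (fun y => localFrac E y w (j + 1)) with hb
  have hbi (w : W) : IntervalIntegrable (fun r : ℝ => b w (X r.toNNReal ω)) volume 0 s :=
    intervalIntegrable_path hX.measurable hX.rightCont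
      (abs_queueGenerator_le hd hlam hE (abs_localFrac_le_one w (j + 1))) ω 0 s
  have hGi := (hq.continuous_meanFieldRate j).intervalIntegrable (μ := volume) 0 (s : ℝ)
  have hdi (w : W) := (hbi w).sub hGi
  have hw (w : W) : |localFrac E (X s ω) w (j + 1) - qbar s (j + 1)| ≤
      |localFrac E (X 0 ω) w (j + 1) - qbar 0 (j + 1)| + (|localMart lam d E X w j s ω| +
      ∫ r in (0 : ℝ)..s, |b w (X r.toNNReal ω) - meanFieldRate lam d (qbar r.toNNReal) j|) := by
    have e : localFrac E (X s ω) w (j + 1) - qbar s (j + 1) =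
        (localFrac E (X 0 ω) w (j + 1) - qbar 0 (j + 1)) + (localMart lam d E X w j s ω +
        ∫ r in (0 : ℝ)..s, (b w (X r.toNNReal ω) - meanFieldRate lam d (qbar r.toNNReal) j)) := by
      rw [intervalIntegral.integral_sub (hbi w) hGi, ← hq.sub_eq_integral]
      simp only [localMart, compensated, pathIntegral, hb]
      ring
    rw [e]
    refine (abs_add_le _ _).trans (add_le_add le_rfl ((abs_add_le _ _).trans
      (add_le_add le_rfl ?_)))
    exact intervalIntegral.abs_integral_le_integral_abs s.coe_nonneg
  have h1 := mul_le_mul_of_nonneg_left (Finset.sum_le_sum fun w (_ : w ∈ Finset.univ) => hw w)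
    (show 0 ≤ 1 / (Fintype.card W : ℝ) by positivity)
  rw [average_add, average_add] at h1
  refine h1.trans ?_
  rw [add_assoc, add_assoc]
  refine add_le_add le_rfl (add_le_add le_rfl ?_)
  have hmeasD := hX.measurable_localDiscrepancy hq ω
  have hD1 (i : ℕ) : IntervalIntegrable
      (fun r : ℝ => localDiscrepancy E (X r.toNNReal ω) (qbar r.toNNReal) i) volume 0 s := by
    refine (intervalIntegrable_const (c := (1 : ℝ))).mono_fun (hmeasD i).aestronglyMeasurable
      (ae_of_all _ fun r => ?_)
    simp only [Real.norm_eq_abs, abs_one]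
    rw [abs_of_nonneg (localDiscrepancy_nonneg _ _ _ _)]
    exact localDiscrepancy_le_one _ (hq.mem _ (NNReal.coe_nonneg _)) i
  have he1 (x : V → ℕ) : |levelFrac E x j| ≤ 1 := by
    rw [abs_of_nonneg (levelFrac_nonneg _ _ _)]
    exact (Finset.single_le_sum (f := levelFrac E x) (fun k _ => levelFrac_nonneg E x k)
      (Finset.self_mem_range_succ j)).trans (sum_levelFrac_le E x (j + 1))
  have hei := intervalIntegrable_path hX.measurable hX.rightCont he1 ω 0 s
  have hgi := ((hD1 j).add (hD1 (j + 1))).add (hD1 (j + 2))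
  rw [← intervalIntegral.integral_const_mul, ← intervalIntegral.integral_const_mul,
    ← intervalIntegral.integral_add (hei.const_mul _) (hgi.const_mul _),
    ← intervalIntegral.integral_finsetSum fun w _ => (hdi w).abs,
    ← intervalIntegral.integral_const_mul]
  have hsum : IntervalIntegrable (fun r : ℝ => ∑ w,
      |b w (X r.toNNReal ω) - meanFieldRate lam d (qbar r.toNNReal) j|) volume 0 s := by
    have := IntervalIntegrable.sum Finset.univ fun w _ => (hdi w).abs
    refine this.congr fun r _ => ?_
    simp
  refine intervalIntegral.integral_mono_on s.coe_nonneg (hsum.const_mul _)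
    ((hei.const_mul _).add (hgi.const_mul _)) fun r _ => ?_
  exact average_drift_sub_le hd hlam hlam1 hE hρ (X r.toNNReal ω)
    (hq.mem _ (NNReal.coe_nonneg _)) j

/-- The type-averaged squared suprema of the martingale parts. -/
noncomputable def martEnergy (lam : ℝ) (d : ℕ) (E : Finset (V × W)) (X : ℝ≥0 → Ω → V → ℕ)
    (t : ℝ≥0) (ω : Ω) : ℝ≥0∞ :=
  ENNReal.ofReal (1 / Fintype.card W) * ∑ w, ∑' j, ⨆ s ∈ Set.Icc (0 : ℝ≥0) t,
    ENNReal.ofReal (localMart lam d E X w j s ω ^ 2)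

/-- The square of a mean over types is at most the mean of the squares. Passing to suprema in time
makes the bound independent of `s`, as Grönwall requires. -/
theorem tsum_average_localMart_sq_le (ω : Ω) {s t : ℝ≥0} (hst : s ≤ t) :
    ∑' j, ENNReal.ofReal ((1 / (Fintype.card W : ℝ) * ∑ w, |localMart lam d E X w j s ω|) ^ 2) ≤
      martEnergy lam d E X t ω := by
  have hW : (0 : ℝ) < Fintype.card W := by exact_mod_cast Fintype.card_pos
  calc _ ≤ ∑' j, ENNReal.ofReal (1 / Fintype.card W) *
        ∑ w, ENNReal.ofReal (localMart lam d E X w j s ω ^ 2) := by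
        refine ENNReal.tsum_le_tsum fun j => ?_
        rw [← ENNReal.ofReal_sum_of_nonneg fun w _ => sq_nonneg _,
          ← ENNReal.ofReal_mul (by positivity)]
        refine ENNReal.ofReal_le_ofReal ?_
        have := sq_sum_le_card_mul_sum_sq (s := Finset.univ)
          (f := fun w => |localMart lam d E X w j s ω|)
        simp only [sq_abs, Finset.card_univ] at this
        rw [mul_pow]
        calc _ ≤ (1 / (Fintype.card W : ℝ)) ^ 2 *
              (Fintype.card W * ∑ w, localMart lam d E X w j s ω ^ 2) := by gcongr
          _ = _ := by field_simp
    _ = ENNReal.ofReal (1 / Fintype.card W) *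
        ∑ w, ∑' j, ENNReal.ofReal (localMart lam d E X w j s ω ^ 2) := by
        rw [ENNReal.tsum_mul_left, Summable.tsum_finsetSum fun w _ => ENNReal.summable]
    _ ≤ _ := by
        unfold martEnergy
        gcongr with w _ j
        exact le_iSup₂ (f := fun s (_ : s ∈ Set.Icc (0 : ℝ≥0) t) =>
          ENNReal.ofReal (localMart lam d E X w j s ω ^ 2)) s ⟨zero_le, hst⟩

theorem IsQueueProcess.measurable_martEnergy (hX : IsQueueProcess lam d E P 𝓕 X)
    (hd : 1 ≤ d) (hlam : 0 ≤ lam) (hE : ∀ w, ∃ v, (v, w) ∈ E) (t : ℝ≥0) :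
    Measurable (martEnergy lam d E X t) := by
  refine (Finset.measurable_fun_sum _ fun w _ => Measurable.tsum fun j => ?_).const_mul _
  exact measurable_iSup_Icc t (fun s => ((hX.measurable_localMart w j s).pow_const 2).ennreal_ofReal)
    fun ω s => ENNReal.continuous_ofReal.continuousAt.comp_continuousWithinAt
      ((hX.rightContinuous_localMart hd hlam hE w j ω s).pow 2)

theorem IsQueueProcess.lintegral_martEnergy_le [IsProbabilityMeasure P]
    (hX : IsQueueProcess lam d E P 𝓕 X)
    (hd : 1 ≤ d) (hlam : 0 ≤ lam) (hE : ∀ w, ∃ v, (v, w) ∈ E) (hρ0 : 0 ≤ rho0)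
    (hρ : graphLoad lam E ≤ rho0) (t : ℝ≥0) :
    ∫⁻ ω, martEnergy lam d E X t ω ∂P ≤
      ENNReal.ofReal (4 * t * (rho0 * d + 1) * graphGamma E) := by
  have hm (w : W) (j : ℕ) : Measurable fun ω => ⨆ s ∈ Set.Icc (0 : ℝ≥0) t,
      ENNReal.ofReal (localMart lam d E X w j s ω ^ 2) :=
    measurable_iSup_Icc t (fun s => ((hX.measurable_localMart w j s).pow_const 2).ennreal_ofReal)
      fun ω s => ENNReal.continuous_ofReal.continuousAt.comp_continuousWithinAt
        ((hX.rightContinuous_localMart hd hlam hE w j ω s).pow 2)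
  unfold martEnergy
  rw [lintegral_const_mul _ (Finset.measurable_fun_sum _ fun w _ => Measurable.tsum (hm w)),
    lintegral_finsetSum _ fun w _ => Measurable.tsum (hm w)]
  calc _ ≤ ENNReal.ofReal (1 / Fintype.card W) *
        ∑ w, ENNReal.ofReal (4 * (t * ((rho0 * d + 1) * (1 / typeDeg E w)))) := by
        gcongr with w
        rw [lintegral_tsum fun j => (hm w j).aemeasurable]
        exact hX.tsum_lintegral_localMart_le hd hlam hE hρ w t
    _ = _ := by
        rw [← ENNReal.ofReal_sum_of_nonneg fun w _ => by positivity,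
          ← ENNReal.ofReal_mul (by positivity)]
        congr 1
        simp only [graphGamma, Finset.mul_sum]
        refine Finset.sum_congr rfl fun w _ => ?_
        ring

/-- The Grönwall estimate with geometric weights. -/
theorem IsQueueProcess.weighted_discrepancy_le [Nonempty V] (hX : IsQueueProcess lam d E P 𝓕 X)
    (hq : IsMeanFieldSolution lam d qbar) (hd : 1 ≤ d) (hlam : 0 ≤ lam) (hlam1 : lam ≤ 1)
    (hE : ∀ w, ∃ v, (v, w) ∈ E) (hρ : graphLoad lam E ≤ 1) (ω : Ω) {s t : ℝ≥0} (hst : s ≤ t)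
    {θ : ℝ} (hθ0 : 1 / 2 ≤ θ) (hθ1 : θ < 1) :
    ∑' j, ENNReal.ofReal (θ ^ (j + 1) * localDiscrepancy E (X s ω) (qbar s) (j + 1) ^ 2) ≤
      4 * (sqSum (localDiscrepancy E (X 0 ω) (qbar 0)) + martEnergy lam d E X t ω +
        ENNReal.ofReal ((t : ℝ) ^ 2 * (d : ℝ) ^ 2 * graphPhi E ^ 2)) *
      ENNReal.ofReal (Real.exp (48 * ((d : ℝ) ^ 2 + d + 1) ^ 2 * (t : ℝ) ^ 2)) := by
  have hθ : 0 < θ := by linarith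
  set K : ℝ := (d : ℝ) ^ 2 + d + 1 with hK
  set D : ℕ → ℝ → ℝ := fun i r => localDiscrepancy E (X r.toNNReal ω) (qbar r.toNNReal) i with hDdef
  set y : ℝ → ℝ≥0∞ := fun r => ∑' j, ENNReal.ofReal (θ ^ (j + 1) * D (j + 1) r ^ 2) with hy
  set A : ℝ≥0∞ := 4 * (sqSum (localDiscrepancy E (X 0 ω) (qbar 0)) + martEnergy lam d E X t ω +
    ENNReal.ofReal ((t : ℝ) ^ 2 * (d : ℝ) ^ 2 * graphPhi E ^ 2)) with hA
  have hDm (i : ℕ) : Measurable (D i) := hX.measurable_localDiscrepancy hq ω i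
  have hD0 (i : ℕ) (r : ℝ) : 0 ≤ D i r := localDiscrepancy_nonneg _ _ _ _
  have hD1 (i : ℕ) (r : ℝ) : D i r ≤ 1 :=
    localDiscrepancy_le_one _ (hq.mem _ (NNReal.coe_nonneg _)) i
  have hym : Measurable y := Measurable.tsum fun j =>
    (((hDm (j + 1)).pow_const 2).const_mul _).ennreal_ofReal
  -- The weights are needed for this a priori bound: without them the sum could be infinite and
  -- Grönwall's inequality would not apply.
  have hyB (r : ℝ) : y r ≤ ∑' j : ℕ, ENNReal.ofReal θ ^ j := by
    refine ENNReal.tsum_le_tsum fun j => ?_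
    rw [← ENNReal.ofReal_pow hθ.le]
    refine ENNReal.ofReal_le_ofReal ?_
    have h2 : D (j + 1) r ^ 2 ≤ 1 := pow_le_one₀ (hD0 _ _) (hD1 _ _)
    calc _ ≤ θ ^ (j + 1) * 1 := by gcongr
      _ ≤ θ ^ j := by rw [mul_one]; exact pow_le_pow_of_le_one hθ.le hθ1.le (by omega)
  have hB : ∑' j : ℕ, ENNReal.ofReal θ ^ j ≠ ∞ := by
    rw [ENNReal.tsum_geometric]
    refine ENNReal.inv_ne_top.2 (tsub_pos_of_lt ?_).ne'
    simpa using hθ1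
  have hKt : (0 : ℝ) ≤ 48 * K ^ 2 * t := by positivity
  have hstep (u : ℝ≥0) (hu : u ≤ t) :
      y u ≤ A + (Real.toNNReal (48 * K ^ 2 * t)) * ∫⁻ r in Set.Ioc (0 : ℝ) u, y r := by
    set m : ℕ → ℝ := fun j => 1 / (Fintype.card W : ℝ) * ∑ w, |localMart lam d E X w j u ω| with hm
    set e : ℕ → ℝ → ℝ := fun j r => levelFrac E (X r.toNNReal ω) j with he
    set g : ℕ → ℝ → ℝ := fun j r => D j r + D (j + 1) r + D (j + 2) r with hg
    have hem (j : ℕ) : Measurable (e j) :=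
      measurable_path hX.measurable hX.rightCont (fun x => levelFrac E x j) ω
    have heb (j : ℕ) (r : ℝ) : |e j r| ≤ 1 := by
      rw [abs_of_nonneg (levelFrac_nonneg _ _ _)]
      exact (Finset.single_le_sum (f := levelFrac E _) (fun k _ => levelFrac_nonneg E _ k)
        (Finset.self_mem_range_succ j)).trans (sum_levelFrac_le E _ (j + 1))
    have hgm (j : ℕ) : Measurable (g j) := ((hDm j).add (hDm (j + 1))).add (hDm (j + 2))
    have hgb (j : ℕ) (r : ℝ) : |g j r| ≤ 3 := by
      rw [abs_of_nonneg (by simp only [hg]; linarith [hD0 j r, hD0 (j + 1) r, hD0 (j + 2) r])]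
      simp only [hg]
      linarith [hD1 j r, hD1 (j + 1) r, hD1 (j + 2) r]
    -- The factor `4` comes from squaring four terms. The weight is dropped from the first three and
    -- kept in the Grönwall term; the two factors `t` come from Cauchy–Schwarz in time.
    have hpt (j : ℕ) : ENNReal.ofReal (θ ^ (j + 1) * D (j + 1) u ^ 2) ≤
        4 * (ENNReal.ofReal (localDiscrepancy E (X 0 ω) (qbar 0) (j + 1) ^ 2) +
          ENNReal.ofReal (m j ^ 2) + ENNReal.ofReal ((d * graphPhi E) ^ 2 * t) *
            ∫⁻ r in Set.Ioc (0 : ℝ) u, ENNReal.ofReal (e j r ^ 2)) +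
        ENNReal.ofReal (4 * K ^ 2 * t) *
          ∫⁻ r in Set.Ioc (0 : ℝ) u, ENNReal.ofReal (θ ^ (j + 1) * g j r ^ 2) := by
      have h1 := hX.localDiscrepancy_le hq hd hlam hlam1 hE hρ ω j u
      set a := localDiscrepancy E (X 0 ω) (qbar 0) (j + 1) with ha
      set p := ∫ r in (0 : ℝ)..u, e j r with hp
      set z := ∫ r in (0 : ℝ)..u, g j r with hz
      have h2 : D (j + 1) u ≤ a + m j + d * graphPhi E * p + K * z := by
        simpa only [hDdef, Real.toNNReal_coe] using h1
      have h3 : D (j + 1) u ^ 2 ≤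
          4 * (a ^ 2 + m j ^ 2 + (d * graphPhi E) ^ 2 * p ^ 2 + K ^ 2 * z ^ 2) := by
        have h4 : D (j + 1) u ^ 2 ≤ (a + m j + d * graphPhi E * p + K * z) ^ 2 :=
          pow_le_pow_left₀ (hD0 _ _) h2 2
        refine h4.trans ?_
        nlinarith [sq_nonneg (a - m j), sq_nonneg (a - d * graphPhi E * p), sq_nonneg (a - K * z),
          sq_nonneg (m j - d * graphPhi E * p), sq_nonneg (m j - K * z),
          sq_nonneg (d * graphPhi E * p - K * z)]
      have hθj : θ ^ (j + 1) ≤ 1 := pow_le_one₀ hθ.le hθ1.le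
      have hθj0 : 0 < θ ^ (j + 1) := by positivity
      have h5 : θ ^ (j + 1) * D (j + 1) u ^ 2 ≤ 4 * (a ^ 2 + m j ^ 2 +
          (d * graphPhi E) ^ 2 * p ^ 2) + 4 * K ^ 2 * (θ ^ (j + 1) * z ^ 2) := by
        have h6 : 0 ≤ a ^ 2 + m j ^ 2 + (d * graphPhi E) ^ 2 * p ^ 2 := by positivity
        calc _ ≤ θ ^ (j + 1) *
              (4 * (a ^ 2 + m j ^ 2 + (d * graphPhi E) ^ 2 * p ^ 2 + K ^ 2 * z ^ 2)) := by gcongr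
          _ = θ ^ (j + 1) * (4 * (a ^ 2 + m j ^ 2 + (d * graphPhi E) ^ 2 * p ^ 2)) +
              4 * K ^ 2 * (θ ^ (j + 1) * z ^ 2) := by ring
          _ ≤ _ := add_le_add (mul_le_of_le_one_left (by positivity) hθj) le_rfl
      have hut : ENNReal.ofReal (u : ℝ) ≤ ENNReal.ofReal (t : ℝ) := by
        simpa using hu
      have hp2 := (ofReal_sq_integral_le (hem j) (heb j) u.coe_nonneg).trans
        (mul_le_mul_left hut _)
      have hz2 := (ofReal_sq_integral_le (hgm j) (hgb j) u.coe_nonneg).trans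
        (mul_le_mul_left hut _)
      have hlin : ENNReal.ofReal (θ ^ (j + 1)) * ∫⁻ r in Set.Ioc (0 : ℝ) u, ENNReal.ofReal (g j r ^ 2) =
          ∫⁻ r in Set.Ioc (0 : ℝ) u, ENNReal.ofReal (θ ^ (j + 1) * g j r ^ 2) := by
        rw [← lintegral_const_mul _ ((hgm j).pow_const 2).ennreal_ofReal]
        simp only [ENNReal.ofReal_mul hθj0.le]
      refine (ENNReal.ofReal_le_ofReal h5).trans ?_
      rw [ENNReal.ofReal_add (by positivity) (by positivity), ENNReal.ofReal_mul (by norm_num),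
        ENNReal.ofReal_add (by positivity) (by positivity),
        ENNReal.ofReal_add (by positivity) (by positivity), ENNReal.ofReal_ofNat,
        ENNReal.ofReal_mul (p := (d * graphPhi E) ^ 2) (by positivity),
        ENNReal.ofReal_mul (p := (d * graphPhi E) ^ 2) (by positivity),
        ENNReal.ofReal_mul (p := 4 * K ^ 2) (by positivity),
        ENNReal.ofReal_mul (p := 4 * K ^ 2) (by positivity),
        ENNReal.ofReal_mul (p := θ ^ (j + 1)) hθj0.le, ← hlin]
      gcongr 4 * (_ + _ + ?_) + ?_
      · rw [mul_assoc]
        gcongr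
      · rw [mul_assoc]
        gcongr ENNReal.ofReal (4 * K ^ 2) * ?_
        rw [mul_left_comm]
        gcongr
    -- The masses of the levels are nonnegative with sum at most one, so the same holds for the sum
    -- of their squares. The bias therefore stays finite after summing over all levels.
    have hE2 : ∑' j, ∫⁻ r in Set.Ioc (0 : ℝ) u, ENNReal.ofReal (e j r ^ 2) ≤
        ENNReal.ofReal (t : ℝ) := by
      rw [← lintegral_tsum fun j => ((hem j).pow_const 2).ennreal_ofReal.aemeasurable]
      calc _ ≤ ∫⁻ r in Set.Ioc (0 : ℝ) u, 1 := by
            refine lintegral_mono fun r => ENNReal.tsum_le_of_sum_range_le fun n => ?_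
            rw [← ENNReal.ofReal_sum_of_nonneg fun j _ => sq_nonneg _, ← ENNReal.ofReal_one]
            exact ENNReal.ofReal_le_ofReal (sum_levelFrac_sq_le E _ n)
        _ ≤ _ := by simpa using hu
    -- The constant `12` here and the `4` above give the rate `48 * K ^ 2 * t`.
    have hG2 : ∑' j, ∫⁻ r in Set.Ioc (0 : ℝ) u, ENNReal.ofReal (θ ^ (j + 1) * g j r ^ 2) ≤
        12 * ∫⁻ r in Set.Ioc (0 : ℝ) u, y r := by
      rw [← lintegral_tsum fun j =>
        (((hgm j).pow_const 2).const_mul _).ennreal_ofReal.aemeasurable,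
        ← lintegral_const_mul _ hym]
      refine lintegral_mono fun r => ?_
      exact tsum_weighted_neighbours_le hθ0 hθ1.le (D := fun i => D i r)
        (localDiscrepancy_zero hE _ (hq.mem _ (NNReal.coe_nonneg _)))
    calc y u ≤ _ := ENNReal.tsum_le_tsum hpt
      _ = 4 * (sqSum (localDiscrepancy E (X 0 ω) (qbar 0)) + ∑' j, ENNReal.ofReal (m j ^ 2) +
            ENNReal.ofReal ((d * graphPhi E) ^ 2 * t) *
            ∑' j, ∫⁻ r in Set.Ioc (0 : ℝ) u, ENNReal.ofReal (e j r ^ 2)) +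
          ENNReal.ofReal (4 * K ^ 2 * t) *
            ∑' j, ∫⁻ r in Set.Ioc (0 : ℝ) u, ENNReal.ofReal (θ ^ (j + 1) * g j r ^ 2) := by
          rw [ENNReal.tsum_add, ENNReal.tsum_mul_left, ENNReal.tsum_add, ENNReal.tsum_add,
            ENNReal.tsum_mul_left, ENNReal.tsum_mul_left]
          rfl
      _ ≤ 4 * (sqSum (localDiscrepancy E (X 0 ω) (qbar 0)) + martEnergy lam d E X t ω +
            ENNReal.ofReal ((d * graphPhi E) ^ 2 * t) * ENNReal.ofReal (t : ℝ)) +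
          ENNReal.ofReal (4 * K ^ 2 * t) * (12 * ∫⁻ r in Set.Ioc (0 : ℝ) u, y r) := by
          gcongr
          exact tsum_average_localMart_sq_le ω hu
      _ = _ := by
          have e1 : (d * graphPhi E) ^ 2 * t * t = (t : ℝ) ^ 2 * (d : ℝ) ^ 2 * graphPhi E ^ 2 := by
            ring
          have e2 : 4 * K ^ 2 * t * 12 = 48 * K ^ 2 * t := by ring
          rw [hA, ← ENNReal.ofReal_mul (by positivity), e1, ← mul_assoc (ENNReal.ofReal _),
            ← ENNReal.ofReal_ofNat 12, ← ENNReal.ofReal_mul (by positivity), e2]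
          rfl
  have hgr := le_mul_exp_of_le_add_lintegral hym hB hyB (A := A) (Real.toNNReal (48 * K ^ 2 * t))
    s.coe_nonneg (fun u hu => by
      have := hstep u.toNNReal (by
        rw [Real.toNNReal_le_iff_le_coe]
        exact hu.2.trans (by exact_mod_cast hst))
      rwa [Real.coe_toNNReal u hu.1] at this)
  have hys : y s = ∑' j, ENNReal.ofReal
      (θ ^ (j + 1) * localDiscrepancy E (X s ω) (qbar s) (j + 1) ^ 2) := by
    simp only [hy, hDdef, Real.toNNReal_coe]
  rw [← hys]
  refine hgr.trans (mul_le_mul_right (ENNReal.ofReal_le_ofReal (Real.exp_le_exp.2 ?_)) _)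
  rw [Real.coe_toNNReal _ hKt, pow_two (t : ℝ), ← mul_assoc]
  exact mul_le_mul_of_nonneg_left (by exact_mod_cast hst) hKt

/-- The weighted bound is uniform in `θ`, so for each partial sum `θ` may be taken close to one. -/
theorem IsQueueProcess.sqSum_localDiscrepancy_le [Nonempty V] (hX : IsQueueProcess lam d E P 𝓕 X)
    (hq : IsMeanFieldSolution lam d qbar) (hd : 1 ≤ d) (hlam : 0 ≤ lam) (hlam1 : lam ≤ 1)
    (hE : ∀ w, ∃ v, (v, w) ∈ E) (hρ : graphLoad lam E ≤ 1) (ω : Ω) {s t : ℝ≥0} (hst : s ≤ t) :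
    sqSum (localDiscrepancy E (X s ω) (qbar s)) ≤
      ENNReal.ofReal (6 * Real.exp (48 * ((d : ℝ) ^ 2 + d + 1) ^ 2 * (t : ℝ) ^ 2)) *
        (sqSum (localDiscrepancy E (X 0 ω) (qbar 0)) + martEnergy lam d E X t ω +
          ENNReal.ofReal ((t : ℝ) ^ 2 * (d : ℝ) ^ 2 * graphPhi E ^ 2)) := by
  rw [sqSum_le_iff]
  intro n
  -- By Bernoulli, `θ ^ n ≥ 1 - n / (3 * (n + 1)) ≥ 2 / 3`. Removing the weights from the first `n`
  -- terms costs `3 / 2`, and `3 / 2 * 4 = 6`.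
  set θ : ℝ := 1 - 1 / (3 * (n + 1)) with hθ
  have hn : (0 : ℝ) < 3 * (n + 1) := by positivity
  have hθ1 : θ < 1 := by
    have : 0 < 1 / (3 * ((n : ℝ) + 1)) := by positivity
    linarith
  have h3 : 1 / (3 * ((n : ℝ) + 1)) ≤ 1 / 3 := by
    apply one_div_le_one_div_of_le (by norm_num)
    linarith [(Nat.cast_nonneg n : (0 : ℝ) ≤ n)]
  have hθ0 : 1 / 2 ≤ θ := by linarith
  have hbern : 2 / 3 ≤ θ ^ n := by
    have := one_add_mul_le_pow (a := -(1 / (3 * ((n : ℝ) + 1)))) (by linarith) n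
    have h4 : (n : ℝ) * (1 / (3 * (n + 1))) ≤ 1 / 3 := by
      rw [mul_one_div, div_le_div_iff₀ hn (by norm_num)]; linarith
    rw [← sub_eq_add_neg] at this
    linarith
  have h := hX.weighted_discrepancy_le hq hd hlam hlam1 hE hρ ω hst hθ0 hθ1
  set Z := sqSum (localDiscrepancy E (X 0 ω) (qbar 0)) + martEnergy lam d E X t ω +
          ENNReal.ofReal ((t : ℝ) ^ 2 * (d : ℝ) ^ 2 * graphPhi E ^ 2)
  calc _ ≤ ∑ j ∈ Finset.range n, ENNReal.ofReal (3 / 2) * ENNReal.ofReal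
        (θ ^ (j + 1) * localDiscrepancy E (X s ω) (qbar s) (j + 1) ^ 2) := by
        refine Finset.sum_le_sum fun j hj => ?_
        rw [← ENNReal.ofReal_mul (by norm_num)]
        refine ENNReal.ofReal_le_ofReal ?_
        have h5 : 2 / 3 ≤ θ ^ (j + 1) := hbern.trans
          (pow_le_pow_of_le_one (by linarith) hθ1.le (Finset.mem_range.1 hj))
        have h6 : 1 ≤ 3 / 2 * θ ^ (j + 1) := by linarith
        rw [← mul_assoc]
        exact le_mul_of_one_le_left (sq_nonneg _) h6
    _ = ENNReal.ofReal (3 / 2) * ∑ j ∈ Finset.range n, ENNReal.ofReal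
        (θ ^ (j + 1) * localDiscrepancy E (X s ω) (qbar s) (j + 1) ^ 2) := by rw [Finset.mul_sum]
    _ ≤ ENNReal.ofReal (3 / 2) * (4 * Z * ENNReal.ofReal
        (Real.exp (48 * ((d : ℝ) ^ 2 + d + 1) ^ 2 * (t : ℝ) ^ 2))) :=
        mul_le_mul_right ((ENNReal.sum_le_tsum _).trans h) _
    _ = _ := by
        rw [show (6 : ℝ) = 3 / 2 * 4 by norm_num, mul_assoc (3 / 2 : ℝ),
          ENNReal.ofReal_mul (by norm_num), ENNReal.ofReal_mul (by norm_num), ENNReal.ofReal_ofNat]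
        ring

theorem IsQueueProcess.lintegral_iSup_sqSum_le [Nonempty V] [IsProbabilityMeasure P]
    (hX : IsQueueProcess lam d E P 𝓕 X) (hq : IsMeanFieldSolution lam d qbar) (hd : 1 ≤ d)
    (hlam : 0 ≤ lam) (hlam1 : lam ≤ 1) (hE : ∀ w, ∃ v, (v, w) ∈ E) (hρ : graphLoad lam E ≤ rho0)
    (hρ0 : 0 ≤ rho0) (hρ1 : rho0 ≤ 1) (t : ℝ≥0) :
    ∫⁻ ω, ⨆ s ∈ Set.Icc (0 : ℝ≥0) t, sqSum (fun i => globalFrac (X s ω) i - qbar s i) ∂P ≤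
      ENNReal.ofReal (2 * graphPhi E ^ 2) *
        (ENNReal.ofReal (lam * t) + ∫⁻ ω, sqSum (globalFrac (X 0 ω)) ∂P) +
      ENNReal.ofReal (12 * Real.exp (48 * ((d : ℝ) ^ 2 + d + 1) ^ 2 * (t : ℝ) ^ 2)) *
        (ENNReal.ofReal ((t : ℝ) ^ 2 * (d : ℝ) ^ 2 * graphPhi E ^ 2) +
          ∫⁻ ω, sqSum (localDiscrepancy E (X 0 ω) (qbar 0)) ∂P +
          ENNReal.ofReal (4 * t * (rho0 * d + 1) * graphGamma E)) := by
  set φ := graphPhi E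
  set L := Real.exp (48 * ((d : ℝ) ^ 2 + d + 1) ^ 2 * (t : ℝ) ^ 2) with hL
  have hL0 : 0 < L := Real.exp_pos _
  set D0 : Ω → ℝ≥0∞ := fun ω => sqSum (localDiscrepancy E (X 0 ω) (qbar 0)) with hD0
  have hD0m : Measurable D0 := (measurable_of_countable
    fun x : V → ℕ => sqSum (localDiscrepancy E x (qbar 0))).comp (hX.measurable 0)
  have hmE := hX.measurable_martEnergy hd hlam hE t
  set Z : Ω → ℝ≥0∞ := fun ω => ENNReal.ofReal ((t : ℝ) ^ 2 * (d : ℝ) ^ 2 * φ ^ 2) +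
    D0 ω + martEnergy lam d E X t ω with hZ
  have hZm : Measurable Z := (measurable_const.add hD0m).add hmE
  set H : Ω → ℝ≥0∞ := fun ω =>
    ⨆ s ∈ Set.Icc (0 : ℝ≥0) t, sqSum (fun i => min (globalFrac (X s ω) i) (1 / 2)) with hH
  have hpoint (ω : Ω) : (⨆ s ∈ Set.Icc (0 : ℝ≥0) t,
      sqSum (fun i => globalFrac (X s ω) i - qbar s i)) ≤
      ENNReal.ofReal (2 * φ ^ 2) * H ω + ENNReal.ofReal (12 * L) * Z ω := by
    refine iSup₂_le fun s hs => ?_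
    -- Bias of the type average plus averaged discrepancy; the `2` from squaring this sum turns `6`
    -- into `12`.
    have h1 : sqSum (fun i => globalFrac (X s ω) i - qbar s i) ≤
        ENNReal.ofReal (2 * φ ^ 2) * sqSum (fun i => min (globalFrac (X s ω) i) (1 / 2)) +
        ENNReal.ofReal 2 * sqSum (localDiscrepancy E (X s ω) (qbar s)) := by
      simp only [sqSum]
      rw [← ENNReal.tsum_mul_left, ← ENNReal.tsum_mul_left, ← ENNReal.tsum_add]
      refine ENNReal.tsum_le_tsum fun j => ?_
      rw [← ENNReal.ofReal_mul (by positivity), ← ENNReal.ofReal_mul (by positivity),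
        ← ENNReal.ofReal_add (by positivity) (by positivity)]
      exact ENNReal.ofReal_le_ofReal (sq_globalFrac_sub_le hE (X s ω) (qbar s) (j + 1))
    refine h1.trans (add_le_add (mul_le_mul_right ?_ _) ?_)
    · exact le_iSup₂ (f := fun s (_ : s ∈ Set.Icc (0 : ℝ≥0) t) =>
        sqSum (fun i => min (globalFrac (X s ω) i) (1 / 2))) s hs
    · have h2 := hX.sqSum_localDiscrepancy_le hq hd hlam hlam1 hE (hρ.trans hρ1) ω hs.2
      refine (mul_le_mul_right h2 _).trans (le_of_eq ?_)
      rw [← mul_assoc, ← ENNReal.ofReal_mul (by norm_num), ← mul_assoc,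
        show (2 : ℝ) * 6 = 12 by norm_num]
      congr 1
      simp only [hZ]
      ring
  calc _ ≤ ∫⁻ ω, (ENNReal.ofReal (2 * φ ^ 2) * H ω + ENNReal.ofReal (12 * L) * Z ω) ∂P :=
        lintegral_mono hpoint
    _ = ENNReal.ofReal (2 * φ ^ 2) * ∫⁻ ω, H ω ∂P +
        ENNReal.ofReal (12 * L) * ∫⁻ ω, Z ω ∂P := by
        -- Additivity requires measurability of only one summand, and a finite constant factors out
        -- unconditionally, so no measurability of `H` is needed here.
        rw [lintegral_add_right _ (hZm.const_mul _), lintegral_const_mul _ hZm,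
          lintegral_const_mul' _ _ ENNReal.ofReal_ne_top]
    _ ≤ _ := by
        gcongr
        · exact hX.lintegral_iSup_energy_le hd hlam hE t
        · simp only [hZ]
          rw [lintegral_add_right _ hmE, lintegral_add_right _ hD0m, lintegral_const, measure_univ,
            mul_one]
          gcongr
          exact hX.lintegral_martEnergy_le hd hlam hE hρ0 hρ t

theorem graphLoad_nonneg (hlam : 0 ≤ lam) (E : Finset (V × W)) : 0 ≤ graphLoad lam E :=
  Real.iSup_nonneg fun v => mul_nonneg hlam (serverWeight_nonneg E v)

end Comparison

end SpatialLoadBalancing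

theorem mainTheorem7 (rho0 : ℝ) (hrho0 : rho0 < 1) (d : ℕ) (hd : 2 ≤ d) :
    -- the mean-field system has a unique solution from every initial occupancy sequence
    (∀ lam : ℝ, 0 < lam → lam < 1 → ∀ p ∈ occupancySpace,
      ∃ qbar : ℝ → ℕ → ℝ, IsMeanFieldSolution lam d qbar ∧ qbar 0 = p ∧
        ∀ q' : ℝ → ℕ → ℝ, IsMeanFieldSolution lam d q' → q' 0 = p →
          ∀ t : ℝ, 0 ≤ t → q' t = qbar t) ∧
    -- the process-level bound
    ∃ c : ℝ, 1 ≤ c ∧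
      ∀ (V W : Type*) [Fintype V] [Nonempty V] [Fintype W] [Nonempty W]
        (E : Finset (V × W)), (∀ w : W, ∃ v : V, (v, w) ∈ E) →
      ∀ lam : ℝ, 0 < lam → lam < 1 → graphLoad lam E ≤ rho0 →
      ∀ qbar : ℝ → ℕ → ℝ, IsMeanFieldSolution lam d qbar →
      ∀ (Ω : Type*) [mΩ : MeasurableSpace Ω] (P : Measure Ω) [IsProbabilityMeasure P]
        (𝓕 : Filtration ℝ≥0 mΩ) (X : ℝ≥0 → Ω → V → ℕ), IsQueueProcess lam d E P 𝓕 X →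
      ∀ t : ℝ≥0,
        ∫⁻ ω, ⨆ s ∈ Set.Icc (0 : ℝ≥0) t,
            sqSum (fun i => globalFrac (X s ω) i - qbar s i) ∂P ≤
          ENNReal.ofReal (2 * graphPhi E ^ 2) *
            (ENNReal.ofReal (lam * t) + ∫⁻ ω, sqSum (globalFrac (X 0 ω)) ∂P) +
          ENNReal.ofReal (12 * Real.exp (c * (t : ℝ) ^ 2)) *
            (ENNReal.ofReal ((t : ℝ) ^ 2 * (d : ℝ) ^ 2 * graphPhi E ^ 2) +
              ∫⁻ ω, sqSum (localDiscrepancy E (X 0 ω) (qbar 0)) ∂P +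
              ENNReal.ofReal (4 * t * (rho0 * d + 1) * graphGamma E)) := by
  -- The constant `c = 48 * (d ^ 2 + d + 1) ^ 2` is the Grönwall exponent; the load affects the
  -- exponential only through `ρ ≤ 1`, so `c` depends on `d` alone.
  refine ⟨fun lam h0 h1 p hp => ⟨picardLimit lam d p,
    isMeanFieldSolution_picardLimit h0.le (by omega) hp, picardLimit_zero h0.le (by omega) hp,
    fun q' hq' h t ht => ?_⟩, 48 * ((d : ℝ) ^ 2 + d + 1) ^ 2, ?_, ?_⟩
  · exact hq'.unique h0.le (isMeanFieldSolution_picardLimit h0.le (by omega) hp)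
      (by rw [h, picardLimit_zero h0.le (by omega) hp]) t ht
  · have h1 : (1 : ℝ) ≤ (d : ℝ) ^ 2 + d + 1 := by
      have : (0 : ℝ) ≤ (d : ℝ) ^ 2 + d := by positivity
      linarith
    nlinarith
  · intro V W _ _ _ _ E hE lam h0 h1 hρ qbar hq Ω _ P _ 𝓕 X hX t
    exact hX.lintegral_iSup_sqSum_le hq (by omega) h0.le h1.le hE hρ
      ((graphLoad_nonneg h0.le E).trans hρ) hrho0.le t
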